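/- \textbf{Setting.} Let $M$ be a smooth connected (Hausdorff, second countable) Riemannian manifold without boundary, of dimension $d\ge 2$, with Riemannian measure $\nu_M$. Let $m:M\to[0,\infty)$ be a smooth Morse function such that $m^{-1}([0,b])$ is compact for every $b>0$, each critical value corresponds to exactly one critical point, and $m(M)=[0,\infty)$ if $M$ is non-compact, $m(M)=[0,1]$ if $M$ is compact. For a regular value $t$ let $J_t=m^{-1}(t)$, with the metric inherited from $M$ and its Riemannian measure $\nu_t$. Let $1\le p<\infty$. \emph{$H$-operators.} On a manifold $X$ ($X=M$ or $X=J_t$), a simple $H$-operator is $H_{\varphi,\Phi,V}f(x)=\varphi(x)f(\Phi(x))$ for $x\in V$, and $0$ for $x\notin V$, where $\Phi:V\to V'$ is a $C^\infty$ diffeomorphism of open subsets of $X$ and $\varphi\in C^\infty(X)$ has compact support contained in $V$. $\mathcal H(X)$ is the space of finite linear combinations of such operators; $T\in\mathcal H(X)$ is localized on an open set $U$ if it is a finite linear combination of simple $H$-operators with $V\subset U$ and $\Phi(V)\subset U$. Such an operator, defined on $C_0(X)$, is said to induce a bounded operator on $L^p(X,\mu)$ if the latter extends it from $C_0(X)\cap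 L^p(X,\mu)$. \emph{Smooth decompositions.} Let $A$ be a bounded operator on $L^p(X,\mu)$ and let $\mathcal U$ be a cover of $Y\subset X$ by open precompact sets. A family $\{P_U\}_{U\in\mathcal U}$ is a smooth decomposition of $A$ with constant $C>0$ subordinate to $\mathcal U$ if: for each compact $K$ all but finitely many of the $P_U$ with $U\cap K\neq\emptyset$ are zero; each $P_U\in\mathcal H(X)$ is localized on $U$ and induces a projection on $L^p(X,\mu)$; $P_U\circ P_{U'}=0$ for $U\ne U'$; $\sum_U P_U=A$ unconditionally in the strong operator topology; and $\frac1C\|Af\|_p\le\big(\sum_U\|P_Uf\|_p^p\big)^{1/p}\le C\|Af\|_p$ for all $f\in L^p(X,\mu)$. It is a smooth decomposition of identity if $Y=X$ and $A=\mathbf I$. \emph{Parametrization of a strip.} Let $I=(a,b)$ be such that $[a,b]$ contains no critical value of $m$, and put $M_I=m^{-1}(I)$. Let $F_{t,t'}:J_t\to J_{t'}$ $(t,t'\in I)$ be any family of diffeomorphisms with $F_{t,t'}^{-1}=F_{t',t}$ and $F_{t',t''}\circ F_{t,t'}=F_{t,t''}$, for which each $F_t(t',x)=F_{t,t'}(x)$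 is a diffeomorphism of $I\times J_t$ onto $M_I$ (for instance the flow of $\operatorname{grad}m/|\operatorname{grad}m|^2$), and such that there are smooth functions $\psi_t:I\times J_t\to(0,\infty)$ with $(F_t^{-1})_*(\nu_M|_{M_I})=\psi_t\,(\lambda\times\nu_t)$, $\lambda$ being Lebesgue measure. \emph{Latitudinal projections.} Let $\delta>0$ and let $s:\mathbb R\to[0,1]$ be smooth with $\operatorname{supp}s\subset(-\delta,\infty)$ and $s^2(t)+s^2(-t)=1$. If $(\vartheta-\delta,\vartheta+\delta)\subset I$, let $E_\vartheta f(y)=f(y)$ if $m(y)\ge\vartheta+\delta$, $E_\vartheta f(y)=0$ if $m(y)\le\vartheta-\delta$, and, for $y=F_\vartheta(t,x)$ with $|t-\vartheta|<\delta$, \[E_\vartheta f(y)=s^2(t-\vartheta)f(y)+s(t-\vartheta)s(\vartheta-t)\Big(\tfrac{\psi_\vartheta(2\vartheta-t,x)}{\psi_\vartheta(t,x)}\Big)^{1/p}f(F_\vartheta(2\vartheta-t,x)).\] Put $Q_{\vartheta_1,\vartheta_2}=E_{\vartheta_1}-E_{\vartheta_2}$ and $B_p=\sup_{0\le\xi\le1}\left\|\begin{bmatrix}\xi&\sqrt{\xi(1-\xi)}\\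 \sqrt{\xi(1-\xi)}&1-\xi\end{bmatrix}\right\|_{\ell^p\to\ell^p}$. \emph{Lifting.} For $\vartheta\in I$ write $\psi=\psi_\vartheta$. For $P\in\mathcal H(J_\vartheta)$ the global lifting operator $\Pi^M$ is given by $\Pi^Mf=0$ on $M\setminus M_I$ and, for $y=F_\vartheta(t,x)$ with $(t,x)\in I\times J_\vartheta$, \[\Pi^Mf(y)=P\Big(f(F_\vartheta(t,\cdot))\big(\tfrac{\psi(t,\cdot)}{\psi(\vartheta,\cdot)}\big)^{1/p}\Big)(x)\,\big(\tfrac{\psi(\vartheta,x)}{\psi(t,x)}\big)^{1/p}.\] \textbf{Theorem.} Let $\vartheta_1+\delta<\vartheta_2-\delta$ and $\vartheta\in[\vartheta_1,\vartheta_2]$, let $m$ take only regular values in $[\vartheta_1-\delta,\vartheta_2+\delta]$, and let $I=(a,b)$ be as above with $a\le\vartheta_1-\delta$ and $\vartheta_2+\delta\le b$ (for instance $I=(\vartheta_1-\delta,\vartheta_2+\delta)$). For an open set $U\subset J_\vartheta$ put $O(U)=\bigcup_{t\in(\vartheta_1-\delta,\vartheta_2+\delta)}F_{\vartheta,t}(U)$.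 Then the following holds. (i) Let $P_U\in\mathcal H(J_\vartheta)$ be localized on the open set $U\subset J_\vartheta$ and induce a projection $P_U$ on $L^p(J_\vartheta,\psi(\vartheta,\cdot)\nu_\vartheta)$, and let $\Pi^M_U$ be its global lifting operator. Then $\Pi^M_U\circ Q_{\vartheta_1,\vartheta_2}=Q_{\vartheta_1,\vartheta_2}\circ\Pi^M_U$; this operator, denoted by $P_{O(U)}$, belongs to $\mathcal H(M)$, is localized on the open set $O(U)$, and induces a projection on $L^p(M)$ with norm at most $B_p\|P_U\|$, where $\|P_U\|$ is the norm on $L^p(J_\vartheta,\psi(\vartheta,\cdot)\nu_\vartheta)$. (ii) Let $\{P_U\}_{U\in\mathcal U}$ be a smooth decomposition of identity in $L^p(J_\vartheta,\psi(\vartheta,\cdot)\nu_\vartheta)$ with constant $C$, subordinate to a finite open cover $\mathcal U$ of $J_\vartheta$. Then $Q_{\vartheta_1,\vartheta_2}$ induces a bounded operator on $L^p(M)$, $\sum_{U\in\mathcal U}P_{O(U)}=Q_{\vartheta_1,\vartheta_2}$, and $\{P_{O(U)}\}_{U\in\mathcal U}$ is a smooth decomposition of $Q_{\vartheta_1,\vartheta_2}$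 on $L^p(M)$, subordinate to the open cover $\{O(U)\}_{U\in\mathcal U}$ of $m^{-1}(\vartheta_1-\delta,\vartheta_2+\delta)$, with the same constant $C$. If in addition $p=2$ and the projections $P_U$ are orthogonal on $L^2(J_\vartheta,\psi(\vartheta,\cdot)\nu_\vartheta)$, then so are the projections $P_{O(U)}$ on $L^2(M)$. -/

import Mathlib

open MeasureTheory Set Topology Bundle
open scoped Manifold ContDiff ENNReal ZeroAtInfty

noncomputable section

/-! ### Smooth maps on embedded submanifolds -/

/-- A map `f` defined on (a subset `V` of) a space `X` which is placed in a manifold `N` by an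
embedding `e : X → N` is smooth if, locally around each point of `V`, it is the restriction of a
smooth map defined on an open subset of `N`.  With `e = id` this is ordinary smoothness; with `e`
the inclusion of an embedded submanifold this is smoothness on the submanifold. -/
def SmoothAlong {X EN HN N EN' HN' N' : Type*}
    [NormedAddCommGroup EN] [NormedSpace ℝ EN] [TopologicalSpace HN]
    [TopologicalSpace N] [ChartedSpace HN N]
    [NormedAddCommGroup EN'] [NormedSpace ℝ EN'] [TopologicalSpace HN']
    [TopologicalSpace N'] [ChartedSpace HN' N']
    (I : ModelWithCorners ℝ EN HN) (I' : ModelWithCorners ℝ EN' HN')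
    (e : X → N) (f : X → N') (V : Set X) : Prop :=
  ∀ x ∈ V, ∃ W : Set N, IsOpen W ∧ e x ∈ W ∧ ∃ g : N → N', ContMDiffOn I I' ∞ g W ∧
    ∀ y ∈ V, e y ∈ W → g (e y) = f y

/-! ### Riemannian measure -/

section Measures

variable (d : ℕ) {M : Type*} [TopologicalSpace M] [ChartedSpace (EuclideanSpace ℝ (Fin d)) M]

/-- A smooth local parametrization, by an open subset (`c.source`) of `ℝᵏ`, of an open subset
(`c.target`) of the `k`-dimensional submanifold of `M` embedded by `e : X → M`. -/
def IsLocalParam {X : Type*} [TopologicalSpace X] (e : X → M) {k : ℕ}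
    (c : OpenPartialHomeomorph (EuclideanSpace ℝ (Fin k)) X) : Prop :=
  ContMDiffOn (𝓡 k) (𝓡 d) ∞ (e ∘ c) c.source ∧
    ∀ u ∈ c.source, Function.Injective (mfderiv (𝓡 k) (𝓡 d) (e ∘ c) u)

variable [RiemannianBundle (fun x : M => TangentSpace (𝓡 d) x)]

/-- The volume density `√(det g(∂ᵢγ, ∂ⱼγ))` at `u` of a map `γ` from `ℝᵏ` to the Riemannian
manifold `M`. -/
def gramDensity {k : ℕ} (γ : EuclideanSpace ℝ (Fin k) → M) (u : EuclideanSpace ℝ (Fin k)) : ℝ :=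
  √(Matrix.det (Matrix.of fun i j : Fin k =>
    (inner ℝ (mfderiv (𝓡 k) (𝓡 d) γ u (EuclideanSpace.single i (1 : ℝ)))
      (mfderiv (𝓡 k) (𝓡 d) γ u (EuclideanSpace.single j (1 : ℝ))) : ℝ)))

/-- The measure on `X` which a local parametrization `c` gives to the parametrized piece: the image
of `√(det g(∂ᵢ, ∂ⱼ)) du`. -/
def paramMeasure {X : Type*} [TopologicalSpace X] [MeasurableSpace X] (e : X → M) {k : ℕ}
    (c : OpenPartialHomeomorph (EuclideanSpace ℝ (Fin k)) X) : Measure X :=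
  ((volume.restrict c.source).withDensity
    (fun u => ENNReal.ofReal (gramDensity d (e ∘ c) u))).map c

/-- The Riemannian measure of the `k`-dimensional submanifold of `M` embedded by `e : X → M`, for
the metric inherited from `M`: the least measure which dominates the measures of all parametrized
pieces (these agree on overlaps, so it restricts to each of them). -/
def submanifoldMeasure {X : Type*} [TopologicalSpace X] [MeasurableSpace X] (e : X → M) (k : ℕ) :
    Measure X :=
  ⨆ c : {c : OpenPartialHomeomorph (EuclideanSpace ℝ (Fin k)) X // IsLocalParam d e c},
    paramMeasure d e c.1

variable (M) in
/-- The Riemannian measure `ν_M` of the `d`-dimensional Riemannian manifold `M`. -/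
def riemannianMeasure [MeasurableSpace M] : Measure M :=
  submanifoldMeasure d (id : M → M) d

/-- The level set `J_t = m⁻¹(t)`. -/
def levelSet {M : Type*} (m : M → ℝ) (t : ℝ) : Set M := m ⁻¹' {t}

/-- The Riemannian measure `ν_t` of the level submanifold `J_t`, of dimension `d - 1`, for the
metric inherited from `M`. -/
def levelMeasure [MeasurableSpace M] (m : M → ℝ) (t : ℝ) : Measure (levelSet m t) :=
  submanifoldMeasure d (Subtype.val : levelSet m t → M) (d - 1)

end Measures

/-! ### Hestenes operators -/

section Hestenes

variable (d : ℕ) {M : Type*} [TopologicalSpace M] [ChartedSpace (EuclideanSpace ℝ (Fin d)) M]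
  {X : Type*} [TopologicalSpace X]

/-- The data `(φ, Φ, V)` of a simple `H`-operator on the (sub)manifold embedded by `e : X → M`:
a diffeomorphism `Φ : V → V'` between open subsets, `V = Φ.source`, `V' = Φ.target`, and a
compactly supported smooth function `φ` with `supp φ ⊆ V`. -/
structure SimpleHData (e : X → M) where
  φ : X → ℝ
  Φ : OpenPartialHomeomorph X X
  smooth_φ : SmoothAlong (𝓡 d) 𝓘(ℝ, ℝ) e φ univ
  compact_φ : HasCompactSupport φ
  supp_φ : tsupport φ ⊆ Φ.source
  smooth_Φ : SmoothAlong (𝓡 d) (𝓡 d) e (e ∘ Φ) Φ.source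
  smooth_Φ_symm : SmoothAlong (𝓡 d) (𝓡 d) e (e ∘ Φ.symm) Φ.target

variable {d} in
open Classical in
/-- The simple `H`-operator `H_{φ,Φ,V}`, acting on functions `X → ℝ`. -/
def SimpleHData.op {e : X → M} (H : SimpleHData d e) : Module.End ℝ (X → ℝ) where
  toFun f x := if x ∈ H.Φ.source then H.φ x * f (H.Φ x) else 0
  map_add' f g := by
    funext x
    by_cases hx : x ∈ H.Φ.source <;> simp [hx, mul_add]
  map_smul' r f := by
    funext x
    by_cases hx : x ∈ H.Φ.source
    · simp [hx]; ring
    · simp [hx]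

/-- The space of `H`-operators: finite linear combinations of simple `H`-operators.  An `H`-operator
maps `C₀(X)` to itself and, being at each point a finite combination of point evaluations, is
determined by its values on `C₀(X)`; it is let act on all functions by the same formula. -/
def HOperators (e : X → M) : Submodule ℝ (Module.End ℝ (X → ℝ)) :=
  Submodule.span ℝ {T | ∃ H : SimpleHData d e, T = H.op}

/-- The `H`-operators localized on `U`: finite linear combinations of simple `H`-operators
`H_{φ,Φ,V}` with `V ⊆ U` and `Φ(V) ⊆ U`. -/
def HOperatorsOn (e : X → M) (U : Set X) : Submodule ℝ (Module.End ℝ (X → ℝ)) :=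
  Submodule.span ℝ {T | ∃ H : SimpleHData d e, H.Φ.source ⊆ U ∧ H.Φ.target ⊆ U ∧ T = H.op}

end Hestenes

/-! ### Operators induced on `Lᵖ` and smooth decompositions -/

section Decomposition

variable {X : Type*} [TopologicalSpace X] [MeasurableSpace X]

/-- `T` is the bounded operator which `P`, given on `C₀(X)`, induces on `Lᵖ(X, μ)`. -/
def Induces {p : ℝ≥0∞} [Fact (1 ≤ p)] {μ : Measure X} (P : Module.End ℝ (X → ℝ))
    (T : Lp ℝ p μ →L[ℝ] Lp ℝ p μ) : Prop :=
  ∀ (f : C₀(X, ℝ)) (hf : MemLp (f : X → ℝ) p μ), T (hf.toLp (f : X → ℝ)) =ᵐ[μ] P f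

/-- Symmetry of an operator for the pairing `∫ f h dμ`; for `p = 2` this is self-adjointness, and a
projection which has this property is an orthogonal one. -/
def IsSymmetricLp {p : ℝ≥0∞} [Fact (1 ≤ p)] {μ : Measure X}
    (T : Lp ℝ p μ →L[ℝ] Lp ℝ p μ) : Prop :=
  ∀ f h : Lp ℝ p μ, ∫ x, T f x * h x ∂μ = ∫ x, f x * T h x ∂μ

/-- The operators `P i`, which induce the operators `T i` on `Lᵖ(X, μ)`, form a smooth decomposition
of the operator `A` on `Lᵖ(X, μ)`, with decomposition constant `C`, subordinate to the open and
precompact cover `𝒰` of `Y`.  A smooth decomposition of identity is the case `Y = X`, `A = id`. -/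
structure IsSmoothDecomposition (d : ℕ) {M : Type*} [TopologicalSpace M]
    [ChartedSpace (EuclideanSpace ℝ (Fin d)) M] (e : X → M)
    {p : ℝ≥0∞} [Fact (1 ≤ p)] {μ : Measure X} {ι : Type*} (Y : Set X) (𝒰 : ι → Set X)
    (P : ι → Module.End ℝ (X → ℝ)) (T : ι → (Lp ℝ p μ →L[ℝ] Lp ℝ p μ))
    (A : Lp ℝ p μ →L[ℝ] Lp ℝ p μ) (C : ℝ) : Prop where
  isOpen : ∀ i, IsOpen (𝒰 i)
  precompact : ∀ i, IsCompact (closure (𝒰 i))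
  cover : ⋃ i, 𝒰 i = Y
  locallyFinite : ∀ K : Set X, IsCompact K → {i | (𝒰 i ∩ K).Nonempty ∧ P i ≠ 0}.Finite
  localized : ∀ i, P i ∈ HOperatorsOn d e (𝒰 i)
  induces : ∀ i, Induces (P i) (T i)
  projection : ∀ i, T i ∘L T i = T i
  disjoint : ∀ i j, i ≠ j → T i ∘L T j = 0
  hasSum : ∀ f, HasSum (fun i => T i f) (A f)
  const_pos : 0 < C
  summable : ∀ f, Summable fun i => ‖T i f‖ ^ p.toReal
  lower : ∀ f, 1 / C * ‖A f‖ ≤ (∑' i, ‖T i f‖ ^ p.toReal) ^ (1 / p.toReal)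
  upper : ∀ f, (∑' i, ‖T i f‖ ^ p.toReal) ^ (1 / p.toReal) ≤ C * ‖A f‖

end Decomposition

/-! ### Morse functions and parametrizations of regular strips -/

section Morse

variable (d : ℕ) {M : Type*} [TopologicalSpace M] [ChartedSpace (EuclideanSpace ℝ (Fin d)) M]

/-- `x` is a critical point of `m`. -/
def IsCritical (m : M → ℝ) (x : M) : Prop := mfderiv (𝓡 d) 𝓘(ℝ, ℝ) m x = 0

/-- A Morse function `m : M → [0, ∞)` with compact sublevel sets, at most one critical point on each
level, and range `[0, ∞)` or `[0, 1]` according as `M` is non-compact or compact. -/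
structure IsProperMorse (m : M → ℝ) : Prop where
  smooth : ContMDiff (𝓡 d) 𝓘(ℝ, ℝ) ∞ m
  nonneg : ∀ x, 0 ≤ m x
  /-- The Hessian of `m`, in a chart around a critical point, is nondegenerate. -/
  nondegenerate : ∀ x, IsCritical d m x → Function.Injective
    (fderiv ℝ (fderiv ℝ (m ∘ (extChartAt (𝓡 d) x).symm)) (extChartAt (𝓡 d) x x))
  isCompact_sublevel : ∀ b : ℝ, 0 < b → IsCompact (m ⁻¹' Icc 0 b)
  critical_unique : ∀ x y, IsCritical d m x → IsCritical d m y → m x = m y → x = y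
  range_noncompact : NoncompactSpace M → range m = Ici 0
  range_compact : CompactSpace M → range m = Icc 0 1

variable [RiemannianBundle (fun x : M => TangentSpace (𝓡 d) x)] [MeasurableSpace M]

/-- A parametrization of the strip `M_I = m⁻¹(I)`, `I = (a, b)`, along the level submanifolds:
diffeomorphisms `F s t : J_s → J_t` with `F s t = (F t s)⁻¹` and `F t r ∘ F s t = F s r`, such that
`F_s : (t, x) ↦ F s t x` is a diffeomorphism of `I × J_s` onto `M_I`, together with the smooth
positive weight `ψ s` on `I × J_s`, namely the density for which `F_s` carries the measure
`ψ s · (λ × ν_s)` to the Riemannian measure on `M_I`. -/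
structure StripParam (m : M → ℝ) (a b : ℝ) where
  F : ∀ s t : Ioo a b, levelSet m s → levelSet m t
  F_inv : ∀ s t x, F t s (F s t x) = x
  F_comp : ∀ s t r x, F t r (F s t x) = F s r x
  smooth_F : ∀ s : Ioo a b, SmoothAlong (𝓘(ℝ, ℝ).prod (𝓡 d)) (𝓡 d)
    (fun q : Ioo a b × levelSet m s => ((q.1 : ℝ), (q.2 : M)))
    (fun q => (F s q.1 q.2 : M)) univ
  /-- The inverse of `F_s` is `y ↦ (m y, F (m y) s y)`; its second component is smooth. -/
  smooth_F_inv : ∀ s : Ioo a b, SmoothAlong (𝓡 d) (𝓡 d)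
    (fun y : m ⁻¹' Ioo a b => (y : M))
    (fun y => (F ⟨m y, y.2⟩ s ⟨y, rfl⟩ : M)) univ
  ψ : ∀ s : Ioo a b, Ioo a b → levelSet m s → ℝ
  ψ_pos : ∀ s t x, 0 < ψ s t x
  smooth_ψ : ∀ s : Ioo a b, SmoothAlong (𝓘(ℝ, ℝ).prod (𝓡 d)) 𝓘(ℝ, ℝ)
    (fun q : Ioo a b × levelSet m s => ((q.1 : ℝ), (q.2 : M)))
    (fun q => ψ s q.1 q.2) univ
  map_eq : ∀ s : Ioo a b,
    (((((volume : Measure ℝ).comap (Subtype.val : Ioo a b → ℝ)).prod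
      (levelMeasure d m s)).withDensity (fun q => ENNReal.ofReal (ψ s q.1 q.2))).map
        (fun q => (F s q.1 q.2 : M))) = (riemannianMeasure d M).restrict (m ⁻¹' Ioo a b)

/-! ### Latitudinal projections -/

/-- The cut-off functions `s : ℝ → [0, 1]` in the Auscher–Weiss–Wickerhauser operators. -/
structure IsAWWCutoff (δ : ℝ) (s : ℝ → ℝ) : Prop where
  smooth : ContDiff ℝ ∞ s
  mem_Icc : ∀ t, s t ∈ Icc (0 : ℝ) 1
  supp : tsupport s ⊆ Ioi (-δ)
  sq_add_sq : ∀ t, s t ^ 2 + s (-t) ^ 2 = 1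

variable {d} {m : M → ℝ} {a b : ℝ}

open Classical in
/-- The Auscher–Weiss–Wickerhauser operator `E_ϑ` on `M`, for the exponent `p` and the cut-off `s`.
A point `y` with `t = m y` in `(ϑ - δ, ϑ + δ)` is written as `F_ϑ(t, x)`.  The operator is used only
when `(ϑ - δ, ϑ + δ) ⊆ (a, b)`; then `t` and `2ϑ - t` automatically lie in `(a, b)`. -/
def StripParam.aww (R : StripParam d m a b) (p : ℝ≥0∞) (s : ℝ → ℝ) (δ : ℝ) (ϑ : Ioo a b) :
    Module.End ℝ (M → ℝ) where
  toFun f y :=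
    if (ϑ : ℝ) + δ ≤ m y then f y
    else if h : m y ∈ Ioo ((ϑ : ℝ) - δ) (ϑ + δ) ∧ m y ∈ Ioo a b ∧ 2 * (ϑ : ℝ) - m y ∈ Ioo a b then
      let t : Ioo a b := ⟨m y, h.2.1⟩
      let t' : Ioo a b := ⟨2 * (ϑ : ℝ) - m y, h.2.2⟩
      let x : levelSet m ϑ := R.F t ϑ ⟨y, rfl⟩
      s (t - ϑ) ^ 2 * f y
        + s (t - ϑ) * s (-t + ϑ) * (R.ψ ϑ t' x / R.ψ ϑ t x) ^ (1 / p.toReal) * f (R.F ϑ t' x)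
    else 0
  map_add' f g := by
    funext y
    simp only [Pi.add_apply]
    split_ifs
    · rfl
    · ring
    · simp
  map_smul' r f := by
    funext y
    simp only [Pi.smul_apply, smul_eq_mul, RingHom.id_apply]
    split_ifs
    · rfl
    · ring
    · simp

/-- The latitudinal projection `Q_{ϑ₁,ϑ₂} = E_{ϑ₁} - E_{ϑ₂}`. -/
def StripParam.latitudinal (R : StripParam d m a b) (p : ℝ≥0∞) (s : ℝ → ℝ) (δ : ℝ)
    (ϑ₁ ϑ₂ : Ioo a b) : Module.End ℝ (M → ℝ) :=
  R.aww p s δ ϑ₁ - R.aww p s δ ϑ₂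

/-- The constant `B_p = sup_{0 ≤ ξ ≤ 1} ‖A_ξ‖_{p → p}`, the norm of the one-dimensional
Auscher–Weiss–Wickerhauser operators on `Lᵖ(ℝ)`. -/
def awwConst (p : ℝ≥0∞) [Fact (1 ≤ p)] : ℝ :=
  ⨆ ξ : Icc (0 : ℝ) 1, ‖LinearMap.toContinuousLinearMap (Matrix.toLpLin p p
    !![(ξ : ℝ), √((ξ : ℝ) * (1 - ξ)); √((ξ : ℝ) * (1 - ξ)), 1 - (ξ : ℝ)])‖

/-! ### Lifting of operators from a level submanifold -/

/-- The weighted measure `ψ(ϑ, ·) ν_ϑ` on the level submanifold `J_ϑ`. -/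
def StripParam.weightedMeasure (R : StripParam d m a b) (ϑ : Ioo a b) : Measure (levelSet m ϑ) :=
  (levelMeasure d m ϑ).withDensity fun x => ENNReal.ofReal (R.ψ ϑ ϑ x)

/-- The operator `P_t` on functions on `J_ϑ`. -/
def StripParam.liftAt (R : StripParam d m a b) (p : ℝ≥0∞) (ϑ : Ioo a b)
    (P : Module.End ℝ (levelSet m ϑ → ℝ)) (t : Ioo a b) (f : levelSet m ϑ → ℝ) :
    levelSet m ϑ → ℝ :=
  fun x => P (fun z => f z * (R.ψ ϑ t z / R.ψ ϑ ϑ z) ^ (1 / p.toReal)) x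
    * (R.ψ ϑ ϑ x / R.ψ ϑ t x) ^ (1 / p.toReal)

/-- The local lifting operator `Π` on functions on `I × J_ϑ`. -/
def StripParam.localLift (R : StripParam d m a b) (p : ℝ≥0∞) (ϑ : Ioo a b)
    (P : Module.End ℝ (levelSet m ϑ → ℝ)) (h : Ioo a b × levelSet m ϑ → ℝ) :
    Ioo a b × levelSet m ϑ → ℝ :=
  fun q => R.liftAt p ϑ P q.1 (fun x => h (q.1, x)) q.2

open Classical in
/-- The global lifting operator `Π^M` on functions on `M`: it is `Π(f ∘ F_ϑ)(t, x)` at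
`y = F_ϑ(t, x)` in `M_I`, and `0` outside `M_I`. -/
def StripParam.globalLift (R : StripParam d m a b) (p : ℝ≥0∞) (ϑ : Ioo a b)
    (P : Module.End ℝ (levelSet m ϑ → ℝ)) : Module.End ℝ (M → ℝ) where
  toFun f y :=
    if h : m y ∈ Ioo a b then
      R.localLift p ϑ P (fun q => f (R.F ϑ q.1 q.2)) (⟨m y, h⟩, R.F ⟨m y, h⟩ ϑ ⟨y, rfl⟩)
    else 0
  map_add' f g := by
    funext y
    by_cases h : m y ∈ Ioo a b
    · simp only [h, dite_true, StripParam.localLift, StripParam.liftAt, Pi.add_apply, add_mul]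
      rw [← add_mul, ← Pi.add_apply, ← map_add]
      rfl
    · simp only [Pi.add_apply, dif_neg h, add_zero]
  map_smul' r f := by
    funext y
    by_cases h : m y ∈ Ioo a b
    · simp only [h, dite_true, StripParam.localLift, StripParam.liftAt, Pi.smul_apply,
        smul_eq_mul, RingHom.id_apply]
      rw [← mul_assoc, ← smul_eq_mul r, ← Pi.smul_apply, ← map_smul]
      congr 2
      refine congrFun (congrArg P ?_) _
      funext z
      simp [mul_assoc]
    · simp only [Pi.smul_apply, dif_neg h, smul_zero]

/-- The set `O(U) = ⋃ F_{ϑ,s}(U)`, the union over `s` in `(ϑ₁ - δ, ϑ₂ + δ)`. -/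
def StripParam.liftSet (R : StripParam d m a b) (δ : ℝ) (ϑ₁ ϑ₂ ϑ : Ioo a b)
    (U : Set (levelSet m ϑ)) : Set M :=
  {y | ∃ s : Ioo a b, (s : ℝ) ∈ Ioo ((ϑ₁ : ℝ) - δ) (ϑ₂ + δ) ∧ ∃ x ∈ U, (R.F ϑ s x : M) = y}

/-- The operator `P_{O(U)} = Π^M ∘ Q_{ϑ₁,ϑ₂}`. -/
def StripParam.liftedOp (R : StripParam d m a b) (p : ℝ≥0∞) (s : ℝ → ℝ) (δ : ℝ)
    (ϑ₁ ϑ₂ ϑ : Ioo a b) (P : Module.End ℝ (levelSet m ϑ → ℝ)) : Module.End ℝ (M → ℝ) :=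
  R.globalLift p ϑ P ∘ₗ R.latitudinal p s δ ϑ₁ ϑ₂

end Morse

end

/-!
The parametrization `F_ϑ` identifies the strip `m⁻¹(a, b)` with `(a, b) × J_ϑ`.  A function `f` on
`M` is replaced by its slices `f_t`, `t ∈ (a, b)`, the functions
`x ↦ f(F_ϑ(t, x)) (ψ(t, x) / ψ(ϑ, x))^{1/p}` on `J_ϑ`.  In terms of slices everything becomes a
product: the `Lᵖ(M)` norm over the strip is the `Lᵖ` norm for the product of Lebesgue measure and
`μ = ψ(ϑ, ·) ν_ϑ` (`StripParam.setLIntegral_enorm_rpow`), the lifting `Π^M` of `P` applies `P` to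
each slice (`StripParam.slice_globalLift`), and the latitudinal projection `Q` acts in the variable
`t` alone, by the projection `awwLine` on the line (`StripParam.slice_latitudinal_apply`).  The
commutation, idempotence and sum formulas follow by algebra.

The operators `E_{ϑ₁}` and `E_{ϑ₂}` are defined with the weights `ψ_{ϑ₁}` and `ψ_{ϑ₂}`, so the
statement on `Q` needs that the ratios `ψ_s(t, x) / ψ_s(t', x)` do not depend on the base level `s`
(`StripParam.ψ_change`).  Both products `ψ_s (λ × ν_s)` represent the Riemannian measure, so their
densities differ by a factor which depends on `x` only (`density_ratio_eq`).  This uses that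
the measures `ν_s` are finite and positive on open sets, which is deduced from the corresponding
properties of the Riemannian measure of `M`, and these are checked in charts.

A simple `H`-operator on the level lifts to three simple `H`-operators on `M`, one for each of the
three terms `f_t`, `f_{2ϑ₁-t}`, `f_{2ϑ₂-t}` of `Q f` (`StripParam.liftedOp_mem_HOperatorsOn`).

On the line, `awwLine` acts on pairs `(g(t), g(2θ - t))` by the matrices `A_ξ`, so its norm is at
most `B_p` (`lintegral_awwLine_le`).  Integrating over lines first and over levels second gives
`‖Π^M Q f‖ ≤ B_p ‖P‖ ‖f‖` for `f ∈ C₀(M) ∩ Lᵖ(M)`, and density extends this to `Lᵖ(M)`.  The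
identities between operators on `Lᵖ(J_ϑ)` are identities between `H`-operators, because an
`H`-operator is determined by its values on continuous functions; hence they lift.  The two-sided
estimate with constant `C` holds for each slice of `Q f`, and integrating it in `t` gives the
estimate on `M` with the same constant.

For `p = 2` a symmetric projection on the level has norm at most one and `B_2 ≤ 1`, so the lifted
projection is an idempotent contraction of a Hilbert space, and as such it is symmetric.
-/

/-! ### The Riemannian measure in charts -/

section RiemannianMeasure

lemma OpenPartialHomeomorph.measurableSet_inter_preimage {X Y : Type*} [TopologicalSpace X]
    [TopologicalSpace Y] [MeasurableSpace X] [BorelSpace X] [MeasurableSpace Y] [BorelSpace Y]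
    (c : OpenPartialHomeomorph X Y) {A : Set Y} (hA : MeasurableSet A) :
    MeasurableSet (c.source ∩ c ⁻¹' A) := by
  have h := (continuousOn_iff_continuous_domRestrict.1 c.continuousOn).measurable hA
  have h' := c.open_source.measurableSet.subtype_image h
  convert h' using 1
  ext x
  simp [and_comm]

lemma isLocalParam_chart_symm {d : ℕ} {M : Type*} [TopologicalSpace M]
    [ChartedSpace (EuclideanSpace ℝ (Fin d)) M] [IsManifold (𝓡 d) ∞ M] (x : M) :
    IsLocalParam d (id : M → M) (chartAt (EuclideanSpace ℝ (Fin d)) x).symm :=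
  ⟨contMDiffOn_chart_symm, fun _ hu =>
    ((mdifferentiable_chart (I := 𝓡 d) x).symm).mfderiv_injective hu⟩

variable {d : ℕ} {M : Type*} [TopologicalSpace M] [ChartedSpace (EuclideanSpace ℝ (Fin d)) M]
  [RiemannianBundle (fun x : M => TangentSpace (𝓡 d) x)]

/-- Chain rule for volume densities: the Gram matrix of `γ ∘ τ` is `Aᵀ G A`, where `A` is the
Jacobian matrix of `τ` and `G` the Gram matrix of `γ`. -/
lemma gramDensity_comp {k : ℕ} {γ : EuclideanSpace ℝ (Fin k) → M}
    {τ : EuclideanSpace ℝ (Fin k) → EuclideanSpace ℝ (Fin k)} {u : EuclideanSpace ℝ (Fin k)}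
    (hγ : MDifferentiableAt (𝓡 k) (𝓡 d) γ (τ u)) (hτ : DifferentiableAt ℝ τ u) :
    gramDensity d (γ ∘ τ) u = |(fderiv ℝ τ u).det| * gramDensity d γ (τ u) := by
  have hc : mfderiv (𝓡 k) (𝓡 d) (γ ∘ τ) u
      = (mfderiv (𝓡 k) (𝓡 d) γ (τ u)).comp (fderiv ℝ τ u) := by
    rw [mfderiv_comp u hγ hτ.mdifferentiableAt, mfderiv_eq_fderiv]
    rfl
  set b := (EuclideanSpace.basisFun (Fin k) ℝ).toBasis with hb
  set A := LinearMap.toMatrix b b (fderiv ℝ τ u : EuclideanSpace ℝ (Fin k) →ₗ[ℝ] _) with hA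
  have hcol : ∀ i, fderiv ℝ τ u (EuclideanSpace.single i (1 : ℝ))
      = ∑ l, A l i • EuclideanSpace.single l (1 : ℝ) := by
    intro i
    have h := b.sum_repr (fderiv ℝ τ u (EuclideanSpace.single i (1 : ℝ)))
    rw [← h]
    refine Finset.sum_congr rfl fun l _ => ?_
    simp [hA, hb, LinearMap.toMatrix_apply]
  have hdet : A.det = (fderiv ℝ τ u).det := by
    rw [hA, LinearMap.det_toMatrix]
  set L : EuclideanSpace ℝ (Fin k) →L[ℝ] TangentSpace (𝓡 d) (γ (τ u)) :=
    mfderiv (𝓡 k) (𝓡 d) γ (τ u) with hL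
  set G : Matrix (Fin k) (Fin k) ℝ := Matrix.of fun i j : Fin k =>
    (inner ℝ (L (EuclideanSpace.single i (1 : ℝ))) (L (EuclideanSpace.single j (1 : ℝ))) : ℝ)
    with hG
  have hG' : (Matrix.of fun i j : Fin k =>
    (inner ℝ (mfderiv (𝓡 k) (𝓡 d) (γ ∘ τ) u (EuclideanSpace.single i (1 : ℝ)))
      (mfderiv (𝓡 k) (𝓡 d) (γ ∘ τ) u (EuclideanSpace.single j (1 : ℝ))) : ℝ))
      = A.transpose * G * A := by
    ext i j
    rw [hc]
    have e : ∀ i, (L.comp (fderiv ℝ τ u)) (EuclideanSpace.single i (1 : ℝ))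
      = ∑ l, A l i • L (EuclideanSpace.single l (1 : ℝ)) := by
      intro i
      rw [ContinuousLinearMap.comp_apply, hcol, map_sum]
      simp
    change (inner ℝ ((L.comp (fderiv ℝ τ u)) (EuclideanSpace.single i (1 : ℝ)))
      ((L.comp (fderiv ℝ τ u)) (EuclideanSpace.single j (1 : ℝ))) : ℝ) = _
    rw [e, e]
    simp only [Matrix.mul_apply, Matrix.transpose_apply, sum_inner, inner_sum,
      real_inner_smul_left, real_inner_smul_right, Finset.sum_mul, hG, Matrix.of_apply]
    refine Finset.sum_congr rfl fun l _ => Finset.sum_congr rfl fun l' _ => ?_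
    ring
  unfold gramDensity
  rw [hG', Matrix.det_mul, Matrix.det_mul, Matrix.det_transpose, hdet,
    show ∀ x y : ℝ, x * y * x = x ^ 2 * y by intros; ring, Real.sqrt_mul (sq_nonneg _),
    Real.sqrt_sq_eq_abs]
  rfl

lemma gramDensity_congr {k : ℕ} {γ γ' : EuclideanSpace ℝ (Fin k) → M}
    {u : EuclideanSpace ℝ (Fin k)} (h : γ =ᶠ[𝓝 u] γ') :
    gramDensity d γ u = gramDensity d γ' u := by
  have h0 : γ u = γ' u := h.self_of_nhds
  unfold gramDensity
  have : mfderiv (𝓡 k) (𝓡 d) γ u = mfderiv (𝓡 k) (𝓡 d) γ' u := h.mfderiv_eq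
  congr 3
  ext i j
  rw [this]
  congr!

lemma gramDensity_pos {k : ℕ} {γ : EuclideanSpace ℝ (Fin k) → M} {u : EuclideanSpace ℝ (Fin k)}
    (h : Function.Injective (mfderiv (𝓡 k) (𝓡 d) γ u)) : 0 < gramDensity d γ u := by
  refine Real.sqrt_pos.2 ?_
  have hli : LinearIndependent ℝ fun i : Fin k =>
      (mfderiv (𝓡 k) (𝓡 d) γ u (EuclideanSpace.single i (1 : ℝ)) :
        TangentSpace (𝓡 d) (γ u)) := by
    have hb := (EuclideanSpace.basisFun (Fin k) ℝ).toBasis.linearIndependent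
    have := hb.map' (mfderiv (𝓡 k) (𝓡 d) γ u).toLinearMap (LinearMap.ker_eq_bot.2 (by exact h))
    have hfun : (fun i : Fin k => (mfderiv (𝓡 k) (𝓡 d) γ u (EuclideanSpace.single i (1 : ℝ)) :
        TangentSpace (𝓡 d) (γ u))) = (mfderiv (𝓡 k) (𝓡 d) γ u).toLinearMap ∘
          (EuclideanSpace.basisFun (Fin k) ℝ).toBasis := by
      funext i
      change _ = mfderiv (𝓡 k) (𝓡 d) γ u ((EuclideanSpace.basisFun (Fin k) ℝ).toBasis i)
      simp
    rw [hfun]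
    exact this
  exact (Matrix.posDef_gram_of_linearIndependent (𝕜 := ℝ) hli).det_pos

lemma continuousOn_gramDensity {k : ℕ} [IsManifold (𝓡 d) ∞ M]
    [IsContMDiffRiemannianBundle (𝓡 d) ∞ (EuclideanSpace ℝ (Fin d))
      (fun x : M => TangentSpace (𝓡 d) x)]
    {γ : EuclideanSpace ℝ (Fin k) → M} {s : Set (EuclideanSpace ℝ (Fin k))} (hs : IsOpen s)
    (hγ : ContMDiffOn (𝓡 k) (𝓡 d) ∞ γ s) : ContinuousOn (gramDensity d γ) s := by
  have : IsContinuousRiemannianBundle (EuclideanSpace ℝ (Fin d))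
      (fun x : M => TangentSpace (𝓡 d) x) := by
    obtain ⟨g, hg, hg'⟩ := IsContMDiffRiemannianBundle.exists_contMDiff (IB := 𝓡 d) (n := ∞)
      (F := EuclideanSpace ℝ (Fin d)) (E := fun x : M => TangentSpace (𝓡 d) x)
    exact ⟨g, hg.continuous, hg'⟩
  have key : ∀ i : Fin k, ContinuousOn (fun u => (⟨γ u, mfderiv (𝓡 k) (𝓡 d) γ u
      (EuclideanSpace.single i (1 : ℝ))⟩ :
        TotalSpace (EuclideanSpace ℝ (Fin d)) (fun x : M => TangentSpace (𝓡 d) x))) s := by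
    intro i
    have h1 := hγ.continuousOn_tangentMapWithin (by simp) hs.uniqueMDiffOn
    have h2 : ContinuousOn (fun u : EuclideanSpace ℝ (Fin k) =>
        (⟨u, EuclideanSpace.single i (1 : ℝ)⟩ :
          TangentBundle (𝓡 k) (EuclideanSpace ℝ (Fin k)))) s := by
      refine Continuous.continuousOn ?_
      have := (tangentBundleModelSpaceHomeomorph (𝓡 k)).symm.continuous
      exact this.comp (by fun_prop : Continuous fun u : EuclideanSpace ℝ (Fin k) =>
        ((u, EuclideanSpace.single i (1 : ℝ)) : ModelProd _ _))
    refine (h1.comp h2 fun u hu => hu).congr fun u hu => ?_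
    simp only [Function.comp, tangentMapWithin]
    rw [mfderivWithin_of_isOpen hs hu]
  refine Real.continuous_sqrt.comp_continuousOn
    ((Continuous.matrix_det continuous_id).comp_continuousOn ?_)
  refine continuousOn_pi.2 fun i => continuousOn_pi.2 fun j => ?_
  exact (key i).inner_bundle (key j)

lemma continuousOn_gramDensity_chart_symm [IsManifold (𝓡 d) ∞ M]
    [IsContMDiffRiemannianBundle (𝓡 d) ∞ (EuclideanSpace ℝ (Fin d))
      (fun x : M => TangentSpace (𝓡 d) x)] (x : M) :
    ContinuousOn (gramDensity d (chartAt (EuclideanSpace ℝ (Fin d)) x).symm)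
      (chartAt (EuclideanSpace ℝ (Fin d)) x).target :=
  continuousOn_gramDensity (chartAt _ x).open_target contMDiffOn_chart_symm

variable [MeasurableSpace M] [BorelSpace M]

lemma paramMeasure_apply {k : ℕ} {c : OpenPartialHomeomorph (EuclideanSpace ℝ (Fin k)) M}
    {A : Set M} (hA : MeasurableSet A) :
    paramMeasure d (id : M → M) c A =
      ∫⁻ u in c.source ∩ c ⁻¹' A, ENNReal.ofReal (gramDensity d c u) := by
  have hc : AEMeasurable c ((volume.restrict c.source).withDensity
      (fun u => ENNReal.ofReal (gramDensity d (id ∘ c) u))) :=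
    (c.continuousOn.aemeasurable c.open_source.measurableSet).mono_ac
      (withDensity_absolutelyContinuous _ _)
  unfold paramMeasure
  rw [Measure.map_apply_of_aemeasurable hc hA, withDensity_apply' _ _,
    Measure.restrict_restrict' c.open_source.measurableSet, inter_comm]
  rfl

variable [IsManifold (𝓡 d) ∞ M]

/-- The transition map from `c` to a chart has the change of variables formula, so the measure
defined by `c` and that defined by the chart agree on the overlap. -/
lemma paramMeasure_restrict_le (x : M) {c : OpenPartialHomeomorph (EuclideanSpace ℝ (Fin d)) M}
    (hc : IsLocalParam d (id : M → M) c) :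
    (paramMeasure d (id : M → M) c).restrict (chartAt (EuclideanSpace ℝ (Fin d)) x).source ≤
      paramMeasure d (id : M → M) (chartAt (EuclideanSpace ℝ (Fin d)) x).symm := by
  set φ := chartAt (EuclideanSpace ℝ (Fin d)) x with hφ
  refine Measure.le_iff.2 fun A hA => ?_
  rw [Measure.restrict_apply hA, paramMeasure_apply (hA.inter φ.open_source.measurableSet),
    paramMeasure_apply hA]
  set D := c.source ∩ c ⁻¹' (A ∩ φ.source) with hD
  have hDm : MeasurableSet D :=
    c.measurableSet_inter_preimage (hA.inter φ.open_source.measurableSet)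
  have hO : IsOpen (c.source ∩ c ⁻¹' φ.source) := c.isOpen_inter_preimage φ.open_source
  have hDO : D ⊆ c.source ∩ c ⁻¹' φ.source := fun u hu => ⟨hu.1, hu.2.2⟩
  have hsm : ContMDiffOn (𝓡 d) (𝓡 d) ∞ (φ ∘ c) (c.source ∩ c ⁻¹' φ.source) :=
    (contMDiffOn_chart (I := 𝓡 d) (n := ∞) (x := x)).comp (hc.1.mono inter_subset_left)
      fun u hu => hu.2
  have hdiff : ∀ u ∈ D, DifferentiableAt ℝ (φ ∘ c) u := fun u hu =>
    (((contMDiffOn_iff_contDiffOn.1 hsm).differentiableOn (by simp)) u (hDO hu)).differentiableAt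
      (hO.mem_nhds (hDO hu))
  have hdens : ∀ u ∈ D, ENNReal.ofReal (gramDensity d c u) =
      ENNReal.ofReal |(fderiv ℝ (φ ∘ c) u).det| *
        ENNReal.ofReal (gramDensity d φ.symm ((φ ∘ c) u)) := by
    intro u hu
    rw [← ENNReal.ofReal_mul (abs_nonneg _), ← gramDensity_comp _ (hdiff u hu)]
    · congr 1
      refine gramDensity_congr ?_
      filter_upwards [hO.mem_nhds (hDO hu)] with v hv
      exact (φ.left_inv hv.2).symm
    · exact ((mdifferentiable_chart (I := 𝓡 d) x).symm).mdifferentiableAt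
        (φ.map_source (hDO hu).2)
  rw [setLIntegral_congr_fun hDm hdens,
    ← lintegral_image_eq_lintegral_abs_det_fderiv_mul volume hDm
      (fun u hu => (hdiff u hu).hasFDerivAt.hasFDerivWithinAt)
      (fun u hu v hv h => c.injOn hu.1 hv.1 (φ.injOn hu.2.2 hv.2.2 h))
      (fun v => ENNReal.ofReal (gramDensity d φ.symm v))]
  refine lintegral_mono_set ?_
  rintro _ ⟨u, hu, rfl⟩
  exact ⟨φ.map_source hu.2.2, by simpa [φ.left_inv hu.2.2] using hu.2.1⟩

/-- The supremum which defines the Riemannian measure is not larger than the measure of a chart on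
its domain: elsewhere no bound is needed, so the other parametrized pieces are compared with a
measure which is infinite there. -/
lemma riemannianMeasure_restrict_le (x : M) :
    (riemannianMeasure d M).restrict (chartAt (EuclideanSpace ℝ (Fin d)) x).source ≤
      paramMeasure d (id : M → M) (chartAt (EuclideanSpace ℝ (Fin d)) x).symm := by
  set U := (chartAt (EuclideanSpace ℝ (Fin d)) x).source with hU
  have hUm : MeasurableSet U := (chartAt (EuclideanSpace ℝ (Fin d)) x).open_source.measurableSet
  set ρ := paramMeasure d (id : M → M) (chartAt (EuclideanSpace ℝ (Fin d)) x).symm with hρ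
  have h : riemannianMeasure d M ≤ ρ + (⊤ : Measure M).restrict Uᶜ := by
    refine iSup_le fun c => ?_
    rw [← Measure.restrict_add_restrict_compl (μ := paramMeasure d id c.1) hUm]
    exact add_le_add (paramMeasure_restrict_le x c.2)
      (Measure.restrict_mono subset_rfl le_top)
  calc (riemannianMeasure d M).restrict U ≤ (ρ + (⊤ : Measure M).restrict Uᶜ).restrict U :=
        Measure.restrict_mono subset_rfl h
    _ ≤ ρ := by
        rw [Measure.restrict_add, Measure.restrict_restrict hUm]
        simp [Measure.restrict_le_self]

variable [IsContMDiffRiemannianBundle (𝓡 d) ∞ (EuclideanSpace ℝ (Fin d))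
      (fun x : M => TangentSpace (𝓡 d) x)]

instance isLocallyFiniteMeasure_riemannianMeasure :
    IsLocallyFiniteMeasure (riemannianMeasure d M) := by
  refine ⟨fun x => ?_⟩
  set φ := chartAt (EuclideanSpace ℝ (Fin d)) x with hφ
  have hx : φ x ∈ φ.target := φ.map_source (mem_chart_source _ x)
  have hcont := (continuousOn_gramDensity_chart_symm x).continuousAt (φ.open_target.mem_nhds hx)
  have hbd : ∀ᶠ v in 𝓝 (φ x), gramDensity d φ.symm v < gramDensity d φ.symm (φ x) + 1 :=
    hcont.eventually_lt continuousAt_const (lt_add_one _)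
  obtain ⟨r, hr, hball⟩ := Metric.eventually_nhds_iff_ball.1
    (hbd.and (φ.open_target.eventually_mem hx))
  refine ⟨φ.source ∩ φ ⁻¹' Metric.ball (φ x) r,
    (φ.isOpen_inter_preimage Metric.isOpen_ball).mem_nhds
      ⟨mem_chart_source _ x, Metric.mem_ball_self hr⟩, ?_⟩
  have hm : MeasurableSet (φ.source ∩ φ ⁻¹' Metric.ball (φ x) r) :=
    (φ.isOpen_inter_preimage Metric.isOpen_ball).measurableSet
  have h1 := riemannianMeasure_restrict_le (d := d) x (φ.source ∩ φ ⁻¹' Metric.ball (φ x) r)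
  rw [Measure.restrict_apply hm, inter_eq_left.2 inter_subset_left] at h1
  refine h1.trans_lt ?_
  rw [paramMeasure_apply hm]
  have hsub : φ.symm.source ∩ φ.symm ⁻¹' (φ.source ∩ φ ⁻¹' Metric.ball (φ x) r) ⊆
      Metric.ball (φ x) r := by
    rintro v ⟨hv, -, hv2⟩
    have : φ (φ.symm v) = v := φ.right_inv hv
    simpa [this] using hv2
  refine (lintegral_mono_set hsub).trans_lt ?_
  refine (setLIntegral_mono (g := fun _ => ENNReal.ofReal (gramDensity d φ.symm (φ x) + 1))
    measurable_const fun v hv => ENNReal.ofReal_le_ofReal (hball v hv).1.le).trans_lt ?_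
  rw [setLIntegral_const]
  exact ENNReal.mul_lt_top ENNReal.ofReal_lt_top measure_ball_lt_top

instance isOpenPosMeasure_riemannianMeasure : (riemannianMeasure d M).IsOpenPosMeasure := by
  refine ⟨fun U hU ⟨x, hx⟩ h0 => ?_⟩
  set φ := chartAt (EuclideanSpace ℝ (Fin d)) x with hφ
  have h1 : paramMeasure d (id : M → M) φ.symm U = 0 := by
    have : paramMeasure d (id : M → M) φ.symm ≤ riemannianMeasure d M :=
      le_iSup (fun c : {c : OpenPartialHomeomorph (EuclideanSpace ℝ (Fin d)) M //
        IsLocalParam d (id : M → M) c} => paramMeasure d (id : M → M) c.1)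
        ⟨φ.symm, isLocalParam_chart_symm x⟩
    exact le_antisymm ((this U).trans h0.le) bot_le
  rw [paramMeasure_apply hU.measurableSet] at h1
  have hopen : IsOpen (φ.symm.source ∩ φ.symm ⁻¹' U) := φ.symm.isOpen_inter_preimage hU
  have hne : (φ.symm.source ∩ φ.symm ⁻¹' U).Nonempty :=
    ⟨φ x, φ.map_source (mem_chart_source _ x), by
      simpa [φ.left_inv (mem_chart_source _ x)] using hx⟩
  have hcont : ContinuousOn (fun u => ENNReal.ofReal (gramDensity d φ.symm u))
      (φ.symm.source ∩ φ.symm ⁻¹' U) :=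
    ENNReal.continuous_ofReal.comp_continuousOn
      ((continuousOn_gramDensity_chart_symm x).mono inter_subset_left)
  rw [lintegral_eq_zero_iff' (hcont.aemeasurable hopen.measurableSet)] at h1
  have hF : ∀ᵐ u ∂volume.restrict (φ.symm.source ∩ φ.symm ⁻¹' U), False := by
    filter_upwards [h1, ae_restrict_mem hopen.measurableSet] with u hu hu'
    exact (gramDensity_pos ((isLocalParam_chart_symm x).2 u hu'.1)).not_ge
      (ENNReal.ofReal_eq_zero.1 hu)
  rw [Filter.eventually_false_iff_eq_bot, ae_eq_bot, Measure.restrict_eq_zero] at hF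
  exact (hopen.measure_pos volume hne).ne' hF

end RiemannianMeasure

/-! ### Calculus of maps smooth along an embedding -/

namespace SmoothAlong

variable {X EN HN N EN₁ HN₁ N₁ EN₂ HN₂ N₂ : Type*}
  [NormedAddCommGroup EN] [NormedSpace ℝ EN] [TopologicalSpace HN]
  [TopologicalSpace N] [ChartedSpace HN N]
  [NormedAddCommGroup EN₁] [NormedSpace ℝ EN₁] [TopologicalSpace HN₁]
  [TopologicalSpace N₁] [ChartedSpace HN₁ N₁]
  [NormedAddCommGroup EN₂] [NormedSpace ℝ EN₂] [TopologicalSpace HN₂]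
  [TopologicalSpace N₂] [ChartedSpace HN₂ N₂]
  {I : ModelWithCorners ℝ EN HN} {I₁ : ModelWithCorners ℝ EN₁ HN₁}
  {I₂ : ModelWithCorners ℝ EN₂ HN₂} {e : X → N} {V : Set X}

lemma mono {f : X → N₁} (hf : SmoothAlong I I₁ e f V) {V' : Set X} (h : V' ⊆ V) :
    SmoothAlong I I₁ e f V' := by
  intro x hx
  obtain ⟨W, hW, hxW, g, hg, hgf⟩ := hf x (h hx)
  exact ⟨W, hW, hxW, g, hg, fun y hy => hgf y (h hy)⟩

lemma congr {f f' : X → N₁} (hf : SmoothAlong I I₁ e f V) (h : EqOn f' f V) :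
    SmoothAlong I I₁ e f' V := by
  intro x hx
  obtain ⟨W, hW, hxW, g, hg, hgf⟩ := hf x hx
  exact ⟨W, hW, hxW, g, hg, fun y hy hyW => (hgf y hy hyW).trans (h hy).symm⟩

lemma of_contMDiffOn {g : N → N₁} {W : Set N} (hW : IsOpen W) (hg : ContMDiffOn I I₁ ∞ g W)
    (h : MapsTo e V W) : SmoothAlong I I₁ e (g ∘ e) V :=
  fun _ hx => ⟨W, hW, h hx, g, hg, fun _ _ _ => rfl⟩

lemma of_contMDiff {g : N → N₁} (hg : ContMDiff I I₁ ∞ g) : SmoothAlong I I₁ e (g ∘ e) V :=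
  of_contMDiffOn isOpen_univ hg.contMDiffOn (mapsTo_univ _ _)

lemma self : SmoothAlong I I e e V := of_contMDiff (g := id) contMDiff_id

lemma const (c : N₁) : SmoothAlong I I₁ e (fun _ => c) V :=
  of_contMDiff (g := fun _ => c) contMDiff_const

/-- Chain rule: `f` is composed with a map `h` which is smooth as a map into the ambient manifold
of the domain of `f`. -/
lemma comp {Y : Type*} {e' : Y → N₁} {e : X → N} {f : X → N₂} {h : Y → X} {V : Set X} {V' : Set Y}
    (hf : SmoothAlong I I₂ e f V) (hh : SmoothAlong I₁ I e' (e ∘ h) V') (hm : MapsTo h V' V) :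
    SmoothAlong I₁ I₂ e' (f ∘ h) V' := by
  intro y hy
  obtain ⟨W, hW, hxW, g, hg, hgf⟩ := hf (h y) (hm hy)
  obtain ⟨W', hW', hyW', g', hg', hgh⟩ := hh y hy
  refine ⟨W' ∩ g' ⁻¹' W, hg'.continuousOn.isOpen_inter_preimage hW' hW, ⟨hyW', ?_⟩, g ∘ g',
    hg.comp (hg'.mono inter_subset_left) fun z hz => hz.2, fun z hz hzW => ?_⟩
  · rw [mem_preimage, hgh y hy hyW']; exact hxW
  · have h1 := hgh z hz hzW.1
    have h2 := hzW.2
    rw [mem_preimage, h1] at h2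
    rw [Function.comp_apply, h1]
    exact hgf (h z) (hm hz) h2

lemma prodMk {f₁ : X → N₁} {f₂ : X → N₂} (h₁ : SmoothAlong I I₁ e f₁ V)
    (h₂ : SmoothAlong I I₂ e f₂ V) :
    SmoothAlong I (I₁.prod I₂) e (fun x => (f₁ x, f₂ x)) V := by
  intro x hx
  obtain ⟨W, hW, hxW, g, hg, hgf⟩ := h₁ x hx
  obtain ⟨W', hW', hxW', g', hg', hgf'⟩ := h₂ x hx
  refine ⟨W ∩ W', hW.inter hW', ⟨hxW, hxW'⟩, fun y => (g y, g' y),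
    (hg.mono inter_subset_left).prodMk (hg'.mono inter_subset_right), fun y hy hyW => ?_⟩
  exact Prod.ext (hgf y hy hyW.1) (hgf' y hy hyW.2)

lemma mul {f₁ f₂ : X → ℝ} (h₁ : SmoothAlong I 𝓘(ℝ, ℝ) e f₁ V)
    (h₂ : SmoothAlong I 𝓘(ℝ, ℝ) e f₂ V) :
    SmoothAlong I 𝓘(ℝ, ℝ) e (fun x => f₁ x * f₂ x) V := by
  intro x hx
  obtain ⟨W, hW, hxW, g, hg, hgf⟩ := h₁ x hx
  obtain ⟨W', hW', hxW', g', hg', hgf'⟩ := h₂ x hx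
  refine ⟨W ∩ W', hW.inter hW', ⟨hxW, hxW'⟩, fun y => g y * g' y,
    (hg.mono inter_subset_left).mul (hg'.mono inter_subset_right), fun y hy hyW => ?_⟩
  exact congrArg₂ (· * ·) (hgf y hy hyW.1) (hgf' y hy hyW.2)

lemma rpow {f : X → ℝ} (h : SmoothAlong I 𝓘(ℝ, ℝ) e f V) (hpos : ∀ x ∈ V, 0 < f x) (r : ℝ) :
    SmoothAlong I 𝓘(ℝ, ℝ) e (fun x => f x ^ r) V := by
  have hg : SmoothAlong 𝓘(ℝ, ℝ) 𝓘(ℝ, ℝ) (id : ℝ → ℝ) (fun y => y ^ r) (Ioi 0) :=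
    of_contMDiffOn (g := fun y : ℝ => y ^ r) isOpen_Ioi (contMDiffOn_iff_contDiffOn.2 fun y hy =>
      (Real.contDiffAt_rpow_const_of_ne (ne_of_gt hy)).contDiffWithinAt) (mapsTo_id _)
  exact hg.comp (h := f) h hpos

lemma div {f₁ f₂ : X → ℝ} (h₁ : SmoothAlong I 𝓘(ℝ, ℝ) e f₁ V)
    (h₂ : SmoothAlong I 𝓘(ℝ, ℝ) e f₂ V) (hpos : ∀ x ∈ V, 0 < f₂ x) :
    SmoothAlong I 𝓘(ℝ, ℝ) e (fun x => f₁ x / f₂ x) V := by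
  refine (h₁.mul (h₂.rpow hpos (-1))).congr fun x _ => ?_
  simp [Real.rpow_neg_one, div_eq_mul_inv]

lemma continuousOn [TopologicalSpace X] {f : X → N₁} (hf : SmoothAlong I I₁ e f V)
    (he : Continuous e) : ContinuousOn f V := by
  intro x hx
  obtain ⟨W, hW, hxW, g, hg, hgf⟩ := hf x hx
  have h1 : ContinuousAt (g ∘ e) x :=
    (hg.continuousOn.continuousAt (hW.mem_nhds hxW)).comp he.continuousAt
  refine h1.continuousWithinAt.congr_of_eventuallyEq ?_ (hgf x hx hxW).symm
  filter_upwards [self_mem_nhdsWithin,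
    nhdsWithin_le_nhds ((hW.preimage he).mem_nhds hxW)] with y hy hyW
  exact (hgf y hy hyW).symm

lemma continuous [TopologicalSpace X] {f : X → N₁} (hf : SmoothAlong I I₁ e f univ)
    (he : Continuous e) : Continuous f :=
  continuousOn_univ.1 (hf.continuousOn he)

/-- Smoothness on a subset of the ambient manifold may be checked on a larger subspace. -/
lemma of_subtype {S V : Set N} {f : N → N₁} (hVS : V ⊆ S)
    (hf : SmoothAlong I I₁ (Subtype.val : S → N) (fun y => f y) (Subtype.val ⁻¹' V)) :
    SmoothAlong I I₁ (id : N → N) f V := by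
  intro x hx
  obtain ⟨W, hW, hxW, g, hg, hgf⟩ := hf ⟨x, hVS hx⟩ hx
  exact ⟨W, hW, hxW, g, hg, fun y hy hyW => hgf ⟨y, hVS hy⟩ hy hyW⟩

end SmoothAlong

/-! ### Hestenes operators on functions -/

/-- `P f x` depends on finitely many values of `f` only, for each `x`. -/
def FinitelyDetermined {X : Type*} (P : Module.End ℝ (X → ℝ)) : Prop :=
  ∀ x, ∃ Z : Set X, Z.Finite ∧ ∀ f g : X → ℝ, EqOn f g Z → P f x = P g x

namespace FinitelyDetermined

variable {X : Type*} {P Q : Module.End ℝ (X → ℝ)}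

lemma zero : FinitelyDetermined (0 : Module.End ℝ (X → ℝ)) :=
  fun _ => ⟨∅, finite_empty, fun _ _ _ => rfl⟩

lemma add (hP : FinitelyDetermined P) (hQ : FinitelyDetermined Q) :
    FinitelyDetermined (P + Q) := by
  intro x
  obtain ⟨Z, hZ, h⟩ := hP x
  obtain ⟨Z', hZ', h'⟩ := hQ x
  refine ⟨Z ∪ Z', hZ.union hZ', fun f g hfg => ?_⟩
  simp only [LinearMap.add_apply, Pi.add_apply]
  rw [h f g (hfg.mono subset_union_left), h' f g (hfg.mono subset_union_right)]

lemma smul (hP : FinitelyDetermined P) (c : ℝ) : FinitelyDetermined (c • P) := by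
  intro x
  obtain ⟨Z, hZ, h⟩ := hP x
  refine ⟨Z, hZ, fun f g hfg => ?_⟩
  simp only [LinearMap.smul_apply, Pi.smul_apply]
  rw [h f g hfg]

lemma comp (hP : FinitelyDetermined P) (hQ : FinitelyDetermined Q) :
    FinitelyDetermined (P ∘ₗ Q) := by
  intro x
  obtain ⟨Z, hZ, h⟩ := hP x
  choose Z' hZ' h' using hQ
  refine ⟨⋃ z ∈ Z, Z' z, hZ.biUnion fun z _ => hZ' z, fun f g hfg => ?_⟩
  exact h _ _ fun z hz => h' z f g (hfg.mono (subset_biUnion_of_mem hz))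

/-- Finitely determined operators which agree on continuous functions are equal, because a
continuous function can be prescribed on a finite set. -/
lemma ext_of_continuous [TopologicalSpace X] [T1Space X] [NormalSpace X]
    (hP : FinitelyDetermined P) (hQ : FinitelyDetermined Q)
    (h : ∀ f : X → ℝ, Continuous f → P f = Q f) : P = Q := by
  ext f x
  obtain ⟨Z, hZ, hPZ⟩ := hP x
  obtain ⟨Z', hZ', hQZ⟩ := hQ x
  have := (hZ.union hZ').to_subtype
  obtain ⟨g, hg⟩ := ContinuousMap.exists_restrict_eq (hZ.union hZ').isClosed
    (⟨fun z => f z, continuous_of_discreteTopology⟩ : C((Z ∪ Z' : Set X), ℝ))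
  have hfg : EqOn f g (Z ∪ Z') := fun z hz => (DFunLike.congr_fun hg ⟨z, hz⟩).symm
  rw [hPZ f g (hfg.mono subset_union_left), hQZ f g (hfg.mono subset_union_right),
    h g g.continuous]

end FinitelyDetermined

section Hestenes

variable {d : ℕ} {M : Type*} [TopologicalSpace M] [ChartedSpace (EuclideanSpace ℝ (Fin d)) M]
  {X : Type*} [TopologicalSpace X] {e : X → M}

lemma SimpleHData.op_apply_of_mem (H : SimpleHData d e) (f : X → ℝ) {x : X}
    (hx : x ∈ H.Φ.source) : H.op f x = H.φ x * f (H.Φ x) := by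
  simp [SimpleHData.op, hx]

lemma SimpleHData.op_apply_of_notMem (H : SimpleHData d e) (f : X → ℝ) {x : X}
    (hx : x ∉ H.Φ.source) : H.op f x = 0 := by
  simp [SimpleHData.op, hx]

lemma SimpleHData.op_apply_of_notMem_tsupport (H : SimpleHData d e) (f : X → ℝ) {x : X}
    (hx : x ∉ tsupport H.φ) : H.op f x = 0 := by
  by_cases h : x ∈ H.Φ.source
  · rw [H.op_apply_of_mem f h, image_eq_zero_of_notMem_tsupport hx, zero_mul]
  · exact H.op_apply_of_notMem f h

lemma SimpleHData.continuous_op (H : SimpleHData d e) (he : Continuous e) {f : X → ℝ}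
    (hf : Continuous f) : Continuous (H.op f) := by
  refine continuous_iff_continuousAt.2 fun x => ?_
  by_cases hx : x ∈ tsupport H.φ
  · have hs := H.Φ.open_source.mem_nhds (H.supp_φ hx)
    have h1 : ContinuousAt (fun y => H.φ y * f (H.Φ y)) x :=
      ((H.smooth_φ.continuous he).continuousAt).mul
        (hf.continuousAt.comp (H.Φ.continuousAt (H.supp_φ hx)))
    refine h1.congr ?_
    filter_upwards [hs] with y hy
    rw [H.op_apply_of_mem f hy]
  · refine (continuousAt_const (y := (0 : ℝ))).congr ?_
    filter_upwards [(isClosed_tsupport H.φ).isOpen_compl.mem_nhds hx] with y hy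
    rw [H.op_apply_of_notMem_tsupport f hy]

lemma HOperatorsOn_le_HOperators (U : Set X) : HOperatorsOn d e U ≤ HOperators d e :=
  Submodule.span_mono fun _ ⟨H, _, _, hT⟩ => ⟨H, hT⟩

lemma HOperators.continuous_apply (he : Continuous e) {P : Module.End ℝ (X → ℝ)}
    (hP : P ∈ HOperators d e) {f : X → ℝ} (hf : Continuous f) : Continuous (P f) := by
  induction hP using Submodule.span_induction with
  | mem T hT => obtain ⟨H, rfl⟩ := hT; exact H.continuous_op he hf
  | zero => exact continuous_zero
  | add P Q _ _ h₁ h₂ => exact h₁.add h₂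
  | smul c P _ h => exact h.const_smul c

lemma HOperators.exists_isCompact {P : Module.End ℝ (X → ℝ)} (hP : P ∈ HOperators d e) :
    ∃ K, IsCompact K ∧ ∀ f : X → ℝ, ∀ x ∉ K, P f x = 0 := by
  induction hP using Submodule.span_induction with
  | mem T hT =>
    obtain ⟨H, rfl⟩ := hT
    exact ⟨tsupport H.φ, H.compact_φ, fun f x hx => H.op_apply_of_notMem_tsupport f hx⟩
  | zero => exact ⟨∅, isCompact_empty, fun _ _ _ => rfl⟩
  | add P Q _ _ h₁ h₂ =>
    obtain ⟨K, hK, h⟩ := h₁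
    obtain ⟨K', hK', h'⟩ := h₂
    refine ⟨K ∪ K', hK.union hK', fun f x hx => ?_⟩
    simp [h f x fun hx' => hx (Or.inl hx'), h' f x fun hx' => hx (Or.inr hx')]
  | smul c P _ h =>
    obtain ⟨K, hK, h⟩ := h
    exact ⟨K, hK, fun f x hx => by simp [h f x hx]⟩

lemma HOperators.hasCompactSupport_apply [R1Space X] {P : Module.End ℝ (X → ℝ)}
    (hP : P ∈ HOperators d e) (f : X → ℝ) : HasCompactSupport (P f) := by
  obtain ⟨K, hK, h⟩ := HOperators.exists_isCompact hP
  exact HasCompactSupport.intro' hK.closure isClosed_closure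
    fun x hx => h f x fun hx' => hx (subset_closure hx')

lemma HOperators.finitelyDetermined {P : Module.End ℝ (X → ℝ)} (hP : P ∈ HOperators d e) :
    FinitelyDetermined P := by
  induction hP using Submodule.span_induction with
  | mem T hT =>
    obtain ⟨H, rfl⟩ := hT
    intro x
    refine ⟨{H.Φ x}, finite_singleton _, fun f g hfg => ?_⟩
    by_cases hx : x ∈ H.Φ.source
    · rw [H.op_apply_of_mem f hx, H.op_apply_of_mem g hx, hfg rfl]
    · rw [H.op_apply_of_notMem f hx, H.op_apply_of_notMem g hx]
  | zero => exact FinitelyDetermined.zero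
  | add P Q _ _ h₁ h₂ => exact h₁.add h₂
  | smul c P _ h => exact h.smul c

lemma id_mem_HOperatorsOn_univ [CompactSpace X] :
    (LinearMap.id : Module.End ℝ (X → ℝ)) ∈ HOperatorsOn d e univ := by
  let H : SimpleHData d e :=
    { φ := fun _ => 1
      Φ := OpenPartialHomeomorph.refl X
      smooth_φ := SmoothAlong.const 1
      compact_φ := HasCompactSupport.of_compactSpace _
      supp_φ := subset_univ _
      smooth_Φ := SmoothAlong.self
      smooth_Φ_symm := SmoothAlong.self }
  refine Submodule.subset_span ⟨H, subset_univ _, subset_univ _, ?_⟩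
  ext f x
  rw [H.op_apply_of_mem f (mem_univ x)]
  simp [H]

end Hestenes

/-! ### Operators on `Lᵖ` given on continuous functions -/

lemma LinearMap.exists_extension_of_norm_le {E₀ E F : Type*} [AddCommGroup E₀] [Module ℝ E₀]
    [NormedAddCommGroup E] [NormedSpace ℝ E] [NormedAddCommGroup F] [NormedSpace ℝ F]
    [CompleteSpace F] (L : E₀ →ₗ[ℝ] F) (j : E₀ →ₗ[ℝ] E) (hd : DenseRange j) {K : ℝ} (hK : 0 ≤ K)
    (hL : ∀ x, ‖L x‖ ≤ K * ‖j x‖) :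
    ∃ S : E →L[ℝ] F, (∀ x, S (j x) = L x) ∧ ‖S‖ ≤ K :=
  ⟨L.extendOfNorm j, LinearMap.extendOfNorm_eq hd ⟨K, hL⟩,
    ContinuousLinearMap.opNorm_le_bound _ hK (LinearMap.norm_extendOfNorm_apply_le hd K hL)⟩

section Induces

variable {X : Type*} [TopologicalSpace X] [MeasurableSpace X]
  {p : ℝ≥0∞} [Fact (1 ≤ p)] {μ : Measure X}

variable (p μ) in
/-- The space `C₀(X) ∩ Lᵖ(X, μ)`, as a space of functions. -/
def c0MemLp : Submodule ℝ (X → ℝ) where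
  carrier := {f | (∃ g : C₀(X, ℝ), ⇑g = f) ∧ MemLp f p μ}
  add_mem' := by
    rintro _ _ ⟨⟨f, rfl⟩, hf⟩ ⟨⟨g, rfl⟩, hg⟩
    exact ⟨⟨f + g, rfl⟩, hf.add hg⟩
  zero_mem' := ⟨⟨0, rfl⟩, MemLp.zero'⟩
  smul_mem' := by
    rintro c _ ⟨⟨f, rfl⟩, hf⟩
    exact ⟨⟨c • f, rfl⟩, hf.const_smul c⟩

variable (p μ) in
/-- The canonical map of `C₀(X) ∩ Lᵖ(X, μ)` to `Lᵖ(X, μ)`. -/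
def c0ToLp : c0MemLp p μ →ₗ[ℝ] Lp ℝ p μ where
  toFun f := f.2.2.toLp _
  map_add' _ _ := rfl
  map_smul' _ _ := rfl

/-- A continuous function with compact support, as an element of `C₀(X)`. -/
def HasCompactSupport.toC0 {f : X → ℝ} (hf : Continuous f) (h : HasCompactSupport f) : C₀(X, ℝ) :=
  ⟨⟨f, hf⟩, h.is_zero_at_infty⟩

lemma denseRange_c0ToLp [BorelSpace X] [R1Space X] [WeaklyLocallyCompactSpace X] [NormalSpace X]
    [μ.Regular] (hp : p ≠ ⊤) :
    DenseRange (c0ToLp p μ) := by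
  refine Metric.denseRange_iff.2 fun f r hr => ?_
  obtain ⟨g, hg, hfg, hgc, hgL⟩ := (Lp.memLp f).exists_hasCompactSupport_eLpNorm_sub_le hp
    (ε := ENNReal.ofReal (r / 2)) (by simpa using hr)
  refine ⟨⟨g, ⟨hg.toC0 hgc, rfl⟩, hgL⟩, ?_⟩
  have h : edist f (c0ToLp p μ ⟨g, ⟨hg.toC0 hgc, rfl⟩, hgL⟩) ≤ ENNReal.ofReal (r / 2) := by
    rw [Lp.edist_def]
    refine le_trans (le_of_eq (eLpNorm_congr_ae ?_)) hfg
    filter_upwards [MemLp.coeFn_toLp hgL] with x hx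
    have : (c0ToLp p μ ⟨g, ⟨hg.toC0 hgc, rfl⟩, hgL⟩ : X → ℝ) x = g x := hx
    simp [this]
  rw [edist_dist] at h
  have := (ENNReal.ofReal_le_ofReal_iff (by positivity)).1 h
  linarith

lemma Lp_induction_c0 [BorelSpace X] [R1Space X] [WeaklyLocallyCompactSpace X] [NormalSpace X]
    [μ.Regular] (hp : p ≠ ⊤)
    {q : Lp ℝ p μ → Prop} (hq : IsClosed {f | q f})
    (h : ∀ (f : C₀(X, ℝ)) (hf : MemLp (f : X → ℝ) p μ), q (hf.toLp (f : X → ℝ))) (f : Lp ℝ p μ) :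
    q f :=
  (denseRange_c0ToLp hp).induction_on f hq <| by
    rintro ⟨_, ⟨g, rfl⟩, hg⟩
    exact h g hg

/-- An operator on `C₀(X)` which is bounded for the `Lᵖ` norm induces an operator on `Lᵖ(X, μ)`. -/
lemma exists_induces [BorelSpace X] [R1Space X] [WeaklyLocallyCompactSpace X] [NormalSpace X]
    [μ.Regular] (hp : p ≠ ⊤)
    {B : Module.End ℝ (X → ℝ)} {K : ℝ} (hK : 0 ≤ K)
    (hB : ∀ f : C₀(X, ℝ), MemLp (f : X → ℝ) p μ →
      MemLp (B f) p μ ∧ eLpNorm (B f) p μ ≤ ENNReal.ofReal K * eLpNorm f p μ) :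
    ∃ S : Lp ℝ p μ →L[ℝ] Lp ℝ p μ, Induces B S ∧ ‖S‖ ≤ K := by
  have hB : ∀ f : c0MemLp p μ, MemLp (B f) p μ ∧
      eLpNorm (B f) p μ ≤ ENNReal.ofReal K * eLpNorm (f : X → ℝ) p μ := by
    rintro ⟨_, ⟨g, rfl⟩, hg⟩
    exact hB g hg
  obtain ⟨L, hLf⟩ : ∃ L : c0MemLp p μ →ₗ[ℝ] Lp ℝ p μ, ∀ f, L f = (hB f).1.toLp _ := ⟨
    { toFun := fun f => (hB f).1.toLp _
      map_add' := fun f g =>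
        (MemLp.toLp_congr _ ((hB f).1.add (hB g).1)
          (Filter.EventuallyEq.of_eq (B.map_add f.1 g.1))).trans (MemLp.toLp_add _ _)
      map_smul' := fun c f =>
        (MemLp.toLp_congr _ ((hB f).1.const_smul c)
          (Filter.EventuallyEq.of_eq (B.map_smul c f.1))).trans
            (MemLp.toLp_const_smul _ _) }, fun _ => rfl⟩
  have hL : ∀ f, ‖L f‖ ≤ K * ‖c0ToLp p μ f‖ := by
    intro f
    have h1 : ‖L f‖ = (eLpNorm (B f.1) p μ).toReal := by
      rw [hLf]; exact Lp.norm_toLp _ (hB f).1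
    have h2 : ‖c0ToLp p μ f‖ = (eLpNorm f.1 p μ).toReal := Lp.norm_toLp _ f.2.2
    rw [h1, h2, ← ENNReal.toReal_ofReal hK, ← ENNReal.toReal_mul]
    exact ENNReal.toReal_mono (ENNReal.mul_ne_top ENNReal.ofReal_ne_top f.2.2.2.ne)
      (hB f).2
  obtain ⟨S, hS, hSK⟩ := LinearMap.exists_extension_of_norm_le (E := Lp ℝ p μ) (F := Lp ℝ p μ) L
    (c0ToLp p μ) (denseRange_c0ToLp hp) hK hL
  refine ⟨S, fun f hf => ?_, hSK⟩
  have h : S (hf.toLp (f : X → ℝ)) = (hB ⟨f, ⟨f, rfl⟩, hf⟩).1.toLp _ :=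
    (hS ⟨f, ⟨f, rfl⟩, hf⟩).trans (hLf _)
  rw [h]
  exact MemLp.coeFn_toLp (hB ⟨f, ⟨f, rfl⟩, hf⟩).1

namespace Induces

variable {B B' : Module.End ℝ (X → ℝ)} {S S' : Lp ℝ p μ →L[ℝ] Lp ℝ p μ}

lemma memLp (h : Induces B S) (f : C₀(X, ℝ)) (hf : MemLp (f : X → ℝ) p μ) : MemLp (B f) p μ :=
  (memLp_congr_ae (h f hf)).1 (Lp.memLp _)

lemma apply_eq (h : Induces B S) (f : C₀(X, ℝ)) (hf : MemLp (f : X → ℝ) p μ) :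
    S (hf.toLp f) = (h.memLp f hf).toLp _ :=
  Lp.ext ((h f hf).trans (MemLp.coeFn_toLp _).symm)

lemma unique [BorelSpace X] [R1Space X] [WeaklyLocallyCompactSpace X] [NormalSpace X]
    [μ.Regular] (hp : p ≠ ⊤)
    (h : Induces B S) (h' : Induces B S') : S = S' := by
  refine ContinuousLinearMap.ext fun f => ?_
  refine Lp_induction_c0 hp (q := fun f => S f = S' f)
    (isClosed_eq S.continuous S'.continuous) (fun g hg => ?_) f
  rw [h.apply_eq, h'.apply_eq]

lemma comp (h : Induces B S) (h' : Induces B' S')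
    (hc : ∀ f : C₀(X, ℝ), Continuous (B' f) ∧ HasCompactSupport (B' f)) :
    Induces (B ∘ₗ B') (S ∘L S') := by
  intro f hf
  rw [ContinuousLinearMap.comp_apply, h'.apply_eq f hf]
  exact h ((hc f).2.toC0 (hc f).1) (h'.memLp f hf)

protected lemma zero : Induces (0 : Module.End ℝ (X → ℝ)) (0 : Lp ℝ p μ →L[ℝ] Lp ℝ p μ) :=
  fun _ _ => Lp.coeFn_zero ℝ p μ

protected lemma id :
    Induces (LinearMap.id : Module.End ℝ (X → ℝ)) (ContinuousLinearMap.id ℝ (Lp ℝ p μ)) :=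
  fun _ hf => hf.coeFn_toLp

lemma add (h : Induces B S) (h' : Induces B' S') : Induces (B + B') (S + S') := by
  intro f hf
  change ((S (hf.toLp f) + S' (hf.toLp f) : Lp ℝ p μ) : X → ℝ) =ᵐ[μ] _
  filter_upwards [Lp.coeFn_add (S (hf.toLp f)) (S' (hf.toLp f)), h f hf, h' f hf]
    with x h1 h2 h3
  exact h1.trans (congrArg₂ (· + ·) h2 h3)

lemma sum {ι : Type*} (s : Finset ι) {B : ι → Module.End ℝ (X → ℝ)}
    {S : ι → (Lp ℝ p μ →L[ℝ] Lp ℝ p μ)} (h : ∀ i ∈ s, Induces (B i) (S i)) :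
    Induces (∑ i ∈ s, B i) (∑ i ∈ s, S i) := by
  classical
  induction s using Finset.induction_on with
  | empty => simpa using Induces.zero
  | insert i s hi ih =>
    rw [Finset.sum_insert hi, Finset.sum_insert hi]
    exact (h i (Finset.mem_insert_self i s)).add
      (ih fun j hj => h j (Finset.mem_insert_of_mem hj))

end Induces

end Induces

/-! ### Geometry of a regular strip -/

namespace StripParam

section Geometry

variable {d : ℕ} {M : Type*} [TopologicalSpace M] [ChartedSpace (EuclideanSpace ℝ (Fin d)) M]
  [RiemannianBundle (fun x : M => TangentSpace (𝓡 d) x)] [MeasurableSpace M]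
  {m : M → ℝ} {a b : ℝ} (R : StripParam d m a b)

lemma F_congr {t t' : Ioo a b} {z : levelSet m t} {z' : levelSet m t'} (h : (z : M) = z')
    (r : Ioo a b) : R.F t r z = R.F t' r z' := by
  have ht : t = t' := Subtype.ext ((show m z = t from z.2).symm.trans
    ((congrArg m h).trans (show m z' = t' from z'.2)))
  subst ht
  rw [Subtype.ext h]

lemma F_self (s : Ioo a b) (x : levelSet m s) : R.F s s x = x :=
  (R.F_comp s s s x).symm.trans (R.F_inv s s x)

lemma m_F (s t : Ioo a b) (x : levelSet m s) : m (R.F s t x) = t := (R.F s t x).2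

/-- The parametrization `F_s` of the strip, with values in `M`. -/
def emb (s : Ioo a b) (q : Ioo a b × levelSet m s) : M := R.F s q.1 q.2

/-- The retraction of the strip to `J_s` along the parametrization. -/
def proj (s : Ioo a b) (y : m ⁻¹' Ioo a b) : levelSet m s := R.F ⟨m y, y.2⟩ s ⟨y, rfl⟩

lemma m_emb (s : Ioo a b) (q : Ioo a b × levelSet m s) : m (R.emb s q) = q.1 := R.m_F s q.1 q.2

lemma emb_mem (s : Ioo a b) (q : Ioo a b × levelSet m s) : R.emb s q ∈ m ⁻¹' Ioo a b := by
  rw [mem_preimage, R.m_emb]; exact q.1.2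

lemma F_eq_of_coe_eq {s t t' r : Ioo a b} {x : levelSet m s} {z : levelSet m t'}
    (h : (z : M) = R.F s t x) : R.F t' r z = R.F s r x :=
  (R.F_congr h r).trans (R.F_comp s t r x)

lemma proj_emb (s r : Ioo a b) (q : Ioo a b × levelSet m s) (h : R.emb s q ∈ m ⁻¹' Ioo a b) :
    R.proj r ⟨R.emb s q, h⟩ = R.F s r q.2 :=
  R.F_eq_of_coe_eq rfl

lemma emb_proj (s : Ioo a b) (y : m ⁻¹' Ioo a b) : R.emb s (⟨m y, y.2⟩, R.proj s y) = y :=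
  congrArg Subtype.val (R.F_inv ⟨m y, y.2⟩ s ⟨y, rfl⟩)

lemma emb_change (s r : Ioo a b) (t : Ioo a b) (x : levelSet m s) :
    R.emb r (t, R.F s r x) = R.emb s (t, x) :=
  congrArg Subtype.val (R.F_comp s r t x)

lemma continuous_emb (s : Ioo a b) : Continuous (R.emb s) :=
  (R.smooth_F s).continuous (by fun_prop)

lemma continuous_proj (s : Ioo a b) : Continuous (R.proj s) :=
  continuous_induced_rng.2 ((R.smooth_F_inv s).continuous continuous_subtype_val)

lemma continuous_ψ (s : Ioo a b) :
    Continuous fun q : Ioo a b × levelSet m s => R.ψ s q.1 q.2 :=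
  (R.smooth_ψ s).continuous (by fun_prop)

/-- The homeomorphism of `I × J_s` with the strip `M_I`. -/
def homeo (hmc : Continuous m) (s : Ioo a b) :
    Ioo a b × levelSet m s ≃ₜ (m ⁻¹' Ioo a b : Set M) where
  toFun q := ⟨R.emb s q, R.emb_mem s q⟩
  invFun y := (⟨m y, y.2⟩, R.proj s y)
  left_inv q := by
    refine Prod.ext (Subtype.ext (R.m_emb s q)) ?_
    exact (R.proj_emb s s q _).trans (R.F_self s q.2)
  right_inv y := Subtype.ext (R.emb_proj s y)
  continuous_toFun := (R.continuous_emb s).subtype_mk _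
  continuous_invFun := ((hmc.comp continuous_subtype_val).subtype_mk _).prodMk (R.continuous_proj s)

lemma isOpenEmbedding_emb (hmc : Continuous m) (s : Ioo a b) : IsOpenEmbedding (R.emb s) :=
  ((isOpen_Ioo.preimage hmc).isOpenEmbedding_subtypeVal).comp (R.homeo hmc s).isOpenEmbedding

/-- Change of the base level: `J_s` and `J_r` are homeomorphic. -/
def levelHomeo (s r : Ioo a b) : levelSet m s ≃ₜ levelSet m r where
  toFun := R.F s r
  invFun := R.F r s
  left_inv := R.F_inv s r
  right_inv := R.F_inv r s
  continuous_toFun := continuous_induced_rng.2 ((R.continuous_emb s).comp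
    (continuous_const.prodMk continuous_id) : Continuous fun x => R.emb s (r, x))
  continuous_invFun := continuous_induced_rng.2 ((R.continuous_emb r).comp
    (continuous_const.prodMk continuous_id) : Continuous fun x => R.emb r (s, x))

end Geometry

end StripParam

lemma IsProperMorse.isCompact_preimage {d : ℕ} {M : Type*} [TopologicalSpace M]
    [ChartedSpace (EuclideanSpace ℝ (Fin d)) M] {m : M → ℝ} (hm : IsProperMorse d m) {A : Set ℝ}
    (hA : IsClosed A) {c : ℝ} (hc : A ⊆ Iic c) : IsCompact (m ⁻¹' A) := by
  refine (hm.isCompact_sublevel (max c 1) (by positivity)).of_isClosed_subset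
    (hA.preimage hm.smooth.continuous) fun x hx => ?_
  exact ⟨hm.nonneg x, (hc hx).trans (le_max_left _ _)⟩

lemma IsProperMorse.compactSpace_levelSet {d : ℕ} {M : Type*} [TopologicalSpace M]
    [ChartedSpace (EuclideanSpace ℝ (Fin d)) M] {m : M → ℝ} (hm : IsProperMorse d m) (t : ℝ) :
    CompactSpace (levelSet m t) :=
  isCompact_iff_compactSpace.1 (hm.isCompact_preimage isClosed_singleton (c := t) (by simp))

/-! ### Product densities -/

/-- If `f · (l × ν) = f' · (l × ν')` for continuous positive functions, then `f' / f` depends on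
the second variable only. -/
lemma density_ratio_eq {T J : Type*} [TopologicalSpace T] [MeasurableSpace T] [BorelSpace T]
    [TopologicalSpace J] [MeasurableSpace J] [BorelSpace J] [SecondCountableTopology T]
    {l : Measure T} [IsFiniteMeasure l] [l.IsOpenPosMeasure]
    {ν ν' : Measure J} [IsFiniteMeasure ν] [IsFiniteMeasure ν'] [ν.IsOpenPosMeasure]
    {f f' : T × J → ℝ} (hf : Continuous f) (hf' : Continuous f') (hpos : ∀ q, 0 < f q)
    (hpos' : ∀ q, 0 < f' q)
    (h : (l.prod ν).withDensity (fun q => ENNReal.ofReal (f q)) =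
      (l.prod ν').withDensity (fun q => ENNReal.ofReal (f' q))) (t t' : T) (x : J) :
    f' (t, x) * f (t', x) = f' (t', x) * f (t, x) := by
  set g : T × J → ℝ := fun q => f' q / f q with hg
  have hgc : Continuous g := hf'.div hf fun q => (hpos q).ne'
  have hgpos : ∀ q, 0 < g q := fun q => div_pos (hpos' q) (hpos q)
  have hd : l.prod ν = (l.prod ν').withDensity (fun q => ENNReal.ofReal (g q)) := by
    have h1 := withDensity_inv_same (μ := l.prod ν) (f := fun q => ENNReal.ofReal (f q))
      hf.measurable.ennreal_ofReal (Filter.Eventually.of_forall fun q => by simpa using hpos q)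
      (Filter.Eventually.of_forall fun q => ENNReal.ofReal_ne_top)
    rw [h] at h1
    refine h1.symm.trans ((withDensity_mul _ hf'.measurable.ennreal_ofReal
      hf.measurable.ennreal_ofReal.inv).symm.trans ?_)
    congr 1
    funext q
    simp only [hg]
    rw [ENNReal.ofReal_div_of_pos (hpos q), div_eq_mul_inv]
    rfl
  have hrect : ∀ {A : Set T} {B : Set J}, MeasurableSet A → MeasurableSet B →
      l A * ν B = ∫⁻ q in A ×ˢ B, ENNReal.ofReal (g q) ∂(l.prod ν') := by
    intro A B hA hB
    rw [← Measure.prod_prod, hd, withDensity_apply _ (hA.prod hB)]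
  -- if `g` is less than `r` near `(t, x)` and greater than `r₂ > r` near `(t', x)`, the two
  -- rectangles give contradictory comparisons of `ν` and `ν'` near `x`
  have key : ∀ t t' : T, g (t', x) ≤ g (t, x) := by
    intro t t'
    by_contra! hlt
    obtain ⟨r, hr, hr'⟩ := exists_between hlt
    have hr0 : 0 < r := (hgpos _).trans hr
    obtain ⟨A, B, hA, hB, htA, hxB, hAB⟩ := isOpen_prod_iff.1
      (isOpen_lt hgc continuous_const : IsOpen {q | g q < r}) t x hr
    obtain ⟨r₂, hr₂, hr₂'⟩ := exists_between hr'
    obtain ⟨A', B', hA', hB', htA', hxB', hAB'⟩ := isOpen_prod_iff.1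
      (isOpen_lt continuous_const hgc : IsOpen {q | r₂ < g q}) t' x hr₂'
    have hBB := hB.inter hB'
    have hν : 0 < ν (B ∩ B') := hBB.measure_pos ν ⟨x, hxB, hxB'⟩
    have h1 : ν (B ∩ B') ≤ ENNReal.ofReal r * ν' (B ∩ B') := by
      have hlA : l A ≠ 0 := (hA.measure_pos l ⟨t, htA⟩).ne'
      rw [← ENNReal.mul_le_mul_iff_right hlA (measure_ne_top l A),
        hrect hA.measurableSet hBB.measurableSet, mul_left_comm, ← Measure.prod_prod,
        ← setLIntegral_const]
      refine setLIntegral_mono' (hA.measurableSet.prod hBB.measurableSet) fun q hq => ?_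
      exact ENNReal.ofReal_le_ofReal (hAB ⟨hq.1, hq.2.1⟩ : g q < r).le
    have h2 : ENNReal.ofReal r₂ * ν' (B ∩ B') ≤ ν (B ∩ B') := by
      have hlA : l A' ≠ 0 := (hA'.measure_pos l ⟨t', htA'⟩).ne'
      rw [← ENNReal.mul_le_mul_iff_right hlA (measure_ne_top l A'),
        hrect hA'.measurableSet hBB.measurableSet, mul_left_comm, ← Measure.prod_prod,
        ← setLIntegral_const]
      refine setLIntegral_mono' (hA'.measurableSet.prod hBB.measurableSet) fun q hq => ?_
      exact ENNReal.ofReal_le_ofReal (hAB' ⟨hq.1, hq.2.2⟩ : r₂ < g q).le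
    have hν' : ν' (B ∩ B') ≠ 0 := by
      intro h0
      rw [h0, mul_zero] at h1
      exact hν.not_ge h1
    have h3 := h2.trans h1
    rw [ENNReal.mul_le_mul_iff_left hν' (measure_ne_top ν' _),
      ENNReal.ofReal_le_ofReal_iff hr0.le] at h3
    linarith
  have := le_antisymm (key t t') (key t' t)
  rw [hg] at this
  simp only at this
  rw [div_eq_div_iff (hpos _).ne' (hpos _).ne'] at this
  linarith

/-- Lebesgue measure on the interval `(a, b)`. -/
noncomputable def ioVolume (a b : ℝ) : Measure (Ioo a b) := (volume : Measure ℝ).comap Subtype.val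

lemma lintegral_ioVolume {a b : ℝ} (f : ℝ → ℝ≥0∞) :
    ∫⁻ t, f t ∂ioVolume a b = ∫⁻ t in Ioo a b, f t := by
  rw [ioVolume, lintegral_subtype_comap measurableSet_Ioo]

instance isFiniteMeasure_ioVolume (a b : ℝ) : IsFiniteMeasure (ioVolume a b) := by
  refine ⟨?_⟩
  rw [ioVolume, comap_subtype_coe_apply measurableSet_Ioo, image_univ, Subtype.range_coe]
  exact measure_Ioo_lt_top

instance isOpenPosMeasure_ioVolume (a b : ℝ) : (ioVolume a b).IsOpenPosMeasure := by
  refine ⟨fun U hU hne h0 => ?_⟩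
  rw [ioVolume, comap_subtype_coe_apply measurableSet_Ioo] at h0
  exact ((isOpen_Ioo.isOpenMap_subtype_val U hU).measure_pos volume (hne.image _)).ne' h0

/-! ### The measures on the levels -/

namespace StripParam

section Measures

variable {d : ℕ} {M : Type*} [TopologicalSpace M] [ChartedSpace (EuclideanSpace ℝ (Fin d)) M]
  [RiemannianBundle (fun x : M => TangentSpace (𝓡 d) x)] [MeasurableSpace M]
  {m : M → ℝ} {a b : ℝ}

/-- The measure `ψ_s · (λ × ν_s)` on `I × J_s`. -/
noncomputable def productMeasure (R : StripParam d m a b) (s : Ioo a b) :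
    Measure (Ioo a b × levelSet m s) :=
  ((ioVolume a b).prod (levelMeasure d m s)).withDensity (fun q => ENNReal.ofReal (R.ψ s q.1 q.2))

lemma map_productMeasure (R : StripParam d m a b) (s : Ioo a b) :
    (R.productMeasure s).map (R.emb s) = (riemannianMeasure d M).restrict (m ⁻¹' Ioo a b) :=
  R.map_eq s

variable [SecondCountableTopology M] [BorelSpace M]

lemma measurableEmbedding_emb (R : StripParam d m a b) (hmc : Continuous m) (s : Ioo a b) :
    MeasurableEmbedding (R.emb s) :=
  (R.isOpenEmbedding_emb hmc s).measurableEmbedding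

/-- A change of the base level carries one product measure to the other. -/
lemma map_productMeasure_change (R : StripParam d m a b) (hmc : Continuous m) (s r : Ioo a b) :
    (R.productMeasure s).map (Prod.map id (R.F s r)) = R.productMeasure r := by
  have hF : Measurable (Prod.map (id : Ioo a b → Ioo a b) (R.F s r)) :=
    (continuous_id.prodMap (R.levelHomeo s r).continuous).measurable
  have h : ((R.productMeasure s).map (Prod.map id (R.F s r))).map (R.emb r)
      = (R.productMeasure r).map (R.emb r) := by
    rw [Measure.map_map (R.continuous_emb r).measurable hF, map_productMeasure,
      ← R.map_productMeasure s]
    congr 1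
    funext q
    exact R.emb_change s r q.1 q.2
  rw [← (R.measurableEmbedding_emb hmc r).comap_map ((R.productMeasure s).map _), h,
    (R.measurableEmbedding_emb hmc r).comap_map]

variable [IsManifold (𝓡 d) ∞ M] [IsContMDiffRiemannianBundle (𝓡 d) ∞ (EuclideanSpace ℝ (Fin d))
      (fun x : M => TangentSpace (𝓡 d) x)]

lemma prod_levelMeasure_univ_prod_ne_zero (R : StripParam d m a b) (hmc : Continuous m)
    (s : Ioo a b) {U : Set (levelSet m s)} (hU : IsOpen U) (hne : U.Nonempty) :
    (ioVolume a b).prod (levelMeasure d m s) (univ ×ˢ U) ≠ 0 := by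
  intro h0
  have hUo : IsOpen (univ ×ˢ U : Set (Ioo a b × levelSet m s)) := isOpen_univ.prod hU
  have h1 : R.productMeasure s (univ ×ˢ U) = 0 :=
    withDensity_absolutelyContinuous _ _ h0
  have hO : IsOpen (R.emb s '' (univ ×ˢ U)) := (R.isOpenEmbedding_emb hmc s).isOpenMap _ hUo
  have h2 : riemannianMeasure d M (R.emb s '' (univ ×ˢ U)) = 0 := by
    have h3 : (R.productMeasure s).map (R.emb s) (R.emb s '' (univ ×ˢ U)) = 0 := by
      rw [(R.measurableEmbedding_emb hmc s).map_apply,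
        preimage_image_eq _ (R.isOpenEmbedding_emb hmc s).injective, h1]
    rw [map_productMeasure, Measure.restrict_apply hO.measurableSet,
      inter_eq_left.2] at h3
    · exact h3
    · rintro _ ⟨q, -, rfl⟩
      exact R.emb_mem s q
  obtain ⟨x, hx⟩ := hne
  exact (hO.measure_pos (riemannianMeasure d M) ⟨_, (s, x), ⟨trivial, hx⟩, rfl⟩).ne' h2

/-- The product measure is not zero, so it is the integral of the measures of its slices; on a
compact set of positive measure it is finite, as the Riemannian measure is locally finite. -/
lemma isFiniteMeasure_levelMeasure (R : StripParam d m a b) (hm : IsProperMorse d m) (s : Ioo a b) :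
    IsFiniteMeasure (levelMeasure d m s) := by
  have hmc := hm.smooth.continuous
  have := hm.compactSpace_levelSet s
  rcases isEmpty_or_nonempty (levelSet m s) with hE | hne
  · rw [Measure.eq_zero_of_isEmpty (levelMeasure d m s)]
    infer_instance
  have hne0 := R.prod_levelMeasure_univ_prod_ne_zero hmc s isOpen_univ univ_nonempty
  -- without measurability of the slices the product measure would be zero by convention
  have hae : AEMeasurable (fun t : Ioo a b => (levelMeasure d m s).map (Prod.mk t))
      (ioVolume a b) := by
    by_contra hna
    refine hne0 ?_
    rw [Measure.prod, Measure.bind, Measure.map_of_not_aemeasurable hna]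
    simp
  have : LocallyCompactSpace (Ioo a b) := isOpen_Ioo.locallyCompactSpace
  obtain ⟨K, hK, hsK⟩ := exists_compact_mem_nhds s
  have hKJ : IsCompact (K ×ˢ (univ : Set (levelSet m s))) := hK.prod isCompact_univ
  have hKm : MeasurableSet K := hK.isClosed.measurableSet
  obtain ⟨q₀, -, hq₀⟩ := hKJ.exists_isMinOn
    ⟨(s, Classical.arbitrary _), mem_of_mem_nhds hsK, trivial⟩ (R.continuous_ψ s).continuousOn
  set c := R.ψ s q₀.1 q₀.2 with hc
  have hcpos : 0 < c := R.ψ_pos _ _ _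
  have h1 : R.productMeasure s (K ×ˢ univ) < ⊤ := by
    have h2 := Measure.le_map_apply (μ := R.productMeasure s)
      (R.continuous_emb s).aemeasurable (R.emb s '' (K ×ˢ univ))
    rw [preimage_image_eq _ (R.isOpenEmbedding_emb hmc s).injective, map_productMeasure] at h2
    exact (h2.trans (Measure.restrict_apply_le _ _)).trans_lt
      (hKJ.image (R.continuous_emb s)).measure_lt_top
  have h2 : ENNReal.ofReal c * (ioVolume a b).prod (levelMeasure d m s) (K ×ˢ univ) ≤
      R.productMeasure s (K ×ˢ univ) := by
    rw [productMeasure, withDensity_apply _ (hKm.prod MeasurableSet.univ), ← setLIntegral_const]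
    exact setLIntegral_mono' (hKm.prod MeasurableSet.univ) fun q hq =>
      ENNReal.ofReal_le_ofReal (hq₀ hq)
  have h3 : (ioVolume a b).prod (levelMeasure d m s) (K ×ˢ univ) =
      levelMeasure d m s univ * ioVolume a b K := by
    rw [Measure.prod, Measure.bind_apply (hKm.prod MeasurableSet.univ) hae, ← setLIntegral_const,
      ← lintegral_indicator hKm]
    refine lintegral_congr fun t => ?_
    rw [Measure.map_apply measurable_prodMk_left (hKm.prod MeasurableSet.univ)]
    by_cases ht : t ∈ K
    · rw [mk_preimage_prod_right ht, indicator_of_mem ht]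
    · rw [mk_preimage_prod_right_eq_empty ht, indicator_of_notMem ht, measure_empty]
  have hKpos : ioVolume a b K ≠ 0 := (Measure.measure_pos_of_mem_nhds _ hsK).ne'
  refine ⟨?_⟩
  have h4 := h2.trans_lt h1
  rw [h3] at h4
  by_contra! htop
  rw [top_le_iff.1 htop, ENNReal.top_mul hKpos,
    ENNReal.mul_top (ENNReal.ofReal_pos.2 hcpos).ne'] at h4
  exact lt_irrefl _ h4

lemma isOpenPosMeasure_levelMeasure (R : StripParam d m a b) (hm : IsProperMorse d m)
    (s : Ioo a b) :
    (levelMeasure d m s).IsOpenPosMeasure := by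
  have := R.isFiniteMeasure_levelMeasure hm s
  refine ⟨fun U hU hne h0 => ?_⟩
  refine R.prod_levelMeasure_univ_prod_ne_zero hm.smooth.continuous s hU hne ?_
  rw [Measure.prod_prod, h0, mul_zero]

/-- The weights which belong to two base levels have the same ratios in the direction of `I`. -/
lemma ψ_change (R : StripParam d m a b) (hm : IsProperMorse d m) (s r t t' : Ioo a b)
    (x : levelSet m s) :
    R.ψ r t (R.F s r x) * R.ψ s t' x = R.ψ r t' (R.F s r x) * R.ψ s t x := by
  have hmc := hm.smooth.continuous
  have := R.isFiniteMeasure_levelMeasure hm s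
  have := R.isFiniteMeasure_levelMeasure hm r
  have := R.isOpenPosMeasure_levelMeasure hm s
  have hF := (R.levelHomeo r s).continuous
  have hF' := (R.levelHomeo s r).continuous
  have hcont : Continuous fun q : Ioo a b × levelSet m s => R.ψ r q.1 (R.F s r q.2) :=
    (R.continuous_ψ r).comp (continuous_fst.prodMk (hF'.comp continuous_snd))
  have : IsFiniteMeasure ((levelMeasure d m r).map (R.F r s)) :=
    Measure.isFiniteMeasure_map _ _
  refine density_ratio_eq (l := ioVolume a b) (ν := levelMeasure d m s)
    (ν' := (levelMeasure d m r).map (R.F r s)) (f := fun q => R.ψ s q.1 q.2)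
    (f' := fun q => R.ψ r q.1 (R.F s r q.2)) (R.continuous_ψ s) hcont
    (fun q => R.ψ_pos _ _ _) (fun q => R.ψ_pos _ _ _) ?_ t t' x
  have h := R.map_productMeasure_change hmc r s
  rw [productMeasure, productMeasure] at h
  refine h.symm.trans ?_
  have hprod : (ioVolume a b).prod ((levelMeasure d m r).map (R.F r s)) =
      ((ioVolume a b).prod (levelMeasure d m r)).map (Prod.map id (R.F r s)) := by
    conv_lhs => rw [← Measure.map_id (μ := ioVolume a b)]
    exact Measure.map_prod_map _ _ measurable_id hF.measurable
  have hPm : Measurable (Prod.map (id : Ioo a b → Ioo a b) (R.F r s)) :=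
    measurable_id.prodMap hF.measurable
  refine Measure.ext fun E hE => ?_
  rw [Measure.map_apply hPm hE, withDensity_apply _ (hPm hE), withDensity_apply _ hE, hprod,
    setLIntegral_map hE hcont.measurable.ennreal_ofReal hPm]
  refine setLIntegral_congr_fun (hPm hE) fun q _ => ?_
  simp [R.F_inv]

end Measures

end StripParam

/-! ### The projection on the line -/

namespace IsAWWCutoff

variable {δ : ℝ} {s : ℝ → ℝ}

lemma eq_zero (hs : IsAWWCutoff δ s) {t : ℝ} (ht : t ≤ -δ) : s t = 0 :=
  image_eq_zero_of_notMem_tsupport fun h => (hs.supp h).not_ge ht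

lemma eq_one (hs : IsAWWCutoff δ s) {t : ℝ} (ht : δ ≤ t) : s t = 1 := by
  have h := hs.sq_add_sq t
  rw [hs.eq_zero (neg_le_neg ht)] at h
  have h0 := (hs.mem_Icc t).1
  nlinarith

end IsAWWCutoff

/-- The coefficient `s(t - θ) s(θ - t)` of the reflected term of an Auscher–Weiss–Wickerhauser
operator. -/
def awwCross (s : ℝ → ℝ) (θ t : ℝ) : ℝ := s (t - θ) * s (θ - t)

/-- The coefficient of the unreflected term of the projection `E_{θ₁} - E_{θ₂}`. -/
def awwDiag (s : ℝ → ℝ) (θ₁ θ₂ t : ℝ) : ℝ := s (t - θ₁) ^ 2 - s (t - θ₂) ^ 2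

/-- The projection `E_{θ₁} - E_{θ₂}` on functions on the line. -/
def awwLine (s : ℝ → ℝ) (θ₁ θ₂ : ℝ) (g : ℝ → ℝ) (t : ℝ) : ℝ :=
  awwDiag s θ₁ θ₂ t * g t + awwCross s θ₁ t * g (2 * θ₁ - t) - awwCross s θ₂ t * g (2 * θ₂ - t)

section Line

variable {δ : ℝ} {s : ℝ → ℝ} {θ₁ θ₂ : ℝ}

lemma awwCross_eq_zero (hs : IsAWWCutoff δ s) {θ t : ℝ} (h : t ∉ Ioo (θ - δ) (θ + δ)) :
    awwCross s θ t = 0 := by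
  unfold awwCross
  by_cases h1 : θ - δ < t
  · rw [hs.eq_zero (t := θ - t) (by by_contra h2; exact h ⟨h1, by linarith⟩), mul_zero]
  · rw [hs.eq_zero (t := t - θ) (by linarith), zero_mul]

lemma awwDiag_eq_zero (hs : IsAWWCutoff δ s) (h₁₂ : θ₁ + δ < θ₂ - δ) (hδ : 0 < δ) {t : ℝ}
    (h : t ∉ Ioo (θ₁ - δ) (θ₂ + δ)) : awwDiag s θ₁ θ₂ t = 0 := by
  unfold awwDiag
  by_cases h1 : θ₁ - δ < t
  · have h2 : θ₂ + δ ≤ t := by by_contra h2; exact h ⟨h1, by linarith⟩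
    rw [hs.eq_one (t := t - θ₁) (by linarith), hs.eq_one (t := t - θ₂) (by linarith), sub_self]
  · rw [hs.eq_zero (t := t - θ₁) (by linarith), hs.eq_zero (t := t - θ₂) (by linarith), sub_self]

lemma awwLine_of_mem_left (hs : IsAWWCutoff δ s) (h₁₂ : θ₁ + δ < θ₂ - δ) (g : ℝ → ℝ) {t : ℝ}
    (h : t ∈ Ioo (θ₁ - δ) (θ₁ + δ)) :
    awwLine s θ₁ θ₂ g t = s (t - θ₁) ^ 2 * g t + s (t - θ₁) * s (θ₁ - t) * g (2 * θ₁ - t) := by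
  simp only [awwLine, awwDiag, awwCross]
  rw [hs.eq_zero (t := t - θ₂) (by linarith [h.2])]
  ring

lemma awwLine_of_mem_right (hs : IsAWWCutoff δ s) (h₁₂ : θ₁ + δ < θ₂ - δ) (g : ℝ → ℝ) {t : ℝ}
    (h : t ∈ Ioo (θ₂ - δ) (θ₂ + δ)) :
    awwLine s θ₁ θ₂ g t = s (θ₂ - t) ^ 2 * g t - s (t - θ₂) * s (θ₂ - t) * g (2 * θ₂ - t) := by
  simp only [awwLine, awwDiag, awwCross]
  have h1 := hs.sq_add_sq (t - θ₂)
  rw [neg_sub] at h1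
  have h2 : s (θ₂ - t) ^ 2 = 1 - s (t - θ₂) ^ 2 := by linarith
  rw [hs.eq_one (t := t - θ₁) (by linarith [h.1, h.2]),
    hs.eq_zero (t := θ₁ - t) (by linarith [h.1, h.2]), h2]
  ring

lemma awwLine_of_notMem (hs : IsAWWCutoff δ s) (g : ℝ → ℝ) {t : ℝ}
    (h : t ∉ Ioo (θ₁ - δ) (θ₁ + δ)) (h' : t ∉ Ioo (θ₂ - δ) (θ₂ + δ)) :
    awwLine s θ₁ θ₂ g t = awwDiag s θ₁ θ₂ t * g t := by
  simp only [awwLine]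
  rw [awwCross_eq_zero hs h, awwCross_eq_zero hs h']
  ring

lemma awwDiag_eq_zero_or_one (hs : IsAWWCutoff δ s) (h₁₂ : θ₁ + δ < θ₂ - δ) (hδ : 0 < δ) {t : ℝ}
    (h : t ∉ Ioo (θ₁ - δ) (θ₁ + δ)) (h' : t ∉ Ioo (θ₂ - δ) (θ₂ + δ)) :
    awwDiag s θ₁ θ₂ t = 0 ∨ awwDiag s θ₁ θ₂ t = 1 := by
  by_cases h1 : t ∈ Ioo (θ₁ - δ) (θ₂ + δ)
  · right
    have h2 : θ₁ + δ ≤ t := by by_contra h2; exact h ⟨h1.1, by linarith⟩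
    have h3 : t ≤ θ₂ - δ := by by_contra h3; exact h' ⟨by linarith, h1.2⟩
    rw [awwDiag, hs.eq_one (t := t - θ₁) (by linarith), hs.eq_zero (t := t - θ₂) (by linarith)]
    norm_num
  · exact Or.inl (awwDiag_eq_zero hs h₁₂ hδ h1)

lemma reflect_mem_Ioo {θ t : ℝ} (h : t ∈ Ioo (θ - δ) (θ + δ)) :
    2 * θ - t ∈ Ioo (θ - δ) (θ + δ) :=
  ⟨by linarith [h.2], by linarith [h.1]⟩

lemma awwLine_awwLine (hs : IsAWWCutoff δ s) (h₁₂ : θ₁ + δ < θ₂ - δ) (hδ : 0 < δ) (g : ℝ → ℝ)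
    (t : ℝ) : awwLine s θ₁ θ₂ (awwLine s θ₁ θ₂ g) t = awwLine s θ₁ θ₂ g t := by
  by_cases h : t ∈ Ioo (θ₁ - δ) (θ₁ + δ)
  · have h1 := hs.sq_add_sq (t - θ₁)
    rw [neg_sub] at h1
    rw [awwLine_of_mem_left hs h₁₂ _ h, awwLine_of_mem_left hs h₁₂ _ h,
      awwLine_of_mem_left hs h₁₂ _ (reflect_mem_Ioo h), show 2 * θ₁ - (2 * θ₁ - t) = t by ring,
      show 2 * θ₁ - t - θ₁ = θ₁ - t by ring, show θ₁ - (2 * θ₁ - t) = t - θ₁ by ring]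
    linear_combination (s (t - θ₁) ^ 2 * g t + s (t - θ₁) * s (θ₁ - t) * g (2 * θ₁ - t)) * h1
  by_cases h' : t ∈ Ioo (θ₂ - δ) (θ₂ + δ)
  · have h1 := hs.sq_add_sq (t - θ₂)
    rw [neg_sub] at h1
    rw [awwLine_of_mem_right hs h₁₂ _ h', awwLine_of_mem_right hs h₁₂ _ h',
      awwLine_of_mem_right hs h₁₂ _ (reflect_mem_Ioo h'), show 2 * θ₂ - (2 * θ₂ - t) = t by ring,
      show 2 * θ₂ - t - θ₂ = θ₂ - t by ring, show θ₂ - (2 * θ₂ - t) = t - θ₂ by ring]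
    linear_combination (s (θ₂ - t) ^ 2 * g t - s (t - θ₂) * s (θ₂ - t) * g (2 * θ₂ - t)) * h1
  · rw [awwLine_of_notMem hs _ h h', awwLine_of_notMem hs _ h h']
    rcases awwDiag_eq_zero_or_one hs h₁₂ hδ h h' with h0 | h0 <;> rw [h0] <;> ring

end Line

/-! ### Slices of functions on the strip -/

namespace StripParam

section Slices

variable {d : ℕ} {M : Type*} [TopologicalSpace M] [ChartedSpace (EuclideanSpace ℝ (Fin d)) M]
  [RiemannianBundle (fun x : M => TangentSpace (𝓡 d) x)] [MeasurableSpace M]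
  {m : M → ℝ} {a b : ℝ} (R : StripParam d m a b) (p : ℝ≥0∞) (ϑ : Ioo a b)

/-- The weight `(ψ(t, x) / ψ(ϑ, x))^{1/p}`. -/
noncomputable def weight (t : Ioo a b) (x : levelSet m ϑ) : ℝ :=
  (R.ψ ϑ t x / R.ψ ϑ ϑ x) ^ (1 / p.toReal)

lemma weight_pos (t : Ioo a b) (x : levelSet m ϑ) : 0 < R.weight p ϑ t x :=
  Real.rpow_pos_of_pos (div_pos (R.ψ_pos _ _ _) (R.ψ_pos _ _ _)) _

lemma weight_inv (t : Ioo a b) (x : levelSet m ϑ) :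
    (R.ψ ϑ ϑ x / R.ψ ϑ t x) ^ (1 / p.toReal) = (R.weight p ϑ t x)⁻¹ := by
  rw [weight, ← Real.inv_rpow (div_pos (R.ψ_pos _ _ _) (R.ψ_pos _ _ _)).le, inv_div]

open Classical in
/-- The slice at `t` of a function on the strip, as a function on `J_ϑ`, weighted so that the norm
in `Lᵖ(M_I)` is the norm of `t ↦ slice t` in `Lᵖ(I; Lᵖ(J_ϑ, ψ(ϑ, ·) ν_ϑ))`.  It is zero for `t`
outside `I`. -/
noncomputable def slice (t : ℝ) : (M → ℝ) →ₗ[ℝ] (levelSet m ϑ → ℝ) where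
  toFun f x := if h : t ∈ Ioo a b then f (R.F ϑ ⟨t, h⟩ x) * R.weight p ϑ ⟨t, h⟩ x else 0
  map_add' f g := by
    funext x
    by_cases h : t ∈ Ioo a b <;> simp only [h, dite_true, dite_false, Pi.add_apply] <;> ring
  map_smul' c f := by
    funext x
    by_cases h : t ∈ Ioo a b <;>
      simp only [h, dite_true, dite_false, Pi.smul_apply, smul_eq_mul, RingHom.id_apply] <;> ring

lemma slice_of_mem (f : M → ℝ) (t : Ioo a b) (x : levelSet m ϑ) :
    R.slice p ϑ t f x = f (R.F ϑ t x) * R.weight p ϑ t x := by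
  simp only [slice, LinearMap.coe_mk, AddHom.coe_mk]
  rw [dif_pos t.2]

lemma slice_of_notMem (f : M → ℝ) {t : ℝ} (h : t ∉ Ioo a b) : R.slice p ϑ t f = 0 := by
  funext x
  simp only [slice, LinearMap.coe_mk, AddHom.coe_mk]
  rw [dif_neg h]
  rfl

/-- A function on `M` is determined by its slices and its values outside the strip. -/
lemma ext_of_slice {f g : M → ℝ} (h : ∀ y, m y ∉ Ioo a b → f y = g y)
    (h' : ∀ t : Ioo a b, R.slice p ϑ t f = R.slice p ϑ t g) : f = g := by
  funext y
  by_cases hy : m y ∈ Ioo a b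
  · have h1 := congrFun (h' ⟨m y, hy⟩) (R.proj ϑ ⟨y, hy⟩)
    rw [slice_of_mem, slice_of_mem] at h1
    have h2 : (R.F ϑ ⟨m y, hy⟩ (R.proj ϑ ⟨y, hy⟩) : M) = y := R.emb_proj ϑ ⟨y, hy⟩
    rw [h2] at h1
    exact mul_right_cancel₀ (R.weight_pos p ϑ _ _).ne' h1
  · exact h y hy

lemma globalLift_of_notMem (P : Module.End ℝ (levelSet m ϑ → ℝ)) (f : M → ℝ) {y : M}
    (hy : m y ∉ Ioo a b) : R.globalLift p ϑ P f y = 0 := by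
  simp only [globalLift, LinearMap.coe_mk, AddHom.coe_mk]
  rw [dif_neg hy]

lemma slice_eq (f : M → ℝ) (t : Ioo a b) : R.slice p ϑ t f =
    fun z => f (R.F ϑ t z) * (R.ψ ϑ t z / R.ψ ϑ ϑ z) ^ (1 / p.toReal) :=
  funext fun z => R.slice_of_mem p ϑ f t z

lemma globalLift_apply_F (P : Module.End ℝ (levelSet m ϑ → ℝ)) (f : M → ℝ) (t : Ioo a b)
    (x : levelSet m ϑ) : R.globalLift p ϑ P f (R.F ϑ t x) =
      P (R.slice p ϑ t f) x * (R.weight p ϑ t x)⁻¹ := by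
  have hmem : m (R.F ϑ t x) ∈ Ioo a b := R.emb_mem ϑ (t, x)
  have hq : ((⟨m (R.F ϑ t x), hmem⟩, R.F ⟨m (R.F ϑ t x), hmem⟩ ϑ ⟨R.F ϑ t x, rfl⟩) :
      Ioo a b × levelSet m ϑ) = (t, x) :=
    Prod.ext (Subtype.ext (R.m_F ϑ t x)) ((R.proj_emb ϑ ϑ (t, x) hmem).trans (R.F_self ϑ x))
  simp only [globalLift, LinearMap.coe_mk, AddHom.coe_mk]
  rw [dif_pos hmem, hq, ← weight_inv, slice_eq]
  rfl

lemma slice_globalLift (P : Module.End ℝ (levelSet m ϑ → ℝ)) (f : M → ℝ) (t : ℝ) :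
    R.slice p ϑ t (R.globalLift p ϑ P f) = P (R.slice p ϑ t f) := by
  by_cases ht : t ∈ Ioo a b
  · funext x
    have h := R.slice_of_mem p ϑ (R.globalLift p ϑ P f) ⟨t, ht⟩ x
    rw [globalLift_apply_F, inv_mul_cancel_right₀ (R.weight_pos p ϑ _ _).ne'] at h
    exact h
  · rw [slice_of_notMem _ _ _ _ ht, slice_of_notMem _ _ _ _ ht, map_zero]

variable {p ϑ} in
lemma End_ext_of_slice {B B' : Module.End ℝ (M → ℝ)}
    (h : ∀ f y, m y ∉ Ioo a b → B f y = B' f y)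
    (h' : ∀ f, ∀ t : Ioo a b, R.slice p ϑ t (B f) = R.slice p ϑ t (B' f)) : B = B' :=
  LinearMap.ext fun f => R.ext_of_slice p ϑ (h f) (h' f)

lemma globalLift_comp (P P' : Module.End ℝ (levelSet m ϑ → ℝ)) :
    R.globalLift p ϑ P ∘ₗ R.globalLift p ϑ P' = R.globalLift p ϑ (P ∘ₗ P') := by
  refine R.End_ext_of_slice (p := p) (ϑ := ϑ) (fun f y hy => ?_) fun f t => ?_
  · rw [LinearMap.comp_apply, globalLift_of_notMem _ _ _ _ _ hy, globalLift_of_notMem _ _ _ _ _ hy]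
  · rw [LinearMap.comp_apply, slice_globalLift, slice_globalLift, slice_globalLift,
      LinearMap.comp_apply]

/-- The global lifting `P ↦ Π^M`, as a linear map. -/
noncomputable def globalLiftₗ :
    Module.End ℝ (levelSet m ϑ → ℝ) →ₗ[ℝ] Module.End ℝ (M → ℝ) where
  toFun := R.globalLift p ϑ
  map_add' P P' := by
    refine R.End_ext_of_slice (p := p) (ϑ := ϑ) (fun f y hy => ?_) fun f t => ?_
    · simp only [LinearMap.add_apply, Pi.add_apply, globalLift_of_notMem _ _ _ _ _ hy, add_zero]
    · simp only [LinearMap.add_apply, map_add, slice_globalLift]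
  map_smul' c P := by
    refine R.End_ext_of_slice (p := p) (ϑ := ϑ) (fun f y hy => ?_) fun f t => ?_
    · simp only [RingHom.id_apply, LinearMap.smul_apply, Pi.smul_apply,
        globalLift_of_notMem _ _ _ _ _ hy, smul_zero]
    · simp only [RingHom.id_apply, LinearMap.smul_apply, map_smul, slice_globalLift]

lemma globalLiftₗ_apply (P : Module.End ℝ (levelSet m ϑ → ℝ)) :
    R.globalLiftₗ p ϑ P = R.globalLift p ϑ P := rfl

end Slices

section Latitudinal

variable {d : ℕ} {M : Type*} [TopologicalSpace M] [SecondCountableTopology M]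
  [ChartedSpace (EuclideanSpace ℝ (Fin d)) M]
  [RiemannianBundle (fun x : M => TangentSpace (𝓡 d) x)] [MeasurableSpace M] [BorelSpace M]
  [IsManifold (𝓡 d) ∞ M] [IsContMDiffRiemannianBundle (𝓡 d) ∞ (EuclideanSpace ℝ (Fin d))
      (fun x : M => TangentSpace (𝓡 d) x)]
  {m : M → ℝ} {a b : ℝ} (R : StripParam d m a b) (p : ℝ≥0∞) (ϑ : Ioo a b)
  {δ : ℝ} {s : ℝ → ℝ}

/-- The weights based at another level `θ` give the same weights for slices. -/
lemma weight_mul_ratio (hm : IsProperMorse d m) (θ t t' : Ioo a b) (x : levelSet m ϑ) :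
    (R.ψ θ t' (R.F ϑ θ x) / R.ψ θ t (R.F ϑ θ x)) ^ (1 / p.toReal) * R.weight p ϑ t x =
      R.weight p ϑ t' x := by
  have h := R.ψ_change hm ϑ θ t t' x
  have h1 := R.ψ_pos θ t (R.F ϑ θ x)
  have h2 := R.ψ_pos θ t' (R.F ϑ θ x)
  have h3 := R.ψ_pos ϑ t x
  have h4 := R.ψ_pos ϑ t' x
  have h5 := R.ψ_pos ϑ ϑ x
  rw [weight, weight, ← Real.mul_rpow (div_pos h2 h1).le (div_pos h3 h5).le]
  congr 1
  field_simp
  linarith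

/-- On slices, `E_θ` is the Auscher–Weiss–Wickerhauser operator on the line; the weights based at
`θ` are absorbed by those of the slices. -/
lemma slice_aww (hm : IsProperMorse d m) (hs : IsAWWCutoff δ s) (θ : Ioo a b)
    (ha : a ≤ θ - δ) (hb : θ + δ ≤ b) (f : M → ℝ) (t : ℝ) :
    R.slice p ϑ t (R.aww p s δ θ f) =
      s (t - θ) ^ 2 • R.slice p ϑ t f + awwCross s θ t • R.slice p ϑ (2 * θ - t) f := by
  by_cases htI : t ∈ Ioo a b
  swap
  · rw [slice_of_notMem _ _ _ _ htI, slice_of_notMem _ _ _ _ htI, smul_zero, zero_add,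
      awwCross_eq_zero hs fun h => htI ⟨ha.trans_lt h.1, h.2.trans_le hb⟩, zero_smul]
  lift t to Ioo a b using htI
  funext x
  rw [slice_of_mem]
  simp only [Pi.add_apply, Pi.smul_apply, smul_eq_mul]
  rw [slice_of_mem]
  have hmt : m (R.F ϑ t x) = t := R.m_F ϑ t x
  by_cases h1 : (θ : ℝ) + δ ≤ t
  · have hval : R.aww p s δ θ f (R.F ϑ t x) = f (R.F ϑ t x) := by
      simp only [aww, LinearMap.coe_mk, AddHom.coe_mk]
      rw [if_pos (by rw [hmt]; exact h1)]
    rw [hval, awwCross_eq_zero hs fun h => h.2.not_ge h1, hs.eq_one (by linarith)]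
    ring
  by_cases h2 : (t : ℝ) ≤ θ - δ
  · have hval : R.aww p s δ θ f (R.F ϑ t x) = 0 := by
      simp only [aww, LinearMap.coe_mk, AddHom.coe_mk]
      rw [if_neg (by rw [hmt]; exact h1), dif_neg]
      rw [hmt]
      exact fun h => h.1.1.not_ge h2
    rw [hval, awwCross_eq_zero hs fun h => h.1.not_ge h2, hs.eq_zero (by linarith)]
    ring
  have hmem : (t : ℝ) ∈ Ioo ((θ : ℝ) - δ) (θ + δ) := ⟨not_le.1 h2, not_le.1 h1⟩
  have ht' : 2 * (θ : ℝ) - t ∈ Ioo a b :=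
    ⟨ha.trans_lt (reflect_mem_Ioo hmem).1, (reflect_mem_Ioo hmem).2.trans_le hb⟩
  have hsl := R.slice_of_mem p ϑ f ⟨_, ht'⟩ x
  simp only at hsl
  rw [hsl, ← R.weight_mul_ratio p ϑ hm θ t ⟨_, ht'⟩ x]
  have hx : R.F ⟨m (R.F ϑ t x), R.emb_mem ϑ (t, x)⟩ θ ⟨R.F ϑ t x, rfl⟩ = R.F ϑ θ x :=
    R.F_eq_of_coe_eq rfl
  have hval : R.aww p s δ θ f (R.F ϑ t x) = s (t - θ) ^ 2 * f (R.F ϑ t x)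
      + s (t - θ) * s (-t + θ) * (R.ψ θ ⟨_, ht'⟩ (R.F ϑ θ x) / R.ψ θ t (R.F ϑ θ x)) ^
        (1 / p.toReal) * f (R.F ϑ ⟨_, ht'⟩ x) := by
    have hF : R.F θ ⟨_, ht'⟩ (R.F ϑ θ x) = R.F ϑ ⟨_, ht'⟩ x := R.F_comp ϑ θ _ x
    have hF2 : ∀ h, (R.F θ ⟨2 * (θ : ℝ) - m (R.F ϑ t x), h⟩ (R.F ϑ θ x) : M) =
        R.F θ ⟨_, ht'⟩ (R.F ϑ θ x) := fun h =>
      congrArg (fun u : Ioo a b => (R.F θ u (R.F ϑ θ x) : M))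
        (Subtype.ext (congrArg (fun v => 2 * (θ : ℝ) - v) hmt))
    simp only [aww, LinearMap.coe_mk, AddHom.coe_mk]
    rw [if_neg (by rw [hmt]; exact h1), dif_pos (by rw [hmt]; exact ⟨hmem, t.2, ht'⟩)]
    simp only [hx]
    rw [← hF]
    simp only [hmt]
    rw [hF2]
  rw [hval, awwCross, neg_add_eq_sub]
  ring

variable {ϑ₁ ϑ₂ : Ioo a b}

lemma slice_latitudinal (hm : IsProperMorse d m) (hs : IsAWWCutoff δ s) (hδ : 0 < δ)
    (ha : a ≤ ϑ₁ - δ) (hb : ϑ₂ + δ ≤ b) (h₁₂ : (ϑ₁ : ℝ) + δ < ϑ₂ - δ) (f : M → ℝ) (t : ℝ) :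
    R.slice p ϑ t (R.latitudinal p s δ ϑ₁ ϑ₂ f) =
      awwDiag s ϑ₁ ϑ₂ t • R.slice p ϑ t f + awwCross s ϑ₁ t • R.slice p ϑ (2 * ϑ₁ - t) f
        - awwCross s ϑ₂ t • R.slice p ϑ (2 * ϑ₂ - t) f := by
  rw [latitudinal, LinearMap.sub_apply, map_sub,
    R.slice_aww p ϑ hm hs ϑ₁ ha (by linarith) f t,
    R.slice_aww p ϑ hm hs ϑ₂ (by linarith) hb f t, awwDiag, sub_smul]
  abel

lemma slice_latitudinal_apply (hm : IsProperMorse d m) (hs : IsAWWCutoff δ s) (hδ : 0 < δ)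
    (ha : a ≤ ϑ₁ - δ) (hb : ϑ₂ + δ ≤ b) (h₁₂ : (ϑ₁ : ℝ) + δ < ϑ₂ - δ) (f : M → ℝ) (t : ℝ)
    (x : levelSet m ϑ) :
    R.slice p ϑ t (R.latitudinal p s δ ϑ₁ ϑ₂ f) x =
      awwLine s ϑ₁ ϑ₂ (fun t => R.slice p ϑ t f x) t := by
  rw [R.slice_latitudinal p ϑ hm hs hδ ha hb h₁₂]
  rfl

end Latitudinal

section LatitudinalAlgebra

variable {d : ℕ} {M : Type*} [TopologicalSpace M]
  [ChartedSpace (EuclideanSpace ℝ (Fin d)) M]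
  [RiemannianBundle (fun x : M => TangentSpace (𝓡 d) x)] [MeasurableSpace M]
  {m : M → ℝ} {a b : ℝ} (R : StripParam d m a b) (p : ℝ≥0∞) (ϑ : Ioo a b)
  {δ : ℝ} {s : ℝ → ℝ} {ϑ₁ ϑ₂ : Ioo a b}

lemma latitudinal_of_notMem (hδ : 0 < δ)
    (h₁₂ : (ϑ₁ : ℝ) + δ < ϑ₂ - δ) (f : M → ℝ) {y : M}
    (hy : m y ∉ Ioo ((ϑ₁ : ℝ) - δ) (ϑ₂ + δ)) : R.latitudinal p s δ ϑ₁ ϑ₂ f y = 0 := by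
  simp only [latitudinal, LinearMap.sub_apply, Pi.sub_apply, aww, LinearMap.coe_mk, AddHom.coe_mk]
  by_cases h : (ϑ₁ : ℝ) - δ < m y
  · have h' : (ϑ₂ : ℝ) + δ ≤ m y := by by_contra h'; exact hy ⟨h, by linarith⟩
    rw [if_pos h', if_pos (by linarith), sub_self]
  · rw [if_neg (by linarith), if_neg (by linarith), dif_neg fun hh => h hh.1.1,
      dif_neg fun hh => h (by linarith [hh.1.1]), sub_self]

lemma liftedOp_of_notMem (P : Module.End ℝ (levelSet m ϑ → ℝ)) (f : M → ℝ) {y : M}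
    (hy : m y ∉ Ioo a b) : R.liftedOp p s δ ϑ₁ ϑ₂ ϑ P f y = 0 :=
  R.globalLift_of_notMem p ϑ P _ hy

lemma slice_liftedOp (P : Module.End ℝ (levelSet m ϑ → ℝ)) (f : M → ℝ) (t : ℝ) :
    R.slice p ϑ t (R.liftedOp p s δ ϑ₁ ϑ₂ ϑ P f) =
      P (R.slice p ϑ t (R.latitudinal p s δ ϑ₁ ϑ₂ f)) :=
  R.slice_globalLift p ϑ P _ t

lemma liftedOp_id (hδ : 0 < δ) (ha : a ≤ ϑ₁ - δ) (hb : ϑ₂ + δ ≤ b)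
    (h₁₂ : (ϑ₁ : ℝ) + δ < ϑ₂ - δ) :
    R.liftedOp p s δ ϑ₁ ϑ₂ ϑ LinearMap.id = R.latitudinal p s δ ϑ₁ ϑ₂ := by
  refine R.End_ext_of_slice (p := p) (ϑ := ϑ) (fun f y hy => ?_) fun f t => ?_
  · rw [liftedOp_of_notMem _ _ _ _ _ hy, R.latitudinal_of_notMem p hδ h₁₂ f fun h =>
      hy ⟨ha.trans_lt h.1, h.2.trans_le hb⟩]
  · rw [slice_liftedOp]
    rfl

lemma liftedOp_add (P P' : Module.End ℝ (levelSet m ϑ → ℝ)) :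
    R.liftedOp p s δ ϑ₁ ϑ₂ ϑ (P + P') =
      R.liftedOp p s δ ϑ₁ ϑ₂ ϑ P + R.liftedOp p s δ ϑ₁ ϑ₂ ϑ P' := by
  have h := (R.globalLiftₗ p ϑ).map_add P P'
  simp only [globalLiftₗ_apply] at h
  rw [liftedOp, h, LinearMap.add_comp]
  rfl

lemma liftedOp_smul (c : ℝ) (P : Module.End ℝ (levelSet m ϑ → ℝ)) :
    R.liftedOp p s δ ϑ₁ ϑ₂ ϑ (c • P) = c • R.liftedOp p s δ ϑ₁ ϑ₂ ϑ P := by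
  have h := (R.globalLiftₗ p ϑ).map_smul c P
  simp only [globalLiftₗ_apply] at h
  rw [liftedOp, h, LinearMap.smul_comp]
  rfl

lemma liftedOp_zero :
    R.liftedOp p s δ ϑ₁ ϑ₂ ϑ (0 : Module.End ℝ (levelSet m ϑ → ℝ)) = 0 := by
  have h := (R.globalLiftₗ p ϑ).map_zero
  simp only [globalLiftₗ_apply] at h
  rw [liftedOp, h, LinearMap.zero_comp]

lemma liftedOp_sum {ι : Type*} (A : Finset ι) (P : ι → Module.End ℝ (levelSet m ϑ → ℝ)) :
    R.liftedOp p s δ ϑ₁ ϑ₂ ϑ (∑ i ∈ A, P i) = ∑ i ∈ A, R.liftedOp p s δ ϑ₁ ϑ₂ ϑ (P i) := by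
  classical
  induction A using Finset.induction_on with
  | empty => simp only [Finset.sum_empty]; exact R.liftedOp_zero p ϑ
  | insert i A hi ih => rw [Finset.sum_insert hi, Finset.sum_insert hi, liftedOp_add, ih]

variable [SecondCountableTopology M] [BorelSpace M]
  [IsManifold (𝓡 d) ∞ M] [IsContMDiffRiemannianBundle (𝓡 d) ∞ (EuclideanSpace ℝ (Fin d))
      (fun x : M => TangentSpace (𝓡 d) x)]

/-- On slices, the lifting acts in the space variable and the latitudinal projection in `t`. -/
lemma globalLift_comp_latitudinal (hm : IsProperMorse d m) (hs : IsAWWCutoff δ s) (hδ : 0 < δ)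
    (ha : a ≤ ϑ₁ - δ) (hb : ϑ₂ + δ ≤ b) (h₁₂ : (ϑ₁ : ℝ) + δ < ϑ₂ - δ)
    (P : Module.End ℝ (levelSet m ϑ → ℝ)) :
    R.globalLift p ϑ P ∘ₗ R.latitudinal p s δ ϑ₁ ϑ₂
      = R.latitudinal p s δ ϑ₁ ϑ₂ ∘ₗ R.globalLift p ϑ P := by
  refine R.End_ext_of_slice (p := p) (ϑ := ϑ) (fun f y hy => ?_) fun f t => ?_
  · rw [LinearMap.comp_apply, LinearMap.comp_apply, globalLift_of_notMem _ _ _ _ _ hy,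
      R.latitudinal_of_notMem p hδ h₁₂ _ fun h => hy ⟨ha.trans_lt h.1, h.2.trans_le hb⟩]
  · rw [LinearMap.comp_apply, LinearMap.comp_apply, slice_globalLift,
      R.slice_latitudinal p ϑ hm hs hδ ha hb h₁₂, R.slice_latitudinal p ϑ hm hs hδ ha hb h₁₂]
    simp only [slice_globalLift, map_sub, map_add, map_smul]

lemma latitudinal_comp_self (hm : IsProperMorse d m) (hs : IsAWWCutoff δ s) (hδ : 0 < δ)
    (ha : a ≤ ϑ₁ - δ) (hb : ϑ₂ + δ ≤ b) (h₁₂ : (ϑ₁ : ℝ) + δ < ϑ₂ - δ) :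
    R.latitudinal p s δ ϑ₁ ϑ₂ ∘ₗ R.latitudinal p s δ ϑ₁ ϑ₂ = R.latitudinal p s δ ϑ₁ ϑ₂ := by
  refine R.End_ext_of_slice (p := p) (ϑ := ϑ₁) (fun f y hy => ?_) fun f t => ?_
  · have hy' : m y ∉ Ioo ((ϑ₁ : ℝ) - δ) (ϑ₂ + δ) :=
      fun h => hy ⟨ha.trans_lt h.1, h.2.trans_le hb⟩
    rw [LinearMap.comp_apply, R.latitudinal_of_notMem p hδ h₁₂ _ hy',
      R.latitudinal_of_notMem p hδ h₁₂ _ hy']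
  · funext x
    simp only [LinearMap.comp_apply, R.slice_latitudinal_apply p ϑ₁ hm hs hδ ha hb h₁₂]
    exact awwLine_awwLine hs h₁₂ hδ _ _

/-- The lifted operators multiply as the operators on the level do. -/
lemma liftedOp_comp (hm : IsProperMorse d m) (hs : IsAWWCutoff δ s) (hδ : 0 < δ)
    (ha : a ≤ ϑ₁ - δ) (hb : ϑ₂ + δ ≤ b) (h₁₂ : (ϑ₁ : ℝ) + δ < ϑ₂ - δ)
    (P P' : Module.End ℝ (levelSet m ϑ → ℝ)) :
    R.liftedOp p s δ ϑ₁ ϑ₂ ϑ P ∘ₗ R.liftedOp p s δ ϑ₁ ϑ₂ ϑ P' =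
      R.liftedOp p s δ ϑ₁ ϑ₂ ϑ (P ∘ₗ P') := by
  have h := R.globalLift_comp_latitudinal p ϑ hm hs hδ ha hb h₁₂ P'
  have h' := R.latitudinal_comp_self p hm hs hδ ha hb h₁₂
  simp only [liftedOp]
  rw [← R.globalLift_comp, LinearMap.comp_assoc, LinearMap.comp_assoc,
    ← LinearMap.comp_assoc _ _ (R.latitudinal p s δ ϑ₁ ϑ₂), ← h, LinearMap.comp_assoc, h']

end LatitudinalAlgebra

end StripParam

/-! ### Lifted operators are Hestenes operators -/

/-- The support of a cut-off function stays at a positive distance from `-δ`. -/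
lemma IsAWWCutoff.exists_lt {δ : ℝ} {s : ℝ → ℝ} (hs : IsAWWCutoff δ s) (hδ : 0 < δ) :
    ∃ δ', 0 < δ' ∧ δ' < δ ∧ IsAWWCutoff δ' s := by
  have hmem : (-δ) ∈ (tsupport s)ᶜ := fun h => lt_irrefl (-δ) (hs.supp h)
  obtain ⟨ε, hε, hball⟩ := Metric.isOpen_iff.1 (isClosed_tsupport s).isOpen_compl _ hmem
  refine ⟨max (δ - ε / 2) (δ / 2), lt_max_of_lt_right (by linarith), max_lt (by linarith)
    (by linarith), hs.smooth, hs.mem_Icc, fun t ht => ?_, hs.sq_add_sq⟩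
  have h1 : -δ < t := hs.supp ht
  have h2 : -δ + ε ≤ t := by
    by_contra h2
    have h3 : t ∈ Metric.ball (-δ) ε := by
      rw [Metric.mem_ball, Real.dist_eq, abs_lt]
      constructor <;> linarith
    exact hball h3 ht
  have h3 := le_max_left (δ - ε / 2) (δ / 2)
  simp only [mem_Ioi]
  linarith

/-- An involution `σ` of an open set `K ⊆ (a, b)`, as a partial homeomorphism of `(a, b)`. -/
noncomputable def involutionHomeo {a b : ℝ} {σ : ℝ → ℝ} {K : Set ℝ} (hK : IsOpen K)
    (hKab : K ⊆ Ioo a b) (hσ : Continuous σ) (hσσ : ∀ t, σ (σ t) = t) (hσK : MapsTo σ K K) :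
    OpenPartialHomeomorph (Ioo a b) (Ioo a b) :=
  have hval : ∀ t : Ioo a b, (t : ℝ) ∈ K →
      ((open Classical in if h : σ t ∈ Ioo a b then ⟨σ t, h⟩ else t : Ioo a b) : ℝ) = σ t :=
    fun t ht => by rw [dif_pos (hKab (hσK ht))]
  { toFun := fun t => open Classical in if h : σ t ∈ Ioo a b then ⟨σ t, h⟩ else t
    invFun := fun t => open Classical in if h : σ t ∈ Ioo a b then ⟨σ t, h⟩ else t
    source := Subtype.val ⁻¹' K
    target := Subtype.val ⁻¹' K
    map_source' := fun t ht => by rw [mem_preimage, hval t ht]; exact hσK ht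
    map_target' := fun t ht => by rw [mem_preimage, hval t ht]; exact hσK ht
    left_inv' := fun t ht => Subtype.ext <| by
      rw [hval _ (by rw [hval t ht]; exact hσK ht), hval t ht, hσσ]
    right_inv' := fun t ht => Subtype.ext <| by
      rw [hval _ (by rw [hval t ht]; exact hσK ht), hval t ht, hσσ]
    open_source := hK.preimage continuous_subtype_val
    open_target := hK.preimage continuous_subtype_val
    continuousOn_toFun := IsInducing.subtypeVal.continuousOn_iff.2 <|
      (hσ.comp continuous_subtype_val).continuousOn.congr fun t ht => hval t ht
    continuousOn_invFun := IsInducing.subtypeVal.continuousOn_iff.2 <|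
      (hσ.comp continuous_subtype_val).continuousOn.congr fun t ht => hval t ht }

lemma involutionHomeo_coe {a b : ℝ} {σ : ℝ → ℝ} {K : Set ℝ} (hK : IsOpen K)
    (hKab : K ⊆ Ioo a b) (hσ : Continuous σ) (hσσ : ∀ t, σ (σ t) = t) (hσK : MapsTo σ K K)
    {t : Ioo a b} (ht : (t : ℝ) ∈ K) :
    (involutionHomeo hK hKab hσ hσσ hσK t : ℝ) = σ t := by
  change ((open Classical in if h : σ t ∈ Ioo a b then ⟨σ t, h⟩ else t : Ioo a b) : ℝ) = σ t
  rw [dif_pos (hKab (hσK ht))]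

namespace StripParam

section Lift

variable {d : ℕ} {M : Type*} [TopologicalSpace M] [ChartedSpace (EuclideanSpace ℝ (Fin d)) M]
  [RiemannianBundle (fun x : M => TangentSpace (𝓡 d) x)] [MeasurableSpace M]
  {m : M → ℝ} {a b : ℝ} (R : StripParam d m a b) (p : ℝ≥0∞) (ϑ : Ioo a b)

/-- The map `F_ϑ(t, x) ↦ F_ϑ(τ, Ψ x)` is smooth where `τ` and `Ψ` are. -/
lemma smoothAlong_pair {V : Set (levelSet m ϑ)} {Ψ : levelSet m ϑ → levelSet m ϑ}
    (hΨ : SmoothAlong (𝓡 d) (𝓡 d) (Subtype.val : levelSet m ϑ → M) (Subtype.val ∘ Ψ) V)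
    {τ : (m ⁻¹' Ioo a b : Set M) → Ioo a b} {V' : Set (m ⁻¹' Ioo a b : Set M)}
    (hτ : SmoothAlong (𝓡 d) 𝓘(ℝ, ℝ) (Subtype.val : (m ⁻¹' Ioo a b : Set M) → M)
      (fun y => (τ y : ℝ)) V') (hV : MapsTo (R.proj ϑ) V' V) :
    SmoothAlong (𝓡 d) (𝓘(ℝ, ℝ).prod (𝓡 d)) (Subtype.val : (m ⁻¹' Ioo a b : Set M) → M)
      ((fun q : Ioo a b × levelSet m ϑ => ((q.1 : ℝ), (q.2 : M))) ∘
        fun y => (τ y, Ψ (R.proj ϑ y))) V' :=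
  hτ.prodMk (hΨ.comp ((R.smooth_F_inv ϑ).mono (subset_univ V')) hV)

lemma smoothAlong_emb {V : Set (levelSet m ϑ)} {Ψ : levelSet m ϑ → levelSet m ϑ}
    (hΨ : SmoothAlong (𝓡 d) (𝓡 d) (Subtype.val : levelSet m ϑ → M) (Subtype.val ∘ Ψ) V)
    {τ : (m ⁻¹' Ioo a b : Set M) → Ioo a b} {V' : Set (m ⁻¹' Ioo a b : Set M)}
    (hτ : SmoothAlong (𝓡 d) 𝓘(ℝ, ℝ) (Subtype.val : (m ⁻¹' Ioo a b : Set M) → M)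
      (fun y => (τ y : ℝ)) V') (hV : MapsTo (R.proj ϑ) V' V) :
    SmoothAlong (𝓡 d) (𝓡 d) (Subtype.val : (m ⁻¹' Ioo a b : Set M) → M)
      (fun y => R.emb ϑ (τ y, Ψ (R.proj ϑ y))) V' :=
  (R.smooth_F ϑ).comp (R.smoothAlong_pair ϑ hΨ hτ hV) (mapsTo_univ _ _)

lemma smoothAlong_ψ {V : Set (levelSet m ϑ)} {Ψ : levelSet m ϑ → levelSet m ϑ}
    (hΨ : SmoothAlong (𝓡 d) (𝓡 d) (Subtype.val : levelSet m ϑ → M) (Subtype.val ∘ Ψ) V)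
    {τ : (m ⁻¹' Ioo a b : Set M) → Ioo a b} {V' : Set (m ⁻¹' Ioo a b : Set M)}
    (hτ : SmoothAlong (𝓡 d) 𝓘(ℝ, ℝ) (Subtype.val : (m ⁻¹' Ioo a b : Set M) → M)
      (fun y => (τ y : ℝ)) V') (hV : MapsTo (R.proj ϑ) V' V) :
    SmoothAlong (𝓡 d) 𝓘(ℝ, ℝ) (Subtype.val : (m ⁻¹' Ioo a b : Set M) → M)
      (fun y => R.ψ ϑ (τ y) (Ψ (R.proj ϑ y))) V' :=
  (R.smooth_ψ ϑ).comp (R.smoothAlong_pair ϑ hΨ hτ hV) (mapsTo_univ _ _)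

/-- The lift of a simple `H`-operator `P` on the level: for an involution `σ` of an open set `K` of
parameters and a smooth function `c` supported in a compact subset `C` of `K`, the operator which
takes the function with slices `f_t` to the one with slices `c(t) P f_{σ t}` is a simple
`H`-operator on `M`. -/
lemma exists_simpleHData_lift [T2Space M] (hm : IsProperMorse d m) [Nonempty (levelSet m ϑ)]
    (H : SimpleHData d (Subtype.val : levelSet m ϑ → M)) {σ c : ℝ → ℝ} {K C : Set ℝ}
    (hK : IsOpen K) (hKab : K ⊆ Ioo a b) (hσ : ContDiff ℝ ∞ σ) (hσσ : ∀ t, σ (σ t) = t)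
    (hσK : MapsTo σ K K) (hc : ContDiff ℝ ∞ c) (hC : IsCompact C) (hCK : C ⊆ K)
    (hcC : ∀ t ∉ C, c t = 0) :
    ∃ H' : SimpleHData d (id : M → M),
      (∀ y ∈ H'.Φ.source, ∃ q : Ioo a b × levelSet m ϑ, (q.1 : ℝ) ∈ K ∧ q.2 ∈ H.Φ.source ∧
        R.emb ϑ q = y) ∧
      (∀ y ∈ H'.Φ.target, ∃ q : Ioo a b × levelSet m ϑ, (q.1 : ℝ) ∈ K ∧ q.2 ∈ H.Φ.target ∧
        R.emb ϑ q = y) ∧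
      (∀ f y, m y ∉ Ioo a b → H'.op f y = 0) ∧
      ∀ f, ∀ t : Ioo a b, R.slice p ϑ t (H'.op f) = c t • H.op (R.slice p ϑ (σ t) f) := by
  have hmc := hm.smooth.continuous
  have : Nonempty (Ioo a b × levelSet m ϑ) := ⟨(ϑ, Classical.arbitrary _)⟩
  set S := involutionHomeo hK hKab hσ.continuous hσσ hσK with hS
  set Θ := (R.isOpenEmbedding_emb hmc ϑ).toOpenPartialHomeomorph (R.emb ϑ) with hΘ
  set Φ' : OpenPartialHomeomorph M M := Θ.symm.trans ((S.prod H.Φ).trans Θ) with hΦ'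
  have hΘinv : ∀ q, Θ.symm (R.emb ϑ q) = q := fun q => Θ.left_inv (x := q) (by simp [hΘ])
  have hΘt : ∀ q, R.emb ϑ q ∈ Θ.target := fun q => by
    rw [hΘ, IsOpenEmbedding.toOpenPartialHomeomorph_target]; exact mem_range_self q
  have hmem : ∀ q : Ioo a b × levelSet m ϑ,
      R.emb ϑ q ∈ Φ'.source ↔ (q.1 : ℝ) ∈ K ∧ q.2 ∈ H.Φ.source := by
    intro q
    have : R.emb ϑ q ∈ Φ'.source ↔ R.emb ϑ q ∈ Θ.target ∧ Θ.symm (R.emb ϑ q) ∈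
      ((S.prod H.Φ).trans Θ).source := Iff.rfl
    rw [this, hΘinv]
    simp only [hΘt q, true_and]
    simp [hΘ, hS, involutionHomeo]
  have hmem' : ∀ q : Ioo a b × levelSet m ϑ,
      R.emb ϑ q ∈ Φ'.target ↔ (q.1 : ℝ) ∈ K ∧ q.2 ∈ H.Φ.target := by
    intro q
    have : R.emb ϑ q ∈ Φ'.target ↔ (R.emb ϑ q ∈ Θ.target ∧ Θ.symm (R.emb ϑ q) ∈
      (S.prod H.Φ).target) ∧ _ := Iff.rfl
    rw [this, hΘinv]
    simp only [hΘt q, true_and]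
    simp [hΘ, hS, involutionHomeo]
  have hsource : ∀ y ∈ Φ'.source, ∃ q, R.emb ϑ q = y := by
    intro y hy
    have : y ∈ Θ.target := hy.1
    rwa [hΘ, IsOpenEmbedding.toOpenPartialHomeomorph_target] at this
  have htarget : ∀ y ∈ Φ'.target, ∃ q, R.emb ϑ q = y := by
    intro y hy
    have : y ∈ Θ.target := hy.1.1
    rwa [hΘ, IsOpenEmbedding.toOpenPartialHomeomorph_target] at this
  have happly : ∀ q, Φ' (R.emb ϑ q) = R.emb ϑ (S q.1, H.Φ q.2) := by
    intro q
    change R.emb ϑ ((S.prod H.Φ) (Θ.symm (R.emb ϑ q))) = _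
    rw [hΘinv]
    rfl
  have happly' : ∀ q, Φ'.symm (R.emb ϑ q) = R.emb ϑ (S q.1, H.Φ.symm q.2) := by
    intro q
    change R.emb ϑ ((S.prod H.Φ).symm (Θ.symm (R.emb ϑ q))) = _
    rw [hΘinv]
    rfl
  -- every point of the strip is `emb (m y, proj y)`
  have hy_eq : ∀ y : (m ⁻¹' Ioo a b : Set M), (y : M) = R.emb ϑ (⟨m y, y.2⟩, R.proj ϑ y) :=
    fun y => (R.emb_proj ϑ y).symm
  have hm_smooth : ∀ {V'} {g : ℝ → ℝ}, ContDiff ℝ ∞ g → SmoothAlong (𝓡 d) 𝓘(ℝ, ℝ)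
      (Subtype.val : (m ⁻¹' Ioo a b : Set M) → M) (fun y => g (m y)) V' := fun hg =>
    SmoothAlong.of_contMDiff (g := fun y => _) (hg.contMDiff.comp hm.smooth)
  set V₁ : Set (m ⁻¹' Ioo a b : Set M) := Subtype.val ⁻¹' Φ'.source with hV₁
  set V₂ : Set (m ⁻¹' Ioo a b : Set M) := Subtype.val ⁻¹' Φ'.target with hV₂
  have hV₁' : ∀ y ∈ V₁, m y ∈ K ∧ R.proj ϑ y ∈ H.Φ.source := fun y hy => by
    rw [hV₁, mem_preimage, hy_eq, hmem] at hy; exact hy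
  have hV₂' : ∀ y ∈ V₂, m y ∈ K ∧ R.proj ϑ y ∈ H.Φ.target := fun y hy => by
    rw [hV₂, mem_preimage, hy_eq, hmem'] at hy; exact hy
  have hτ₁ : SmoothAlong (𝓡 d) 𝓘(ℝ, ℝ) (Subtype.val : (m ⁻¹' Ioo a b : Set M) → M)
      (fun y => (S ⟨m y, y.2⟩ : ℝ)) V₁ := (hm_smooth hσ).congr fun y hy =>
    involutionHomeo_coe hK hKab hσ.continuous hσσ hσK (t := ⟨m y, y.2⟩) (hV₁' y hy).1
  have hτ₂ : SmoothAlong (𝓡 d) 𝓘(ℝ, ℝ) (Subtype.val : (m ⁻¹' Ioo a b : Set M) → M)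
      (fun y => (S ⟨m y, y.2⟩ : ℝ)) V₂ := (hm_smooth hσ).congr fun y hy =>
    involutionHomeo_coe hK hKab hσ.continuous hσσ hσK (t := ⟨m y, y.2⟩) (hV₂' y hy).1
  have hτ₀ : SmoothAlong (𝓡 d) 𝓘(ℝ, ℝ) (Subtype.val : (m ⁻¹' Ioo a b : Set M) → M)
      (fun y => ((⟨m y, y.2⟩ : Ioo a b) : ℝ)) V₁ := hm_smooth contDiff_id
  have hτc : SmoothAlong (𝓡 d) 𝓘(ℝ, ℝ) (Subtype.val : (m ⁻¹' Ioo a b : Set M) → M)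
      (fun _ => (ϑ : ℝ)) V₁ := SmoothAlong.const _
  have hid : SmoothAlong (𝓡 d) (𝓡 d) (Subtype.val : levelSet m ϑ → M)
      (Subtype.val ∘ (fun x => x)) H.Φ.source := SmoothAlong.self
  have hpr₁ : MapsTo (R.proj ϑ) V₁ H.Φ.source := fun y hy => (hV₁' y hy).2
  have hpr₂ : MapsTo (R.proj ϑ) V₂ H.Φ.target := fun y hy => (hV₂' y hy).2
  -- the coefficient, in the coordinates `(t, x)`
  set κ : Ioo a b × levelSet m ϑ → ℝ := fun q => c q.1 * H.φ q.2 *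
    (R.weight p ϑ (S q.1) (H.Φ q.2) * (R.weight p ϑ q.1 q.2)⁻¹) with hκ
  have hκ_smooth : SmoothAlong (𝓡 d) 𝓘(ℝ, ℝ) (Subtype.val : (m ⁻¹' Ioo a b : Set M) → M)
      (fun y => κ (⟨m y, y.2⟩, R.proj ϑ y)) V₁ := by
    refine ((hm_smooth hc).mul (H.smooth_φ.comp ((R.smooth_F_inv ϑ).mono (subset_univ V₁))
      (mapsTo_univ _ _))).mul (SmoothAlong.mul ?_ ?_)
    · refine SmoothAlong.rpow (SmoothAlong.div (R.smoothAlong_ψ ϑ H.smooth_Φ hτ₁ hpr₁)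
        (R.smoothAlong_ψ ϑ H.smooth_Φ hτc hpr₁) fun _ _ => R.ψ_pos _ _ _)
        (fun _ _ => div_pos (R.ψ_pos _ _ _) (R.ψ_pos _ _ _)) _
    · refine (SmoothAlong.rpow (SmoothAlong.div (R.smoothAlong_ψ ϑ hid hτc hpr₁)
        (R.smoothAlong_ψ ϑ hid hτ₀ hpr₁) fun _ _ => R.ψ_pos _ _ _)
        (fun _ _ => div_pos (R.ψ_pos _ _ _) (R.ψ_pos _ _ _)) (1 / p.toReal)).congr fun y _ => ?_
      exact (R.weight_inv p ϑ _ _).symm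
  set D : Set M := R.emb ϑ '' ((Subtype.val ⁻¹' C) ×ˢ tsupport H.φ) with hD
  have hDc : IsCompact D := by
    refine IsCompact.image (IsCompact.prod ?_ H.compact_φ) (R.continuous_emb ϑ)
    rw [Subtype.isCompact_iff, Subtype.image_preimage_coe, inter_eq_right.2 (hCK.trans hKab)]
    exact hC
  have hDs : D ⊆ Φ'.source := by
    rintro _ ⟨q, hq, rfl⟩
    exact (hmem q).2 ⟨hCK hq.1, H.supp_φ hq.2⟩
  set φ' : M → ℝ := Φ'.source.indicator (fun y => κ (Θ.symm y)) with hφ'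
  have hφ'_emb : ∀ q, R.emb ϑ q ∈ Φ'.source → φ' (R.emb ϑ q) = κ q := fun q hq => by
    rw [hφ', indicator_of_mem hq, hΘinv]
  have hφ'_zero : ∀ y ∉ D, φ' y = 0 := by
    intro y hy
    by_cases hys : y ∈ Φ'.source
    · obtain ⟨q, rfl⟩ := hsource y hys
      rw [hφ'_emb q hys]
      by_cases hq1 : (q.1 : ℝ) ∈ C
      · have hq2 : q.2 ∉ tsupport H.φ := fun h => hy ⟨q, ⟨hq1, h⟩, rfl⟩
        simp only [hκ]
        rw [image_eq_zero_of_notMem_tsupport hq2]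
        ring
      · simp only [hκ]
        rw [hcC _ hq1]
        ring
    · exact indicator_of_notMem hys _
  have hstrip : Φ'.source ⊆ m ⁻¹' Ioo a b := fun y hy => by
    obtain ⟨q, rfl⟩ := hsource y hy; exact R.emb_mem ϑ q
  have hstrip' : Φ'.target ⊆ m ⁻¹' Ioo a b := fun y hy => by
    obtain ⟨q, rfl⟩ := htarget y hy; exact R.emb_mem ϑ q
  have hφ'_smooth : SmoothAlong (𝓡 d) 𝓘(ℝ, ℝ) (id : M → M) φ' univ := by
    intro y _
    by_cases hy : y ∈ Φ'.source
    · have h1 : SmoothAlong (𝓡 d) 𝓘(ℝ, ℝ) (id : M → M) φ' Φ'.source :=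
        SmoothAlong.of_subtype hstrip (hκ_smooth.congr fun z hz => by
          have h2 := hφ'_emb (⟨m z, z.2⟩, R.proj ϑ z) (by rw [← hy_eq]; exact hz)
          rw [← hy_eq] at h2
          exact h2)
      obtain ⟨W, hW, hyW, g, hg, hgφ⟩ := h1 y hy
      exact ⟨W ∩ Φ'.source, hW.inter Φ'.open_source, ⟨hyW, hy⟩, g, hg.mono inter_subset_left,
        fun z _ hz => hgφ z hz.2 hz.1⟩
    · exact ⟨Dᶜ, hDc.isClosed.isOpen_compl, fun h => hy (hDs h), fun _ => 0, contMDiffOn_const,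
        fun z _ hz => (hφ'_zero z hz).symm⟩
  have htsupp : tsupport φ' ⊆ D :=
    closure_minimal (fun y hy => by_contra fun h => hy (hφ'_zero y h)) hDc.isClosed
  refine ⟨{ φ := φ'
            Φ := Φ'
            smooth_φ := hφ'_smooth
            compact_φ := hDc.of_isClosed_subset (isClosed_tsupport _) htsupp
            supp_φ := htsupp.trans hDs
            smooth_Φ := SmoothAlong.of_subtype hstrip
              ((R.smoothAlong_emb ϑ H.smooth_Φ hτ₁ hpr₁).congr fun y _ =>
                (congrArg Φ' (hy_eq y)).trans (happly _))
            smooth_Φ_symm := SmoothAlong.of_subtype hstrip'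
              ((R.smoothAlong_emb ϑ H.smooth_Φ_symm hτ₂ hpr₂).congr fun y _ =>
                (congrArg Φ'.symm (hy_eq y)).trans (happly' _)) }, ?_, ?_, ?_, ?_⟩
  · intro y hy
    obtain ⟨q, rfl⟩ := hsource y hy
    exact ⟨q, ((hmem q).1 hy).1, ((hmem q).1 hy).2, rfl⟩
  · intro y hy
    obtain ⟨q, rfl⟩ := htarget y hy
    exact ⟨q, ((hmem' q).1 hy).1, ((hmem' q).1 hy).2, rfl⟩
  · exact fun f y hy => SimpleHData.op_apply_of_notMem _ f fun h => hy (hstrip h)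
  · intro f t
    funext x
    rw [slice_of_mem, Pi.smul_apply, smul_eq_mul]
    by_cases htx : (t : ℝ) ∈ K ∧ x ∈ H.Φ.source
    · have hs := (hmem (t, x)).2 htx
      have hSt : (S t : ℝ) = σ t :=
        involutionHomeo_coe hK hKab hσ.continuous hσσ hσK (t := t) htx.1
      have h1 : R.slice p ϑ (σ t) f (H.Φ x) =
          f (R.F ϑ (S t) (H.Φ x)) * R.weight p ϑ (S t) (H.Φ x) := by
        rw [← hSt]; exact R.slice_of_mem p ϑ f (S t) (H.Φ x)
      rw [H.op_apply_of_mem _ htx.2, h1, show (R.F ϑ t x : M) = R.emb ϑ (t, x) from rfl,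
        SimpleHData.op_apply_of_mem _ _ hs]
      change φ' (R.emb ϑ (t, x)) * f (Φ' (R.emb ϑ (t, x))) * _ = _
      rw [hφ'_emb _ hs, happly]
      simp only [hκ]
      have hw := (R.weight_pos p ϑ t x).ne'
      field_simp
      rfl
    · rw [show (R.F ϑ t x : M) = R.emb ϑ (t, x) from rfl,
        SimpleHData.op_apply_of_notMem _ _ fun h => htx ((hmem _).1 h), zero_mul]
      rcases not_and_or.1 htx with h | h
      · rw [hcC _ fun h' => h (hCK h'), zero_mul]
      · rw [H.op_apply_of_notMem _ h, mul_zero]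

lemma liftSet_eq (δ : ℝ) (ϑ₁ ϑ₂ : Ioo a b) (U : Set (levelSet m ϑ)) :
    R.liftSet δ ϑ₁ ϑ₂ ϑ U =
      R.emb ϑ '' ((Subtype.val ⁻¹' Ioo ((ϑ₁ : ℝ) - δ) (ϑ₂ + δ)) ×ˢ U) := by
  ext y
  constructor
  · rintro ⟨t, ht, x, hx, rfl⟩
    exact ⟨(t, x), ⟨ht, hx⟩, rfl⟩
  · rintro ⟨⟨t, x⟩, ⟨ht, hx⟩, rfl⟩
    exact ⟨t, ht, x, hx, rfl⟩

lemma isOpen_liftSet (hmc : Continuous m) (δ : ℝ) (ϑ₁ ϑ₂ : Ioo a b) {U : Set (levelSet m ϑ)}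
    (hU : IsOpen U) : IsOpen (R.liftSet δ ϑ₁ ϑ₂ ϑ U) := by
  rw [liftSet_eq]
  exact (R.isOpenEmbedding_emb hmc ϑ).isOpenMap _
    ((isOpen_Ioo.preimage continuous_subtype_val).prod hU)

variable [T2Space M] [SecondCountableTopology M] [BorelSpace M]
  [IsManifold (𝓡 d) ∞ M] [IsContMDiffRiemannianBundle (𝓡 d) ∞ (EuclideanSpace ℝ (Fin d))
      (fun x : M => TangentSpace (𝓡 d) x)]
  {δ : ℝ} {s : ℝ → ℝ} {ϑ₁ ϑ₂ : Ioo a b}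

/-- The lift of a simple `H`-operator is the sum of three simple `H`-operators, one for each of the
three terms of the latitudinal projection. -/
lemma liftedOp_mem_HOperatorsOn (hm : IsProperMorse d m) (hs : IsAWWCutoff δ s) (hδ : 0 < δ)
    (ha : a ≤ ϑ₁ - δ) (hb : ϑ₂ + δ ≤ b) (h₁₂ : (ϑ₁ : ℝ) + δ < ϑ₂ - δ) {U : Set (levelSet m ϑ)}
    {P : Module.End ℝ (levelSet m ϑ → ℝ)}
    (hP : P ∈ HOperatorsOn d (Subtype.val : levelSet m ϑ → M) U) :
    R.liftedOp p s δ ϑ₁ ϑ₂ ϑ P ∈ HOperatorsOn d (id : M → M) (R.liftSet δ ϑ₁ ϑ₂ ϑ U) := by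
  induction hP using Submodule.span_induction with
  | zero => rw [liftedOp_zero]; exact Submodule.zero_mem _
  | add P P' _ _ h h' => rw [liftedOp_add]; exact Submodule.add_mem _ h h'
  | smul c P _ h => rw [liftedOp_smul]; exact Submodule.smul_mem _ c h
  | mem T hT =>
    obtain ⟨H, hHs, hHt, rfl⟩ := hT
    rcases isEmpty_or_nonempty (levelSet m ϑ) with hE | hne
    · have : H.op = 0 := LinearMap.ext fun f => Subsingleton.elim _ _
      rw [this, liftedOp_zero]
      exact Submodule.zero_mem _
    obtain ⟨δ', hδ'0, hδ'δ, hs'⟩ := hs.exists_lt hδ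
    have hc₁ : ∀ θ : ℝ, ContDiff ℝ ∞ fun t => s (t - θ) := fun θ =>
      hs.smooth.comp (contDiff_id.sub contDiff_const)
    have hc₂ : ∀ θ : ℝ, ContDiff ℝ ∞ fun t => s (θ - t) := fun θ =>
      hs.smooth.comp (contDiff_const.sub contDiff_id)
    have hcross : ∀ θ : Ioo a b, a ≤ θ - δ → (θ : ℝ) + δ ≤ b → _ := fun θ h1 h2 =>
      R.exists_simpleHData_lift p ϑ hm H (σ := fun t => 2 * θ - t) (c := awwCross s θ)
        (K := Ioo ((θ : ℝ) - δ) (θ + δ)) (C := Icc ((θ : ℝ) - δ') (θ + δ')) isOpen_Ioo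
        (Ioo_subset_Ioo h1 h2) (contDiff_const.sub contDiff_id) (fun t => by ring)
        (fun t ht => reflect_mem_Ioo ht) ((hc₁ θ).mul (hc₂ θ)) isCompact_Icc
        (Icc_subset_Ioo (by linarith) (by linarith))
        (fun t ht => awwCross_eq_zero hs' fun h => ht (Ioo_subset_Icc_self h))
    obtain ⟨H₀, h₀s, h₀t, h₀z, h₀⟩ := R.exists_simpleHData_lift p ϑ hm H (σ := fun t => t)
      (c := awwDiag s ϑ₁ ϑ₂) (K := Ioo ((ϑ₁ : ℝ) - δ) (ϑ₂ + δ))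
      (C := Icc ((ϑ₁ : ℝ) - δ') (ϑ₂ + δ')) isOpen_Ioo (Ioo_subset_Ioo ha hb) contDiff_id
      (fun _ => rfl) (fun _ ht => ht) (((hc₁ ϑ₁).pow 2).sub ((hc₁ ϑ₂).pow 2)) isCompact_Icc
      (Icc_subset_Ioo (by linarith) (by linarith))
      (fun t ht => awwDiag_eq_zero hs' (by linarith) hδ'0 fun h => ht (Ioo_subset_Icc_self h))
    obtain ⟨H₁, h₁s, h₁t, h₁z, h₁⟩ := hcross ϑ₁ ha (by linarith)
    obtain ⟨H₂, h₂s, h₂t, h₂z, h₂⟩ := hcross ϑ₂ (by linarith) hb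
    have heq : R.liftedOp p s δ ϑ₁ ϑ₂ ϑ H.op = H₀.op + H₁.op - H₂.op := by
      refine R.End_ext_of_slice (p := p) (ϑ := ϑ) (fun f y hy => ?_) fun f t => ?_
      · rw [liftedOp_of_notMem _ _ _ _ _ hy]
        simp only [LinearMap.sub_apply, LinearMap.add_apply, Pi.sub_apply, Pi.add_apply,
          h₀z f y hy, h₁z f y hy, h₂z f y hy]
        ring
      · rw [slice_liftedOp, R.slice_latitudinal p ϑ hm hs hδ ha hb h₁₂]
        simp only [LinearMap.sub_apply, LinearMap.add_apply, map_sub, map_add, map_smul, h₀, h₁,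
          h₂]
    have hsub : ∀ {K : Set ℝ} {V : Set (levelSet m ϑ)} {A : Set M},
        K ⊆ Ioo ((ϑ₁ : ℝ) - δ) (ϑ₂ + δ) → V ⊆ U →
        (∀ y ∈ A, ∃ q : Ioo a b × levelSet m ϑ, (q.1 : ℝ) ∈ K ∧ q.2 ∈ V ∧ R.emb ϑ q = y) →
        A ⊆ R.liftSet δ ϑ₁ ϑ₂ ϑ U := by
      intro K V A hKs hVU hA y hy
      obtain ⟨q, hq1, hq2, rfl⟩ := hA y hy
      exact ⟨q.1, hKs hq1, q.2, hVU hq2, rfl⟩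
    have hK₁ : Ioo ((ϑ₁ : ℝ) - δ) (ϑ₁ + δ) ⊆ Ioo ((ϑ₁ : ℝ) - δ) (ϑ₂ + δ) :=
      Ioo_subset_Ioo le_rfl (by linarith)
    have hK₂ : Ioo ((ϑ₂ : ℝ) - δ) (ϑ₂ + δ) ⊆ Ioo ((ϑ₁ : ℝ) - δ) (ϑ₂ + δ) :=
      Ioo_subset_Ioo (by linarith) le_rfl
    rw [heq]
    exact Submodule.sub_mem _ (Submodule.add_mem _
      (Submodule.subset_span ⟨H₀, hsub subset_rfl hHs h₀s, hsub subset_rfl hHt h₀t, rfl⟩)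
      (Submodule.subset_span ⟨H₁, hsub hK₁ hHs h₁s, hsub hK₁ hHt h₁t, rfl⟩))
      (Submodule.subset_span ⟨H₂, hsub hK₂ hHs h₂s, hsub hK₂ hHt h₂t, rfl⟩)

end Lift

end StripParam

/-! ### The constant `B_p` and the norm of the projection on the line -/

section Const

variable (p : ℝ≥0∞) [Fact (1 ≤ p)]

/-- The matrix `A_ξ`, as an operator on the two-dimensional `ℓᵖ`. -/
noncomputable def awwMatrixOp (ξ : ℝ) :
    PiLp p (fun _ : Fin 2 => ℝ) →L[ℝ] PiLp p (fun _ : Fin 2 => ℝ) :=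
  LinearMap.toContinuousLinearMap (Matrix.toLpLin p p
    !![ξ, √(ξ * (1 - ξ)); √(ξ * (1 - ξ)), 1 - ξ])

lemma awwMatrixOp_apply_zero (ξ : ℝ) (v : PiLp p (fun _ : Fin 2 => ℝ)) :
    awwMatrixOp p ξ v 0 = ξ * v 0 + √(ξ * (1 - ξ)) * v 1 := by
  simp [awwMatrixOp, Matrix.mulVec, dotProduct, Fin.sum_univ_two]

lemma awwMatrixOp_apply_one (ξ : ℝ) (v : PiLp p (fun _ : Fin 2 => ℝ)) :
    awwMatrixOp p ξ v 1 = √(ξ * (1 - ξ)) * v 0 + (1 - ξ) * v 1 := by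
  simp [awwMatrixOp, Matrix.mulVec, dotProduct, Fin.sum_univ_two]

lemma awwConst_eq : awwConst p = ⨆ ξ : Icc (0 : ℝ) 1, ‖awwMatrixOp p ξ‖ := rfl

lemma continuous_awwMatrixOp : Continuous (awwMatrixOp p) := by
  have h : Continuous fun A : Matrix (Fin 2) (Fin 2) ℝ =>
      LinearMap.toContinuousLinearMap (Matrix.toLpLin p p A) :=
    LinearMap.continuous_of_finiteDimensional
      ((LinearMap.toContinuousLinearMap (𝕜 := ℝ) (E := PiLp p (fun _ : Fin 2 => ℝ))
        (F' := PiLp p (fun _ : Fin 2 => ℝ))).toLinearMap ∘ₗ (Matrix.toLpLin p p).toLinearMap)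
  refine h.comp (continuous_matrix fun i j => ?_)
  fin_cases i <;> fin_cases j <;> simp <;> fun_prop

lemma norm_awwMatrixOp_le {ξ : ℝ} (hξ : ξ ∈ Icc (0 : ℝ) 1) : ‖awwMatrixOp p ξ‖ ≤ awwConst p := by
  have hb : BddAbove (range fun ξ : Icc (0 : ℝ) 1 => ‖awwMatrixOp p ξ‖) :=
    (isCompact_range ((continuous_awwMatrixOp p).comp continuous_subtype_val).norm).bddAbove
  exact le_ciSup hb ⟨ξ, hξ⟩

lemma one_le_awwConst : 1 ≤ awwConst p := by
  refine le_trans ?_ (norm_awwMatrixOp_le p (ξ := 1) ⟨zero_le_one, le_rfl⟩)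
  have hfix : awwMatrixOp p 1 (WithLp.toLp p ![1, 0]) = WithLp.toLp p ![1, 0] := by
    ext i
    fin_cases i
    · refine (awwMatrixOp_apply_zero p _ _).trans ?_
      simp
    · refine (awwMatrixOp_apply_one p _ _).trans ?_
      simp
  have hne : (WithLp.toLp p ![1, 0] : PiLp p (fun _ : Fin 2 => ℝ)) ≠ 0 := by
    intro h
    have := congrArg (fun v : PiLp p (fun _ : Fin 2 => ℝ) => v 0) h
    simp at this
  have h := (awwMatrixOp p 1).le_opNorm (WithLp.toLp p ![1, 0])
  rw [hfix] at h
  exact le_of_mul_le_mul_right (by rwa [one_mul]) (norm_pos_iff.2 hne)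

/-- For `p = 2` the matrices are orthogonal projections. -/
lemma awwConst_two_le : awwConst 2 ≤ 1 := by
  rw [awwConst_eq]
  refine ciSup_le fun ξ => ContinuousLinearMap.opNorm_le_bound _ zero_le_one fun v => ?_
  rw [one_mul, EuclideanSpace.norm_eq, EuclideanSpace.norm_eq]
  refine Real.sqrt_le_sqrt ?_
  rw [Fin.sum_univ_two, Fin.sum_univ_two, awwMatrixOp_apply_zero, awwMatrixOp_apply_one]
  simp only [Real.norm_eq_abs, sq_abs]
  have h := Real.sq_sqrt (mul_nonneg ξ.2.1 (sub_nonneg.2 ξ.2.2))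
  set r := √((ξ : ℝ) * (1 - ξ))
  have h1 : 0 ≤ ((1 - (ξ : ℝ)) * v 0 - r * v 1) ^ 2 + (r * v 0 - ξ * v 1) ^ 2 := by positivity
  have h2 : (v 0) ^ 2 + (v 1) ^ 2 - ((ξ * v 0 + r * v 1) ^ 2 + (r * v 0 + (1 - (ξ : ℝ)) * v 1) ^ 2)
      = ((1 - (ξ : ℝ)) * v 0 - r * v 1) ^ 2 + (r * v 0 - ξ * v 1) ^ 2 := by
    linear_combination (-2 * (v 0) ^ 2 - 2 * (v 1) ^ 2) * h
  linarith

variable {p}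

lemma toReal_pos_of_ne_top (hp : p ≠ ⊤) : 0 < p.toReal :=
  ENNReal.toReal_pos (zero_lt_one.trans_le Fact.out).ne' hp

/-- The norm bound for `A_ξ` with `ξ = α²`, in coordinates. -/
lemma awwMatrix_enorm_le (hp : p ≠ ⊤) {α β : ℝ} (hα : 0 ≤ α) (hβ : 0 ≤ β) (h : α ^ 2 + β ^ 2 = 1)
    (u v : ℝ) :
    ‖α ^ 2 * u + α * β * v‖ₑ ^ p.toReal + ‖β ^ 2 * v + β * α * u‖ₑ ^ p.toReal ≤
      ENNReal.ofReal (awwConst p) ^ p.toReal * (‖u‖ₑ ^ p.toReal + ‖v‖ₑ ^ p.toReal) := by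
  have hp0 := toReal_pos_of_ne_top hp
  have hB := zero_le_one.trans (one_le_awwConst p)
  have hsum : ∀ x y : ℝ, ‖x‖ₑ ^ p.toReal + ‖y‖ₑ ^ p.toReal =
      ENNReal.ofReal (‖(WithLp.toLp p ![x, y] : PiLp p (fun _ : Fin 2 => ℝ))‖ ^ p.toReal) := by
    intro x y
    rw [PiLp.norm_eq_sum hp0, Fin.sum_univ_two, ← Real.rpow_mul (by positivity),
      one_div_mul_cancel hp0.ne', Real.rpow_one, ENNReal.ofReal_add (by positivity) (by positivity),
      ← ENNReal.ofReal_rpow_of_nonneg (norm_nonneg _) hp0.le,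
      ← ENNReal.ofReal_rpow_of_nonneg (norm_nonneg _) hp0.le, ofReal_norm, ofReal_norm]
    rfl
  have hsq : √(α ^ 2 * (1 - α ^ 2)) = α * β := by
    rw [show α ^ 2 * (1 - α ^ 2) = (α * β) ^ 2 by rw [← h]; ring]
    exact Real.sqrt_sq (mul_nonneg hα hβ)
  have hA : awwMatrixOp p (α ^ 2) (WithLp.toLp p ![u, v]) =
      WithLp.toLp p ![α ^ 2 * u + α * β * v, β ^ 2 * v + β * α * u] := by
    ext i
    fin_cases i
    · refine (awwMatrixOp_apply_zero p _ _).trans ?_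
      rw [hsq]
      simp
    · refine (awwMatrixOp_apply_one p _ _).trans ?_
      rw [hsq, show 1 - α ^ 2 = β ^ 2 by linarith]
      simp
      ring
  rw [hsum, hsum, ← hA, ENNReal.ofReal_rpow_of_nonneg hB hp0.le,
    ← ENNReal.ofReal_mul (by positivity), ← Real.mul_rpow hB (norm_nonneg _)]
  refine ENNReal.ofReal_le_ofReal (Real.rpow_le_rpow (norm_nonneg _) ?_ hp0.le)
  refine ((awwMatrixOp p (α ^ 2)).le_opNorm _).trans ?_
  gcongr
  exact norm_awwMatrixOp_le p ⟨by positivity, by nlinarith⟩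

end Const

section LineNorm

lemma measurePreserving_reflect (θ : ℝ) :
    MeasurePreserving (fun t : ℝ => 2 * θ - t) volume volume :=
  Measure.measurePreserving_sub_left volume (2 * θ)

/-- A pointwise inequality between sums over the orbits of a reflection gives the inequality of
integrals over a symmetric interval. -/
lemma setLIntegral_le_of_reflect {θ δ : ℝ} {φ g : ℝ → ℝ≥0∞} (hφ : Measurable φ) (hg : Measurable g)
    {K : ℝ≥0∞}
    (h : ∀ t ∈ Ioo (θ - δ) (θ + δ), φ t + φ (2 * θ - t) ≤ K * (g t + g (2 * θ - t))) :
    ∫⁻ t in Ioo (θ - δ) (θ + δ), φ t ≤ K * ∫⁻ t in Ioo (θ - δ) (θ + δ), g t := by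
  have hr := (measurePreserving_reflect θ).measurable
  have hpre : (fun t : ℝ => 2 * θ - t) ⁻¹' Ioo (θ - δ) (θ + δ) = Ioo (θ - δ) (θ + δ) := by
    rw [preimage_const_sub_Ioo]
    congr 1 <;> ring
  have key : ∀ f : ℝ → ℝ≥0∞, Measurable f →
      ∫⁻ t in Ioo (θ - δ) (θ + δ), (f t + f (2 * θ - t)) =
        2 * ∫⁻ t in Ioo (θ - δ) (θ + δ), f t := by
    intro f hf
    have h1 := (measurePreserving_reflect θ).setLIntegral_comp_preimage
      (measurableSet_Ioo (a := θ - δ) (b := θ + δ)) hf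
    rw [hpre] at h1
    rw [lintegral_add_left hf, h1, two_mul]
  have h2 : 2 * ∫⁻ t in Ioo (θ - δ) (θ + δ), φ t ≤
      2 * (K * ∫⁻ t in Ioo (θ - δ) (θ + δ), g t) := by
    have h3 : ∫⁻ t in Ioo (θ - δ) (θ + δ), K * (g t + g (2 * θ - t)) =
        K * ∫⁻ t in Ioo (θ - δ) (θ + δ), (g t + g (2 * θ - t)) :=
      lintegral_const_mul K (hg.add (hg.comp hr))
    rw [← key φ hφ, mul_left_comm, ← key g hg, ← h3]
    exact setLIntegral_mono' measurableSet_Ioo h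
  exact (ENNReal.mul_le_mul_iff_right two_ne_zero ENNReal.ofNat_ne_top).1 h2

variable {δ : ℝ} {s : ℝ → ℝ} {θ₁ θ₂ : ℝ}

lemma measurable_awwLine (hs : IsAWWCutoff δ s) {G : ℝ → ℝ} (hG : Measurable G) :
    Measurable (awwLine s θ₁ θ₂ G) := by
  have h := hs.smooth.continuous.measurable
  unfold awwLine awwDiag awwCross
  fun_prop

/-- The projection on the line has norm at most `B_p` on `Lᵖ(ℝ)`. -/
lemma lintegral_awwLine_le {p : ℝ≥0∞} [Fact (1 ≤ p)] (hp : p ≠ ⊤) (hs : IsAWWCutoff δ s)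
    (hδ : 0 < δ) (h₁₂ : θ₁ + δ < θ₂ - δ) {G : ℝ → ℝ} (hG : Measurable G) :
    ∫⁻ t, ‖awwLine s θ₁ θ₂ G t‖ₑ ^ p.toReal ≤
      ENNReal.ofReal (awwConst p) ^ p.toReal * ∫⁻ t, ‖G t‖ₑ ^ p.toReal := by
  have hp0 := toReal_pos_of_ne_top hp
  set K := ENNReal.ofReal (awwConst p) ^ p.toReal with hK
  have hK1 : 1 ≤ K := ENNReal.one_le_rpow (ENNReal.one_le_ofReal.2 (one_le_awwConst p)) hp0
  have hφ : Measurable fun t => ‖awwLine s θ₁ θ₂ G t‖ₑ ^ p.toReal :=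
    (measurable_awwLine hs hG).enorm.pow_const _
  have hg : Measurable fun t => ‖G t‖ₑ ^ p.toReal := hG.enorm.pow_const _
  have hsub : Ioo (θ₂ - δ) (θ₂ + δ) ⊆ (Ioo (θ₁ - δ) (θ₁ + δ))ᶜ :=
    fun t ht ht' => by linarith [ht.1, ht'.2]
  have hsplit : ∀ f : ℝ → ℝ≥0∞, ∫⁻ t, f t = (∫⁻ t in Ioo (θ₁ - δ) (θ₁ + δ), f t) +
      ((∫⁻ t in Ioo (θ₂ - δ) (θ₂ + δ), f t) +
        ∫⁻ t in (Ioo (θ₁ - δ) (θ₁ + δ))ᶜ \ Ioo (θ₂ - δ) (θ₂ + δ), f t) := by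
    intro f
    rw [← lintegral_add_compl f (measurableSet_Ioo (a := θ₁ - δ) (b := θ₁ + δ)),
      ← lintegral_inter_add_sdiff f (Ioo (θ₁ - δ) (θ₁ + δ))ᶜ
        (measurableSet_Ioo (a := θ₂ - δ) (b := θ₂ + δ)), inter_eq_self_of_subset_right hsub]
  rw [hsplit, hsplit fun t => ‖G t‖ₑ ^ p.toReal, mul_add, mul_add]
  refine add_le_add (setLIntegral_le_of_reflect hφ hg fun t ht => ?_)
    (add_le_add (setLIntegral_le_of_reflect hφ hg fun t ht => ?_) ?_)
  · have h1 := hs.sq_add_sq (t - θ₁)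
    rw [neg_sub] at h1
    rw [awwLine_of_mem_left hs h₁₂ _ ht, awwLine_of_mem_left hs h₁₂ _ (reflect_mem_Ioo ht),
      show 2 * θ₁ - (2 * θ₁ - t) = t by ring, show 2 * θ₁ - t - θ₁ = θ₁ - t by ring,
      show θ₁ - (2 * θ₁ - t) = t - θ₁ by ring]
    exact awwMatrix_enorm_le hp (hs.mem_Icc _).1 (hs.mem_Icc _).1 h1 _ _
  · have h1 := hs.sq_add_sq (θ₂ - t)
    rw [neg_sub] at h1
    rw [awwLine_of_mem_right hs h₁₂ _ ht, awwLine_of_mem_right hs h₁₂ _ (reflect_mem_Ioo ht),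
      show 2 * θ₂ - (2 * θ₂ - t) = t by ring, show 2 * θ₂ - t - θ₂ = θ₂ - t by ring,
      show θ₂ - (2 * θ₂ - t) = t - θ₂ by ring]
    -- the reflected terms enter with a minus sign, which changing the sign of one value removes
    have h2 := awwMatrix_enorm_le hp (hs.mem_Icc (θ₂ - t)).1 (hs.mem_Icc (t - θ₂)).1 h1
      (G t) (-G (2 * θ₂ - t))
    rw [enorm_neg] at h2
    refine le_trans (le_of_eq ?_) h2
    congr 2
    · congr 1; ring
    · rw [← enorm_neg]; congr 1; ring
  · have hmeas : MeasurableSet ((Ioo (θ₁ - δ) (θ₁ + δ))ᶜ \ Ioo (θ₂ - δ) (θ₂ + δ)) :=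
      measurableSet_Ioo.compl.diff measurableSet_Ioo
    refine (setLIntegral_mono' hmeas fun t ht => ?_).trans (le_mul_of_one_le_left' hK1)
    rw [awwLine_of_notMem hs _ ht.1 ht.2]
    rcases awwDiag_eq_zero_or_one hs h₁₂ hδ ht.1 ht.2 with h0 | h0 <;> rw [h0]
    · simp [hp0]
    · rw [one_mul]

end LineNorm

/-! ### The `Lᵖ` norm in terms of slices -/

namespace StripParam

section SliceNorm

variable {d : ℕ} {M : Type*} [TopologicalSpace M] [ChartedSpace (EuclideanSpace ℝ (Fin d)) M]
  [RiemannianBundle (fun x : M => TangentSpace (𝓡 d) x)] [MeasurableSpace M]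
  {m : M → ℝ} {a b : ℝ} (R : StripParam d m a b) (p : ℝ≥0∞) (ϑ : Ioo a b)

lemma continuous_ψ_self : Continuous (R.ψ ϑ ϑ) :=
  (R.continuous_ψ ϑ).comp (continuous_const.prodMk continuous_id)

lemma continuous_weight : Continuous fun q : Ioo a b × levelSet m ϑ => R.weight p ϑ q.1 q.2 := by
  have h := R.continuous_ψ ϑ
  have h' : Continuous fun q : Ioo a b × levelSet m ϑ => R.ψ ϑ ϑ q.2 :=
    h.comp (continuous_const.prodMk continuous_snd)
  exact (h.div h' fun q => (R.ψ_pos _ _ _).ne').rpow_const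
    fun q => Or.inl (div_pos (R.ψ_pos _ _ _) (R.ψ_pos _ _ _)).ne'

lemma continuous_slice {f : M → ℝ} (hf : Continuous f) (t : ℝ) :
    Continuous (R.slice p ϑ t f) := by
  by_cases ht : t ∈ Ioo a b
  · have h1 : Continuous fun x : levelSet m ϑ => ((⟨t, ht⟩, x) : Ioo a b × levelSet m ϑ) := by
      fun_prop
    refine (((hf.comp (R.continuous_emb ϑ)).mul (R.continuous_weight p ϑ)).comp h1).congr
      fun x => (R.slice_of_mem p ϑ f ⟨t, ht⟩ x).symm
  · rw [slice_of_notMem _ _ _ _ ht]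
    exact continuous_const

variable [SecondCountableTopology M] [BorelSpace M]

lemma measurable_slice {f : M → ℝ} (hf : Measurable f) :
    Measurable fun q : Ioo a b × levelSet m ϑ => R.slice p ϑ q.1 f q.2 := by
  have h : Measurable fun q : Ioo a b × levelSet m ϑ => f (R.emb ϑ q) * R.weight p ϑ q.1 q.2 :=
    (hf.comp (R.continuous_emb ϑ).measurable).mul (R.continuous_weight p ϑ).measurable
  convert h using 2 with q
  exact R.slice_of_mem p ϑ f q.1 q.2

open Classical in
lemma measurable_slice_left {f : M → ℝ} (hf : Measurable f) (x : levelSet m ϑ) :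
    Measurable fun t => R.slice p ϑ t f x := by
  have h1 : Measurable fun t : Ioo a b => R.slice p ϑ t f x :=
    (R.measurable_slice p ϑ hf).comp measurable_prodMk_right
  have h2 := h1.dite (measurable_const : Measurable fun _ : ((Ioo a b)ᶜ : Set ℝ) => (0 : ℝ))
    measurableSet_Ioo
  refine (congrArg Measurable (funext fun t => ?_)).mp h2
  split_ifs with h
  · rfl
  · rw [slice_of_notMem _ _ _ _ h]
    rfl

variable [IsManifold (𝓡 d) ∞ M] [IsContMDiffRiemannianBundle (𝓡 d) ∞ (EuclideanSpace ℝ (Fin d))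
      (fun x : M => TangentSpace (𝓡 d) x)]

lemma isFiniteMeasure_weightedMeasure (hm : IsProperMorse d m) :
    IsFiniteMeasure (R.weightedMeasure ϑ) := by
  have := R.isFiniteMeasure_levelMeasure hm ϑ
  have := hm.compactSpace_levelSet ϑ
  obtain ⟨c, hc⟩ := (isCompact_range (R.continuous_ψ_self ϑ)).bddAbove
  refine isFiniteMeasure_withDensity (ne_of_lt ?_)
  calc ∫⁻ x, ENNReal.ofReal (R.ψ ϑ ϑ x) ∂levelMeasure d m ϑ
      ≤ ∫⁻ _, ENNReal.ofReal c ∂levelMeasure d m ϑ :=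
        lintegral_mono fun x => ENNReal.ofReal_le_ofReal (hc (mem_range_self x))
    _ < ⊤ := by
        rw [lintegral_const]
        exact ENNReal.mul_lt_top ENNReal.ofReal_lt_top (measure_lt_top _ _)

lemma isOpenPosMeasure_weightedMeasure (hm : IsProperMorse d m) :
    (R.weightedMeasure ϑ).IsOpenPosMeasure := by
  have := R.isOpenPosMeasure_levelMeasure hm ϑ
  refine Measure.AbsolutelyContinuous.isOpenPosMeasure (μ := levelMeasure d m ϑ) ?_
  exact withDensity_absolutelyContinuous'
    (R.continuous_ψ_self ϑ).measurable.ennreal_ofReal.aemeasurable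
    (Filter.Eventually.of_forall fun x => (ENNReal.ofReal_pos.2 (R.ψ_pos _ _ _)).ne')

/-- The weights of the slices turn the Riemannian measure of the strip into a product measure. -/
lemma setLIntegral_enorm_rpow [Fact (1 ≤ p)] (hp : p ≠ ⊤) (hm : IsProperMorse d m) {f : M → ℝ}
    (hf : Measurable f) :
    ∫⁻ y in m ⁻¹' Ioo a b, ‖f y‖ₑ ^ p.toReal ∂riemannianMeasure d M =
      ∫⁻ q, ‖R.slice p ϑ q.1 f q.2‖ₑ ^ p.toReal ∂(ioVolume a b).prod (R.weightedMeasure ϑ) := by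
  have := R.isFiniteMeasure_levelMeasure hm ϑ
  have hp0 := toReal_pos_of_ne_top hp
  have hψ := (R.continuous_ψ ϑ).measurable.ennreal_ofReal
  have hψ' := (R.continuous_ψ_self ϑ).measurable.ennreal_ofReal
  rw [← R.map_productMeasure ϑ,
    (R.measurableEmbedding_emb hm.smooth.continuous ϑ).lintegral_map, productMeasure,
    lintegral_withDensity_eq_lintegral_mul _ hψ
      (show Measurable fun q => ‖f (R.emb ϑ q)‖ₑ ^ p.toReal from
        (hf.comp (R.continuous_emb ϑ).measurable).enorm.pow_const _),
    weightedMeasure, prod_withDensity_right hψ', lintegral_withDensity_eq_lintegral_mul _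
      (show Measurable fun q : Ioo a b × levelSet m ϑ => ENNReal.ofReal (R.ψ ϑ ϑ q.2) from
        hψ'.comp measurable_snd) ((R.measurable_slice p ϑ hf).enorm.pow_const _)]
  refine lintegral_congr fun q => ?_
  have h1 := R.ψ_pos ϑ q.1 q.2
  have h2 := R.ψ_pos ϑ ϑ q.2
  have hw : ‖R.weight p ϑ q.1 q.2‖ₑ ^ p.toReal = ENNReal.ofReal (R.ψ ϑ q.1 q.2 / R.ψ ϑ ϑ q.2) := by
    rw [Real.enorm_of_nonneg (R.weight_pos p ϑ _ _).le,
      ENNReal.ofReal_rpow_of_nonneg (R.weight_pos p ϑ _ _).le hp0.le, weight,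
      ← Real.rpow_mul (div_pos h1 h2).le, one_div_mul_cancel hp0.ne', Real.rpow_one]
  simp only [Pi.mul_apply]
  rw [slice_of_mem, enorm_mul, ENNReal.mul_rpow_of_nonneg _ _ hp0.le, hw, mul_left_comm,
    ← ENNReal.ofReal_mul h2.le, mul_div_cancel₀ _ h2.ne', mul_comm]
  rfl

/-- The norm of a function which vanishes outside the strip, integrated over the level first. -/
lemma lintegral_enorm_rpow_eq [Fact (1 ≤ p)] (hp : p ≠ ⊤) (hm : IsProperMorse d m) {f : M → ℝ}
    (hf : Measurable f) (h0 : ∀ y, m y ∉ Ioo a b → f y = 0) :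
    ∫⁻ y, ‖f y‖ₑ ^ p.toReal ∂riemannianMeasure d M =
      ∫⁻ t, (∫⁻ x, ‖R.slice p ϑ t f x‖ₑ ^ p.toReal ∂(R.weightedMeasure ϑ)) ∂ioVolume a b := by
  have := R.isFiniteMeasure_weightedMeasure ϑ hm
  rw [← lintegral_prod (fun q : Ioo a b × levelSet m ϑ => ‖R.slice p ϑ q.1 f q.2‖ₑ ^ p.toReal)
      ((R.measurable_slice p ϑ hf).enorm.pow_const _).aemeasurable,
    ← R.setLIntegral_enorm_rpow p ϑ hp hm hf, setLIntegral_eq_of_support_subset]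
  intro y hy
  by_contra hy'
  exact hy (by simp [h0 y hy', toReal_pos_of_ne_top hp])

/-- The norm of a function on the strip, integrated along the lines of the parametrization first. -/
lemma setLIntegral_enorm_rpow_symm [Fact (1 ≤ p)] (hp : p ≠ ⊤) (hm : IsProperMorse d m)
    {f : M → ℝ} (hf : Measurable f) :
    ∫⁻ y in m ⁻¹' Ioo a b, ‖f y‖ₑ ^ p.toReal ∂riemannianMeasure d M =
      ∫⁻ x, (∫⁻ t, ‖R.slice p ϑ t f x‖ₑ ^ p.toReal) ∂(R.weightedMeasure ϑ) := by
  have := R.isFiniteMeasure_weightedMeasure ϑ hm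
  rw [R.setLIntegral_enorm_rpow p ϑ hp hm hf,
    lintegral_prod_symm' _ ((R.measurable_slice p ϑ hf).enorm.pow_const _)]
  refine lintegral_congr fun x => ?_
  rw [lintegral_ioVolume fun t => ‖R.slice p ϑ t f x‖ₑ ^ p.toReal,
    setLIntegral_eq_of_support_subset]
  intro t ht
  by_contra ht'
  have h0 : R.slice p ϑ t f x = 0 := congrFun (R.slice_of_notMem p ϑ f ht') x
  exact ht (by simp [h0, toReal_pos_of_ne_top hp])

variable {δ : ℝ} {s : ℝ → ℝ} {ϑ₁ ϑ₂ : Ioo a b}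

/-- The latitudinal projection has norm at most `B_p`. -/
lemma lintegral_latitudinal_le [Fact (1 ≤ p)] (hp : p ≠ ⊤) (hm : IsProperMorse d m)
    (hs : IsAWWCutoff δ s) (hδ : 0 < δ) (ha : a ≤ ϑ₁ - δ) (hb : ϑ₂ + δ ≤ b)
    (h₁₂ : (ϑ₁ : ℝ) + δ < ϑ₂ - δ) {f : M → ℝ} (hf : Measurable f)
    (hQ : Measurable (R.latitudinal p s δ ϑ₁ ϑ₂ f)) :
    ∫⁻ y, ‖R.latitudinal p s δ ϑ₁ ϑ₂ f y‖ₑ ^ p.toReal ∂riemannianMeasure d M ≤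
      ENNReal.ofReal (awwConst p) ^ p.toReal * ∫⁻ y, ‖f y‖ₑ ^ p.toReal ∂riemannianMeasure d M := by
  have hp0 := toReal_pos_of_ne_top hp
  have hK : ENNReal.ofReal (awwConst p) ^ p.toReal ≠ ⊤ :=
    ENNReal.rpow_ne_top_of_nonneg hp0.le ENNReal.ofReal_ne_top
  have hsupp : Function.support (fun y => ‖R.latitudinal p s δ ϑ₁ ϑ₂ f y‖ₑ ^ p.toReal) ⊆
      m ⁻¹' Ioo a b := by
    intro y hy
    by_contra hy'
    refine hy ?_
    have h0 := R.latitudinal_of_notMem p (s := s) hδ h₁₂ f (y := y)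
      fun h => hy' ⟨ha.trans_lt h.1, h.2.trans_le hb⟩
    simp [h0, hp0]
  calc ∫⁻ y, ‖R.latitudinal p s δ ϑ₁ ϑ₂ f y‖ₑ ^ p.toReal ∂riemannianMeasure d M
      = ∫⁻ x, (∫⁻ t, ‖awwLine s ϑ₁ ϑ₂ (fun t => R.slice p ϑ₁ t f x) t‖ₑ ^ p.toReal)
          ∂(R.weightedMeasure ϑ₁) := by
        rw [← setLIntegral_eq_of_support_subset hsupp,
          R.setLIntegral_enorm_rpow_symm p ϑ₁ hp hm hQ]
        simp only [R.slice_latitudinal_apply p ϑ₁ hm hs hδ ha hb h₁₂]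
    _ ≤ ∫⁻ x, ENNReal.ofReal (awwConst p) ^ p.toReal *
          (∫⁻ t, ‖R.slice p ϑ₁ t f x‖ₑ ^ p.toReal) ∂(R.weightedMeasure ϑ₁) :=
        lintegral_mono fun x =>
          lintegral_awwLine_le hp hs hδ h₁₂ (R.measurable_slice_left p ϑ₁ hf x)
    _ = ENNReal.ofReal (awwConst p) ^ p.toReal *
          ∫⁻ y in m ⁻¹' Ioo a b, ‖f y‖ₑ ^ p.toReal ∂riemannianMeasure d M := by
        rw [lintegral_const_mul' _ _ hK, R.setLIntegral_enorm_rpow_symm p ϑ₁ hp hm hf]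
    _ ≤ _ := mul_le_mul' le_rfl (setLIntegral_le_lintegral _ _)

end SliceNorm

end StripParam

/-! ### Idempotent contractions on a Hilbert space -/

section Hilbert

variable {E : Type*} [NormedAddCommGroup E] [InnerProductSpace ℝ E]

/-- An idempotent contraction is symmetric: moving along the kernel from a point of the range does
not decrease the norm, so the kernel is orthogonal to the range. -/
lemma ContinuousLinearMap.isSymmetric_of_comp_self_of_norm_le_one {T : E →L[ℝ] E}
    (h : T ∘L T = T) (h1 : ‖T‖ ≤ 1) : (T : E →ₗ[ℝ] E).IsSymmetric := by
  have hid : IsIdempotentElem (T : E →ₗ[ℝ] E) := by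
    refine LinearMap.ext fun x => ?_
    exact DFunLike.congr_fun h x
  rw [LinearMap.IsIdempotentElem.isSymmetric_iff_isOrtho_range_ker hid,
    Submodule.isOrtho_iff_inner_eq]
  rintro _ ⟨x, rfl⟩ y hy
  have hy : T y = 0 := hy
  have hx : T (T x) = T x := DFunLike.congr_fun h x
  have hq : ∀ c : ℝ, 0 ≤ ‖y‖ ^ 2 * (c * c) + 2 * inner ℝ (T x) y * c + 0 := by
    intro c
    have h2 : ‖T x‖ ≤ ‖T x + c • y‖ := by
      have h3 := T.le_of_opNorm_le h1 (T x + c • y)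
      rwa [map_add, map_smul, hy, smul_zero, add_zero, hx, one_mul] at h3
    have h4 := pow_le_pow_left₀ (norm_nonneg _) h2 2
    rw [norm_add_sq_real, inner_smul_right, norm_smul, mul_pow, Real.norm_eq_abs, sq_abs] at h4
    linarith
  have h5 := discrim_le_zero hq
  rw [discrim, mul_zero, sub_zero] at h5
  have h6 : (2 * inner ℝ (T x) y : ℝ) = 0 := pow_eq_zero_iff two_ne_zero |>.1
    (le_antisymm h5 (sq_nonneg _))
  simpa using h6

lemma ContinuousLinearMap.norm_le_one_of_comp_self_of_isSymmetric {T : E →L[ℝ] E}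
    (h : T ∘L T = T) (hs : (T : E →ₗ[ℝ] E).IsSymmetric) : ‖T‖ ≤ 1 := by
  refine T.opNorm_le_bound zero_le_one fun x => ?_
  rw [one_mul]
  have hx : T (T x) = T x := DFunLike.congr_fun h x
  have h1 : ‖T x‖ ^ 2 = inner ℝ (T x) x := by
    have h2 : inner ℝ (T (T x)) x = inner ℝ (T x) (T x) := hs (T x) x
    rw [← real_inner_self_eq_norm_sq, ← h2, hx]
  have h3 := h1.trans_le (real_inner_le_norm (T x) x)
  rcases (norm_nonneg (T x)).eq_or_lt with h0 | h0
  · rw [← h0]; exact norm_nonneg x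
  · exact le_of_mul_le_mul_left (by rwa [sq] at h3) h0

end Hilbert

lemma isSymmetricLp_iff {X : Type*} [MeasurableSpace X] {μ : Measure X}
    {T : Lp ℝ 2 μ →L[ℝ] Lp ℝ 2 μ} :
    IsSymmetricLp T ↔ (T : Lp ℝ 2 μ →ₗ[ℝ] Lp ℝ 2 μ).IsSymmetric := by
  refine forall₂_congr fun f h => ?_
  simp only [ContinuousLinearMap.coe_coe, L2.inner_def, RCLike.inner_apply, conj_trivial]
  simp only [mul_comm]

/-! ### Comparison of sums of powers of norms -/

section PowerSums

variable {F : Type*} [NormedAddCommGroup F] {ι : Type*} [Fintype ι] {r C : ℝ}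

lemma enorm_rpow_eq_ofReal (hr : 0 < r) (x : F) : ‖x‖ₑ ^ r = ENNReal.ofReal (‖x‖ ^ r) := by
  rw [← ofReal_norm, ENNReal.ofReal_rpow_of_nonneg (norm_nonneg x) hr.le]

lemma sum_enorm_rpow_eq_ofReal (hr : 0 < r) (v : ι → F) :
    ∑ i, ‖v i‖ₑ ^ r = ENNReal.ofReal (∑ i, ‖v i‖ ^ r) := by
  rw [ENNReal.ofReal_sum_of_nonneg fun i _ => by positivity]
  exact Finset.sum_congr rfl fun i _ => enorm_rpow_eq_ofReal hr _

lemma le_rpow_sum_iff (hr : 0 < r) (hC : 0 < C) (w : F) (v : ι → F) :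
    1 / C * ‖w‖ ≤ (∑' i, ‖v i‖ ^ r) ^ (1 / r) ↔
      ‖w‖ₑ ^ r ≤ ENNReal.ofReal C ^ r * ∑ i, ‖v i‖ₑ ^ r := by
  have h0 : 0 ≤ ∑ i, ‖v i‖ ^ r := Finset.sum_nonneg fun i _ => by positivity
  rw [tsum_fintype, one_div r, Real.le_rpow_inv_iff_of_pos (by positivity) h0 hr,
    enorm_rpow_eq_ofReal hr, sum_enorm_rpow_eq_ofReal hr, ENNReal.ofReal_rpow_of_pos hC,
    ← ENNReal.ofReal_mul (by positivity), ENNReal.ofReal_le_ofReal_iff (by positivity),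
    Real.mul_rpow (by positivity) (norm_nonneg _), one_div, Real.inv_rpow hC.le,
    inv_mul_le_iff₀ (by positivity)]

lemma rpow_sum_le_iff (hr : 0 < r) (hC : 0 < C) (w : F) (v : ι → F) :
    (∑' i, ‖v i‖ ^ r) ^ (1 / r) ≤ C * ‖w‖ ↔
      ∑ i, ‖v i‖ₑ ^ r ≤ ENNReal.ofReal C ^ r * ‖w‖ₑ ^ r := by
  have h0 : 0 ≤ ∑ i, ‖v i‖ ^ r := Finset.sum_nonneg fun i _ => by positivity
  rw [tsum_fintype, one_div r, Real.rpow_inv_le_iff_of_pos h0 (by positivity) hr,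
    enorm_rpow_eq_ofReal hr, sum_enorm_rpow_eq_ofReal hr, ENNReal.ofReal_rpow_of_pos hC,
    ← ENNReal.ofReal_mul (by positivity), ENNReal.ofReal_le_ofReal_iff (by positivity),
    Real.mul_rpow hC.le (norm_nonneg _)]

end PowerSums

lemma enorm_toLp_rpow {X : Type*} [MeasurableSpace X] {μ : Measure X} {p : ℝ≥0∞} [Fact (1 ≤ p)]
    (hp : p ≠ ⊤) {f : X → ℝ} (hf : MemLp f p μ) :
    ‖hf.toLp f‖ₑ ^ p.toReal = ∫⁻ x, ‖f x‖ₑ ^ p.toReal ∂μ := by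
  have hp0 := toReal_pos_of_ne_top hp
  rw [Lp.enorm_toLp, eLpNorm_eq_lintegral_rpow_enorm_toReal
    (zero_lt_one.trans_le Fact.out).ne' hp, ← ENNReal.rpow_mul, one_div_mul_cancel hp0.ne',
    ENNReal.rpow_one]

/-! ### `H`-operators on a compact space -/

section CompactSpace

variable {d : ℕ} {M : Type*} [TopologicalSpace M] [ChartedSpace (EuclideanSpace ℝ (Fin d)) M]
  {X : Type*} [TopologicalSpace X] [CompactSpace X] {e : X → M}

lemma id_mem_HOperators : LinearMap.id ∈ HOperators d e :=
  HOperatorsOn_le_HOperators univ id_mem_HOperatorsOn_univ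

variable [MeasurableSpace X] {p : ℝ≥0∞} {μ : Measure X}

lemma Continuous.memLp_of_compactSpace [BorelSpace X] [IsFiniteMeasure μ] {f : X → ℝ}
    (hf : Continuous f) : MemLp f p μ :=
  hf.memLp_of_hasCompactSupport (HasCompactSupport.of_compactSpace f)

variable [Fact (1 ≤ p)] {P P' : Module.End ℝ (X → ℝ)} {T T' : Lp ℝ p μ →L[ℝ] Lp ℝ p μ}

lemma Induces.comp_of_compactSpace (he : Continuous e) (h : Induces P T) (h' : Induces P' T')
    (hP' : P' ∈ HOperators d e) : Induces (P ∘ₗ P') (T ∘L T') :=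
  h.comp h' fun f => ⟨HOperators.continuous_apply he hP' f.continuous,
    HasCompactSupport.of_compactSpace _⟩

variable [BorelSpace X] [IsFiniteMeasure μ]

lemma Induces.lintegral_eq (hp : p ≠ ⊤) (h : Induces P T) {f : X → ℝ} (hf : Continuous f) :
    ∫⁻ x, ‖P f x‖ₑ ^ p.toReal ∂μ = ‖T (hf.memLp_of_compactSpace.toLp f)‖ₑ ^ p.toReal := by
  have h1 := h.apply_eq ((HasCompactSupport.of_compactSpace f).toC0 hf) hf.memLp_of_compactSpace
  have h2 := enorm_toLp_rpow hp (h.memLp ((HasCompactSupport.of_compactSpace f).toC0 hf)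
    hf.memLp_of_compactSpace)
  rw [← h1] at h2
  exact h2.symm

lemma Induces.lintegral_le (hp : p ≠ ⊤) (h : Induces P T) {f : X → ℝ} (hf : Continuous f) :
    ∫⁻ x, ‖P f x‖ₑ ^ p.toReal ∂μ ≤ ‖T‖ₑ ^ p.toReal * ∫⁻ x, ‖f x‖ₑ ^ p.toReal ∂μ := by
  have hp0 := toReal_pos_of_ne_top hp
  rw [h.lintegral_eq hp hf, ← enorm_toLp_rpow hp hf.memLp_of_compactSpace,
    ← ENNReal.mul_rpow_of_nonneg _ _ hp0.le]
  exact ENNReal.rpow_le_rpow (T.le_opENorm _) hp0.le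

/-- An operator composed of `H`-operators is determined by the operator which it induces on
`Lᵖ`. -/
lemma Induces.eq_of_mem_HOperators [T2Space X] [μ.IsOpenPosMeasure] (he : Continuous e)
    (hP : FinitelyDetermined P) (hPc : ∀ f, Continuous f → Continuous (P f))
    (hP' : P' ∈ HOperators d e) (h : Induces P T) (h' : Induces P' T) : P = P' := by
  refine hP.ext_of_continuous (HOperators.finitelyDetermined hP') fun f hf => ?_
  refine (Continuous.ae_eq_iff_eq μ (hPc f hf) (HOperators.continuous_apply he hP' hf)).1 ?_
  have hf' : MemLp f p μ := hf.memLp_of_compactSpace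
  exact (h ((HasCompactSupport.of_compactSpace f).toC0 hf) hf').symm.trans
    (h' ((HasCompactSupport.of_compactSpace f).toC0 hf) hf')

end CompactSpace

/-! ### The lifted operators on `Lᵖ` -/

namespace StripParam

section Lift

variable {d : ℕ} {M : Type*} [TopologicalSpace M] [SecondCountableTopology M]
  [ChartedSpace (EuclideanSpace ℝ (Fin d)) M] [IsManifold (𝓡 d) ∞ M]
  [RiemannianBundle (fun x : M => TangentSpace (𝓡 d) x)]
  [IsContMDiffRiemannianBundle (𝓡 d) ∞ (EuclideanSpace ℝ (Fin d))
    (fun x : M => TangentSpace (𝓡 d) x)]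
  [MeasurableSpace M] [BorelSpace M]
  {m : M → ℝ} {a b : ℝ} (R : StripParam d m a b) {p : ℝ≥0∞} (ϑ : Ioo a b)
  {δ : ℝ} {s : ℝ → ℝ} {ϑ₁ ϑ₂ : Ioo a b}

/-- The norm of `P_{O(U)} f` in terms of the operator on the level and the slices of `Q f`. -/
lemma lintegral_liftedOp [Fact (1 ≤ p)] (hp : p ≠ ⊤) (hm : IsProperMorse d m)
    (P : Module.End ℝ (levelSet m ϑ → ℝ)) {f : M → ℝ}
    (hPf : Measurable (R.liftedOp p s δ ϑ₁ ϑ₂ ϑ P f)) :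
    ∫⁻ y, ‖R.liftedOp p s δ ϑ₁ ϑ₂ ϑ P f y‖ₑ ^ p.toReal ∂riemannianMeasure d M =
      ∫⁻ t, (∫⁻ x, ‖P (R.slice p ϑ t (R.latitudinal p s δ ϑ₁ ϑ₂ f)) x‖ₑ ^ p.toReal
        ∂(R.weightedMeasure ϑ)) ∂ioVolume a b := by
  rw [R.lintegral_enorm_rpow_eq p ϑ hp hm hPf fun y hy => R.liftedOp_of_notMem p ϑ P f hy]
  simp only [slice_liftedOp]

lemma lintegral_latitudinal [Fact (1 ≤ p)] (hp : p ≠ ⊤) (hm : IsProperMorse d m) (hδ : 0 < δ)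
    (ha : a ≤ ϑ₁ - δ) (hb : ϑ₂ + δ ≤ b) (h₁₂ : (ϑ₁ : ℝ) + δ < ϑ₂ - δ) {f : M → ℝ}
    (hQ : Measurable (R.latitudinal p s δ ϑ₁ ϑ₂ f)) :
    ∫⁻ y, ‖R.latitudinal p s δ ϑ₁ ϑ₂ f y‖ₑ ^ p.toReal ∂riemannianMeasure d M =
      ∫⁻ t, (∫⁻ x, ‖R.slice p ϑ t (R.latitudinal p s δ ϑ₁ ϑ₂ f) x‖ₑ ^ p.toReal
        ∂(R.weightedMeasure ϑ)) ∂ioVolume a b :=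
  R.lintegral_enorm_rpow_eq p ϑ hp hm hQ fun _ hy => R.latitudinal_of_notMem p hδ h₁₂ f fun h =>
    hy ⟨ha.trans_lt h.1, h.2.trans_le hb⟩

variable [T2Space M]

variable (p) in
lemma liftedOp_mem_HOperators (hm : IsProperMorse d m) (hs : IsAWWCutoff δ s) (hδ : 0 < δ)
    (ha : a ≤ ϑ₁ - δ) (hb : ϑ₂ + δ ≤ b) (h₁₂ : (ϑ₁ : ℝ) + δ < ϑ₂ - δ)
    {U : Set (levelSet m ϑ)} {P : Module.End ℝ (levelSet m ϑ → ℝ)}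
    (hP : P ∈ HOperatorsOn d (Subtype.val : levelSet m ϑ → M) U) :
    R.liftedOp p s δ ϑ₁ ϑ₂ ϑ P ∈ HOperators d (id : M → M) :=
  HOperatorsOn_le_HOperators _ (R.liftedOp_mem_HOperatorsOn p ϑ hm hs hδ ha hb h₁₂ hP)

variable (p) in
lemma latitudinal_mem_HOperators (hm : IsProperMorse d m) (hs : IsAWWCutoff δ s) (hδ : 0 < δ)
    (ha : a ≤ ϑ₁ - δ) (hb : ϑ₂ + δ ≤ b) (h₁₂ : (ϑ₁ : ℝ) + δ < ϑ₂ - δ) :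
    R.latitudinal p s δ ϑ₁ ϑ₂ ∈ HOperators d (id : M → M) := by
  have := hm.compactSpace_levelSet ϑ₁
  rw [← R.liftedOp_id p ϑ₁ hδ ha hb h₁₂]
  exact R.liftedOp_mem_HOperators p ϑ₁ hm hs hδ ha hb h₁₂ id_mem_HOperatorsOn_univ

variable [Fact (1 ≤ p)]

lemma lintegral_liftedOp_le (hp : p ≠ ⊤) (hm : IsProperMorse d m) (hs : IsAWWCutoff δ s)
    (hδ : 0 < δ) (ha : a ≤ ϑ₁ - δ) (hb : ϑ₂ + δ ≤ b) (h₁₂ : (ϑ₁ : ℝ) + δ < ϑ₂ - δ)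
    {U : Set (levelSet m ϑ)} {P : Module.End ℝ (levelSet m ϑ → ℝ)}
    {T : Lp ℝ p (R.weightedMeasure ϑ) →L[ℝ] Lp ℝ p (R.weightedMeasure ϑ)}
    (hP : P ∈ HOperatorsOn d (Subtype.val : levelSet m ϑ → M) U) (hT : Induces P T)
    {f : M → ℝ} (hf : Continuous f) :
    ∫⁻ y, ‖R.liftedOp p s δ ϑ₁ ϑ₂ ϑ P f y‖ₑ ^ p.toReal ∂riemannianMeasure d M ≤
      ENNReal.ofReal (awwConst p * ‖T‖) ^ p.toReal *
        ∫⁻ y, ‖f y‖ₑ ^ p.toReal ∂riemannianMeasure d M := by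
  have hp0 := toReal_pos_of_ne_top hp
  have := hm.compactSpace_levelSet ϑ
  have := R.isFiniteMeasure_weightedMeasure ϑ hm
  have hTtop : ‖T‖ₑ ^ p.toReal ≠ ⊤ := ENNReal.rpow_ne_top_of_nonneg hp0.le enorm_ne_top
  have hQ : Continuous (R.latitudinal p s δ ϑ₁ ϑ₂ f) := HOperators.continuous_apply continuous_id
    (R.latitudinal_mem_HOperators p hm hs hδ ha hb h₁₂) hf
  have hPf : Continuous (R.liftedOp p s δ ϑ₁ ϑ₂ ϑ P f) := HOperators.continuous_apply continuous_id
    (R.liftedOp_mem_HOperators p ϑ hm hs hδ ha hb h₁₂ hP) hf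
  calc ∫⁻ y, ‖R.liftedOp p s δ ϑ₁ ϑ₂ ϑ P f y‖ₑ ^ p.toReal ∂riemannianMeasure d M
      = ∫⁻ t, (∫⁻ x, ‖P (R.slice p ϑ t (R.latitudinal p s δ ϑ₁ ϑ₂ f)) x‖ₑ ^ p.toReal
          ∂(R.weightedMeasure ϑ)) ∂ioVolume a b := R.lintegral_liftedOp ϑ hp hm P hPf.measurable
    _ ≤ ∫⁻ t, ‖T‖ₑ ^ p.toReal *
          (∫⁻ x, ‖R.slice p ϑ t (R.latitudinal p s δ ϑ₁ ϑ₂ f) x‖ₑ ^ p.toReal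
            ∂(R.weightedMeasure ϑ)) ∂ioVolume a b :=
        lintegral_mono fun t => hT.lintegral_le hp (R.continuous_slice p ϑ hQ t)
    _ = ‖T‖ₑ ^ p.toReal *
          ∫⁻ y, ‖R.latitudinal p s δ ϑ₁ ϑ₂ f y‖ₑ ^ p.toReal ∂riemannianMeasure d M := by
        rw [lintegral_const_mul' _ _ hTtop,
          R.lintegral_latitudinal ϑ hp hm hδ ha hb h₁₂ hQ.measurable]
    _ ≤ ‖T‖ₑ ^ p.toReal * (ENNReal.ofReal (awwConst p) ^ p.toReal *
          ∫⁻ y, ‖f y‖ₑ ^ p.toReal ∂riemannianMeasure d M) :=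
        mul_le_mul' le_rfl (R.lintegral_latitudinal_le p hp hm hs hδ ha hb h₁₂ hf.measurable
          hQ.measurable)
    _ = _ := by
        rw [← mul_assoc, ← ENNReal.mul_rpow_of_nonneg _ _ hp0.le, ← ofReal_norm, mul_comm,
          ← ENNReal.ofReal_mul (norm_nonneg T), mul_comm ‖T‖, mul_comm]

/-- The lifted operator is bounded on `Lᵖ(M)`. -/
lemma exists_induces_liftedOp (hp : p ≠ ⊤) (hm : IsProperMorse d m) (hs : IsAWWCutoff δ s)
    (hδ : 0 < δ) (ha : a ≤ ϑ₁ - δ) (hb : ϑ₂ + δ ≤ b) (h₁₂ : (ϑ₁ : ℝ) + δ < ϑ₂ - δ)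
    {U : Set (levelSet m ϑ)} {P : Module.End ℝ (levelSet m ϑ → ℝ)}
    {T : Lp ℝ p (R.weightedMeasure ϑ) →L[ℝ] Lp ℝ p (R.weightedMeasure ϑ)}
    (hP : P ∈ HOperatorsOn d (Subtype.val : levelSet m ϑ → M) U) (hT : Induces P T) :
    ∃ S : Lp ℝ p (riemannianMeasure d M) →L[ℝ] Lp ℝ p (riemannianMeasure d M),
      Induces (R.liftedOp p s δ ϑ₁ ϑ₂ ϑ P) S ∧ ‖S‖ ≤ awwConst p * ‖T‖ := by
  have hp0 := toReal_pos_of_ne_top hp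
  have hpz : p ≠ 0 := (zero_lt_one.trans_le Fact.out).ne'
  have := ChartedSpace.locallyCompactSpace (EuclideanSpace ℝ (Fin d)) M
  have hK : 0 ≤ awwConst p * ‖T‖ :=
    mul_nonneg (zero_le_one.trans (one_le_awwConst p)) (norm_nonneg T)
  refine exists_induces hp hK fun f hf => ?_
  have hmem := R.liftedOp_mem_HOperators p ϑ hm hs hδ ha hb h₁₂ hP
  have hPf : Continuous (R.liftedOp p s δ ϑ₁ ϑ₂ ϑ P f) :=
    HOperators.continuous_apply continuous_id hmem f.continuous
  refine ⟨hPf.memLp_of_hasCompactSupport (HOperators.hasCompactSupport_apply hmem _), ?_⟩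
  rw [eLpNorm_eq_lintegral_rpow_enorm_toReal hpz hp, eLpNorm_eq_lintegral_rpow_enorm_toReal hpz hp,
    one_div, ENNReal.rpow_inv_le_iff hp0, ENNReal.mul_rpow_of_nonneg _ _ hp0.le,
    ← ENNReal.rpow_mul, inv_mul_cancel₀ hp0.ne', ENNReal.rpow_one]
  exact R.lintegral_liftedOp_le ϑ hp hm hs hδ ha hb h₁₂ hP hT f.continuous

end Lift

end StripParam

/-! ### Lifting of projections and of smooth decompositions -/

namespace StripParam

section Decomposition

variable {d : ℕ} {M : Type*} [TopologicalSpace M] [ChartedSpace (EuclideanSpace ℝ (Fin d)) M]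
  [RiemannianBundle (fun x : M => TangentSpace (𝓡 d) x)] [MeasurableSpace M]
  {m : M → ℝ} {a b : ℝ} (R : StripParam d m a b) (ϑ : Ioo a b)
  {δ : ℝ} {ϑ₁ ϑ₂ : Ioo a b}

lemma liftSet_subset (δ : ℝ) (ϑ₁ ϑ₂ : Ioo a b) (U : Set (levelSet m ϑ)) :
    R.liftSet δ ϑ₁ ϑ₂ ϑ U ⊆ m ⁻¹' Ioo ((ϑ₁ : ℝ) - δ) (ϑ₂ + δ) := by
  rintro _ ⟨t, ht, x, -, rfl⟩
  rw [mem_preimage, R.m_F]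
  exact ht

lemma isCompact_closure_liftSet (hm : IsProperMorse d m) (U : Set (levelSet m ϑ)) :
    IsCompact (closure (R.liftSet δ ϑ₁ ϑ₂ ϑ U)) := by
  refine (hm.isCompact_preimage isClosed_Icc (A := Icc ((ϑ₁ : ℝ) - δ) (ϑ₂ + δ))
    (c := ϑ₂ + δ) fun t ht => ht.2).of_isClosed_subset isClosed_closure ?_
  refine closure_minimal ?_ (isClosed_Icc.preimage hm.smooth.continuous)
  exact (R.liftSet_subset ϑ δ ϑ₁ ϑ₂ U).trans (preimage_mono Ioo_subset_Icc_self)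

lemma iUnion_liftSet (ha : a ≤ ϑ₁ - δ) (hb : ϑ₂ + δ ≤ b) {ι : Type*}
    {𝒰 : ι → Set (levelSet m ϑ)} (h : ⋃ i, 𝒰 i = univ) :
    ⋃ i, R.liftSet δ ϑ₁ ϑ₂ ϑ (𝒰 i) = m ⁻¹' Ioo ((ϑ₁ : ℝ) - δ) (ϑ₂ + δ) := by
  refine Subset.antisymm (iUnion_subset fun i => R.liftSet_subset ϑ δ ϑ₁ ϑ₂ _) fun y hy => ?_
  have hy' : m y ∈ Ioo a b := ⟨ha.trans_lt hy.1, hy.2.trans_le hb⟩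
  obtain ⟨i, hi⟩ := mem_iUnion.1 (h.symm ▸ mem_univ (R.proj ϑ ⟨y, hy'⟩))
  exact mem_iUnion.2 ⟨i, ⟨m y, hy'⟩, hy, _, hi, R.emb_proj ϑ ⟨y, hy'⟩⟩

variable [T2Space M] [SecondCountableTopology M] [IsManifold (𝓡 d) ∞ M]
  [IsContMDiffRiemannianBundle (𝓡 d) ∞ (EuclideanSpace ℝ (Fin d))
    (fun x : M => TangentSpace (𝓡 d) x)]
  [BorelSpace M] {p : ℝ≥0∞} [Fact (1 ≤ p)] {s : ℝ → ℝ}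

lemma induces_liftedOp_comp (hm : IsProperMorse d m) (hs : IsAWWCutoff δ s)
    (hδ : 0 < δ) (ha : a ≤ ϑ₁ - δ) (hb : ϑ₂ + δ ≤ b) (h₁₂ : (ϑ₁ : ℝ) + δ < ϑ₂ - δ)
    {U : Set (levelSet m ϑ)} {P P' : Module.End ℝ (levelSet m ϑ → ℝ)}
    (hP' : P' ∈ HOperatorsOn d (Subtype.val : levelSet m ϑ → M) U)
    {S S' : Lp ℝ p (riemannianMeasure d M) →L[ℝ] Lp ℝ p (riemannianMeasure d M)}
    (h : Induces (R.liftedOp p s δ ϑ₁ ϑ₂ ϑ P) S) (h' : Induces (R.liftedOp p s δ ϑ₁ ϑ₂ ϑ P') S') :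
    Induces (R.liftedOp p s δ ϑ₁ ϑ₂ ϑ (P ∘ₗ P')) (S ∘L S') := by
  have := ChartedSpace.locallyCompactSpace (EuclideanSpace ℝ (Fin d)) M
  have hmem := R.liftedOp_mem_HOperators p ϑ hm hs hδ ha hb h₁₂ hP'
  rw [← R.liftedOp_comp p ϑ hm hs hδ ha hb h₁₂]
  exact h.comp h' fun f => ⟨HOperators.continuous_apply continuous_id hmem f.continuous,
    HOperators.hasCompactSupport_apply hmem _⟩

/-- An `H`-operator on the level which induces a projection is itself idempotent, hence so is its
lifting. -/
lemma comp_self_of_induces_liftedOp (hp : p ≠ ⊤) (hm : IsProperMorse d m) (hs : IsAWWCutoff δ s)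
    (hδ : 0 < δ) (ha : a ≤ ϑ₁ - δ) (hb : ϑ₂ + δ ≤ b) (h₁₂ : (ϑ₁ : ℝ) + δ < ϑ₂ - δ)
    {U : Set (levelSet m ϑ)} {P : Module.End ℝ (levelSet m ϑ → ℝ)}
    {T : Lp ℝ p (R.weightedMeasure ϑ) →L[ℝ] Lp ℝ p (R.weightedMeasure ϑ)}
    (hP : P ∈ HOperatorsOn d (Subtype.val : levelSet m ϑ → M) U) (hT : Induces P T)
    (hTT : T ∘L T = T)
    {S : Lp ℝ p (riemannianMeasure d M) →L[ℝ] Lp ℝ p (riemannianMeasure d M)}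
    (h : Induces (R.liftedOp p s δ ϑ₁ ϑ₂ ϑ P) S) : S ∘L S = S := by
  have := ChartedSpace.locallyCompactSpace (EuclideanSpace ℝ (Fin d)) M
  have := hm.compactSpace_levelSet ϑ
  have := R.isFiniteMeasure_weightedMeasure ϑ hm
  have := R.isOpenPosMeasure_weightedMeasure ϑ hm
  have hPH := HOperatorsOn_le_HOperators U hP
  have hfd := HOperators.finitelyDetermined hPH
  have hPc : ∀ f, Continuous f → Continuous (P f) :=
    fun f hf => HOperators.continuous_apply continuous_subtype_val hPH hf
  have hPP : P ∘ₗ P = P := by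
    have h1 := hT.comp_of_compactSpace continuous_subtype_val hT hPH
    rw [hTT] at h1
    exact h1.eq_of_mem_HOperators continuous_subtype_val (hfd.comp hfd)
      (fun f hf => hPc _ (hPc f hf)) hPH hT
  have h2 := R.induces_liftedOp_comp ϑ hm hs hδ ha hb h₁₂ hP h h
  rw [hPP] at h2
  exact h2.unique hp h

/-- A smooth decomposition of identity on the level lifts to a smooth decomposition of the
latitudinal projection.  The constant is unchanged because the two-sided estimate holds on each
slice of `Q f`. -/
lemma isSmoothDecomposition_liftedOp (hp : p ≠ ⊤) (hm : IsProperMorse d m) (hs : IsAWWCutoff δ s)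
    (hδ : 0 < δ) (ha : a ≤ ϑ₁ - δ) (hb : ϑ₂ + δ ≤ b) (h₁₂ : (ϑ₁ : ℝ) + δ < ϑ₂ - δ)
    {ι : Type*} [Fintype ι] {𝒰 : ι → Set (levelSet m ϑ)}
    {P : ι → Module.End ℝ (levelSet m ϑ → ℝ)}
    {T : ι → (Lp ℝ p (R.weightedMeasure ϑ) →L[ℝ] Lp ℝ p (R.weightedMeasure ϑ))} {C : ℝ}
    (hd : IsSmoothDecomposition d (Subtype.val : levelSet m ϑ → M) univ 𝒰 P T
      (ContinuousLinearMap.id ℝ _) C)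
    {A : Lp ℝ p (riemannianMeasure d M) →L[ℝ] Lp ℝ p (riemannianMeasure d M)}
    {S : ι → (Lp ℝ p (riemannianMeasure d M) →L[ℝ] Lp ℝ p (riemannianMeasure d M))}
    (hA : Induces (R.latitudinal p s δ ϑ₁ ϑ₂) A)
    (hS : ∀ i, Induces (R.liftedOp p s δ ϑ₁ ϑ₂ ϑ (P i)) (S i)) :
    R.latitudinal p s δ ϑ₁ ϑ₂ = ∑ i, R.liftedOp p s δ ϑ₁ ϑ₂ ϑ (P i) ∧
    IsSmoothDecomposition d (id : M → M) (m ⁻¹' Ioo ((ϑ₁ : ℝ) - δ) (ϑ₂ + δ))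
      (fun i => R.liftSet δ ϑ₁ ϑ₂ ϑ (𝒰 i)) (fun i => R.liftedOp p s δ ϑ₁ ϑ₂ ϑ (P i)) S A C := by
  have := ChartedSpace.locallyCompactSpace (EuclideanSpace ℝ (Fin d)) M
  have := hm.compactSpace_levelSet ϑ
  have := R.isFiniteMeasure_weightedMeasure ϑ hm
  have := R.isOpenPosMeasure_weightedMeasure ϑ hm
  have hp0 := toReal_pos_of_ne_top hp
  have hC := hd.const_pos
  have hPH : ∀ i, P i ∈ HOperators d (Subtype.val : levelSet m ϑ → M) :=
    fun i => HOperatorsOn_le_HOperators _ (hd.localized i)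
  have hPc : ∀ i f, Continuous f → Continuous (P i f) :=
    fun i f hf => HOperators.continuous_apply continuous_subtype_val (hPH i) hf
  have hTsum : ∑ i, T i = ContinuousLinearMap.id ℝ _ := by
    refine ContinuousLinearMap.ext fun f => ?_
    rw [sum_apply]
    exact (hasSum_fintype _).unique (hd.hasSum f)
  have hPsum : ∑ i, P i = LinearMap.id := by
    have h1 := Induces.sum Finset.univ fun i _ => hd.induces i
    rw [hTsum] at h1
    have hmem : ∑ i, P i ∈ HOperators d (Subtype.val : levelSet m ϑ → M) :=
      Submodule.sum_mem _ fun i _ => hPH i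
    exact h1.eq_of_mem_HOperators continuous_subtype_val (HOperators.finitelyDetermined hmem)
      (fun f hf => HOperators.continuous_apply continuous_subtype_val hmem hf)
      (id_mem_HOperators (d := d)) Induces.id
  have hPdisj : ∀ i j, i ≠ j → P i ∘ₗ P j = 0 := by
    intro i j hij
    have h1 := (hd.induces i).comp_of_compactSpace continuous_subtype_val (hd.induces j) (hPH j)
    rw [hd.disjoint i j hij] at h1
    exact h1.eq_of_mem_HOperators continuous_subtype_val
      ((HOperators.finitelyDetermined (hPH i)).comp (HOperators.finitelyDetermined (hPH j)))
      (fun f hf => hPc i _ (hPc j f hf)) (HOperators d _).zero_mem Induces.zero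
  have hQsum : R.latitudinal p s δ ϑ₁ ϑ₂ = ∑ i, R.liftedOp p s δ ϑ₁ ϑ₂ ϑ (P i) := by
    rw [← R.liftedOp_id p ϑ hδ ha hb h₁₂, ← hPsum, liftedOp_sum]
  have hSsum : ∑ i, S i = A := by
    have h1 := Induces.sum Finset.univ fun i _ => hS i
    rw [← hQsum] at h1
    exact h1.unique hp hA
  have hmem : ∀ i, R.liftedOp p s δ ϑ₁ ϑ₂ ϑ (P i) ∈ HOperators d (id : M → M) :=
    fun i => R.liftedOp_mem_HOperators p ϑ hm hs hδ ha hb h₁₂ (hd.localized i)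
  -- both sides of the two-sided estimate, as integrals over `I` of norms on the level
  have hcontS : ∀ (f : C₀(M, ℝ)) i, Continuous (R.liftedOp p s δ ϑ₁ ϑ₂ ϑ (P i) f) :=
    fun f i => HOperators.continuous_apply continuous_id (hmem i) f.continuous
  have hcontQ : ∀ f : C₀(M, ℝ), Continuous (R.latitudinal p s δ ϑ₁ ϑ₂ f) :=
    fun f => HOperators.continuous_apply continuous_id
      (R.latitudinal_mem_HOperators p hm hs hδ ha hb h₁₂) f.continuous
  have hcont : ∀ (f : C₀(M, ℝ)) (t : ℝ),
      Continuous (R.slice p ϑ t (R.latitudinal p s δ ϑ₁ ϑ₂ f)) :=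
    fun f t => R.continuous_slice p ϑ (hcontQ f) t
  have hnormS : ∀ (f : C₀(M, ℝ)) (hf : MemLp (f : M → ℝ) p (riemannianMeasure d M)),
      ∑ i, ‖S i (hf.toLp f)‖ₑ ^ p.toReal = ∫⁻ t : Ioo a b, ∑ i,
        ‖T i ((hcont f t).memLp_of_compactSpace.toLp _)‖ₑ ^ p.toReal ∂ioVolume a b := by
    intro f hf
    have h1 : ∀ i, Measurable fun t : Ioo a b =>
        ‖T i ((hcont f t).memLp_of_compactSpace.toLp _)‖ₑ ^ p.toReal := by
      intro i
      have h2 := ((R.measurable_slice p ϑ (hcontS f i).measurable).enorm.pow_const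
        p.toReal).lintegral_prod_right' (ν := R.weightedMeasure ϑ)
      refine (congrArg Measurable (funext fun t => ?_)).mp h2
      rw [← (hd.induces i).lintegral_eq hp (hcont f t)]
      simp only [slice_liftedOp]
    rw [lintegral_finsetSum _ fun i _ => h1 i]
    refine Finset.sum_congr rfl fun i _ => ?_
    rw [(hS i).apply_eq f hf, enorm_toLp_rpow hp,
      R.lintegral_liftedOp ϑ hp hm (P i) (hcontS f i).measurable]
    exact lintegral_congr fun t => (hd.induces i).lintegral_eq hp (hcont f t)
  have hnormA : ∀ (f : C₀(M, ℝ)) (hf : MemLp (f : M → ℝ) p (riemannianMeasure d M)),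
      ‖A (hf.toLp f)‖ₑ ^ p.toReal = ∫⁻ t : Ioo a b,
        ‖((hcont f t).memLp_of_compactSpace.toLp _ : Lp ℝ p (R.weightedMeasure ϑ))‖ₑ ^ p.toReal
          ∂ioVolume a b := by
    intro f hf
    rw [hA.apply_eq f hf, enorm_toLp_rpow hp,
      R.lintegral_latitudinal ϑ hp hm hδ ha hb h₁₂ (hcontQ f).measurable]
    exact lintegral_congr fun t => (enorm_toLp_rpow hp _).symm
  have hCtop : ENNReal.ofReal C ^ p.toReal ≠ ⊤ :=
    ENNReal.rpow_ne_top_of_nonneg hp0.le ENNReal.ofReal_ne_top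
  have hcsum : Continuous fun f : Lp ℝ p (riemannianMeasure d M) =>
      (∑' i, ‖S i f‖ ^ p.toReal) ^ (1 / p.toReal) := by
    simp only [tsum_fintype]
    refine (continuous_finsetSum _ fun i _ => ?_).rpow_const fun _ => Or.inr (by positivity)
    exact ((S i).continuous.norm).rpow_const fun _ => Or.inr hp0.le
  have hcA : ∀ c : ℝ, Continuous fun f : Lp ℝ p (riemannianMeasure d M) => c * ‖A f‖ :=
    fun c => continuous_const.mul A.continuous.norm
  refine ⟨hQsum, ?_⟩
  exact
    { isOpen := fun i => R.isOpen_liftSet ϑ hm.smooth.continuous δ ϑ₁ ϑ₂ (hd.isOpen i)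
      precompact := fun i => R.isCompact_closure_liftSet ϑ hm (𝒰 i)
      cover := R.iUnion_liftSet ϑ ha hb hd.cover
      locallyFinite := fun _ _ => toFinite _
      localized := fun i => R.liftedOp_mem_HOperatorsOn p ϑ hm hs hδ ha hb h₁₂ (hd.localized i)
      induces := hS
      projection := fun i => R.comp_self_of_induces_liftedOp ϑ hp hm hs hδ ha hb h₁₂
        (hd.localized i) (hd.induces i) (hd.projection i) (hS i)
      disjoint := fun i j hij => by
        have h1 := R.induces_liftedOp_comp ϑ hm hs hδ ha hb h₁₂ (hd.localized j) (hS i) (hS j)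
        rw [hPdisj i j hij, liftedOp_zero] at h1
        exact h1.unique hp Induces.zero
      hasSum := fun f => by
        rw [← hSsum, sum_apply]
        exact hasSum_fintype _
      const_pos := hC
      summable := fun f => Summable.of_finite
      lower := fun f => by
        refine Lp_induction_c0 hp (isClosed_le (hcA (1 / C)) hcsum) (fun f hf => ?_) f
        rw [le_rpow_sum_iff hp0 hC, hnormS f hf, hnormA f hf, ← lintegral_const_mul' _ _ hCtop]
        exact lintegral_mono fun t => (le_rpow_sum_iff hp0 hC _ _).1 (hd.lower _)
      upper := fun f => by
        refine Lp_induction_c0 hp (isClosed_le hcsum (hcA C)) (fun f hf => ?_) f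
        rw [rpow_sum_le_iff hp0 hC, hnormS f hf, hnormA f hf, ← lintegral_const_mul' _ _ hCtop]
        exact lintegral_mono fun t => (rpow_sum_le_iff hp0 hC _ _).1 (hd.upper _) }

end Decomposition

end StripParam

theorem mainTheorem5
    {d : ℕ} (hd : 2 ≤ d) {M : Type*} [TopologicalSpace M] [T2Space M] [SecondCountableTopology M]
    [ConnectedSpace M] [ChartedSpace (EuclideanSpace ℝ (Fin d)) M] [IsManifold (𝓡 d) ∞ M]
    [RiemannianBundle (fun x : M => TangentSpace (𝓡 d) x)]
    [IsContMDiffRiemannianBundle (𝓡 d) ∞ (EuclideanSpace ℝ (Fin d))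
      (fun x : M => TangentSpace (𝓡 d) x)]
    [MeasurableSpace M] [BorelSpace M]
    {m : M → ℝ} (hm : IsProperMorse d m)
    {p : ℝ≥0∞} [Fact (1 ≤ p)] (hp : p ≠ ⊤)
    {δ : ℝ} (hδ : 0 < δ) {s : ℝ → ℝ} (hs : IsAWWCutoff δ s)
    {a b : ℝ} (hreg : ∀ x, m x ∈ Set.Icc a b → ¬ IsCritical d m x) (R : StripParam d m a b)
    (ϑ₁ ϑ₂ ϑ : Set.Ioo a b) (ha : a ≤ ϑ₁ - δ) (hb : ϑ₂ + δ ≤ b) (h₁₂ : (ϑ₁ : ℝ) + δ < ϑ₂ - δ)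
    (hϑ : (ϑ : ℝ) ∈ Set.Icc (ϑ₁ : ℝ) ϑ₂) :
    -- lifting of a single projection
    (∀ (U : Set (levelSet m ϑ)) (P : Module.End ℝ (levelSet m ϑ → ℝ))
      (T : Lp ℝ p (R.weightedMeasure ϑ) →L[ℝ] Lp ℝ p (R.weightedMeasure ϑ)),
      IsOpen U → P ∈ HOperatorsOn d (Subtype.val : levelSet m ϑ → M) U →
      Induces P T → T ∘L T = T →
      R.globalLift p ϑ P ∘ₗ R.latitudinal p s δ ϑ₁ ϑ₂
          = R.latitudinal p s δ ϑ₁ ϑ₂ ∘ₗ R.globalLift p ϑ P ∧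
        R.liftedOp p s δ ϑ₁ ϑ₂ ϑ P ∈ HOperators d (id : M → M) ∧
        IsOpen (R.liftSet δ ϑ₁ ϑ₂ ϑ U) ∧
        R.liftedOp p s δ ϑ₁ ϑ₂ ϑ P ∈ HOperatorsOn d (id : M → M) (R.liftSet δ ϑ₁ ϑ₂ ϑ U) ∧
        ∃ S : Lp ℝ p (riemannianMeasure d M) →L[ℝ] Lp ℝ p (riemannianMeasure d M),
          Induces (R.liftedOp p s δ ϑ₁ ϑ₂ ϑ P) S ∧ S ∘L S = S ∧ ‖S‖ ≤ awwConst p * ‖T‖) ∧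
    -- lifting of a smooth decomposition of identity subordinate to a finite open cover
    (∀ (ι : Type*) [Finite ι] (𝒰 : ι → Set (levelSet m ϑ))
      (P : ι → Module.End ℝ (levelSet m ϑ → ℝ))
      (T : ι → (Lp ℝ p (R.weightedMeasure ϑ) →L[ℝ] Lp ℝ p (R.weightedMeasure ϑ))) (C : ℝ),
      IsSmoothDecomposition d (Subtype.val : levelSet m ϑ → M) Set.univ 𝒰 P T
        (ContinuousLinearMap.id ℝ _) C →
      R.latitudinal p s δ ϑ₁ ϑ₂ = ∑ᶠ i, R.liftedOp p s δ ϑ₁ ϑ₂ ϑ (P i) ∧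
        ∃ (A : Lp ℝ p (riemannianMeasure d M) →L[ℝ] Lp ℝ p (riemannianMeasure d M))
          (S : ι → (Lp ℝ p (riemannianMeasure d M) →L[ℝ] Lp ℝ p (riemannianMeasure d M))),
          Induces (R.latitudinal p s δ ϑ₁ ϑ₂) A ∧
          IsSmoothDecomposition d (id : M → M) (m ⁻¹' Set.Ioo ((ϑ₁ : ℝ) - δ) (ϑ₂ + δ))
            (fun i => R.liftSet δ ϑ₁ ϑ₂ ϑ (𝒰 i)) (fun i => R.liftedOp p s δ ϑ₁ ϑ₂ ϑ (P i)) S A C ∧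
          (p = 2 → (∀ i, IsSymmetricLp (T i)) → ∀ i, IsSymmetricLp (S i))) := by
  constructor
  · intro U P T hU hP hT hTT
    obtain ⟨S, hS, hSn⟩ := R.exists_induces_liftedOp ϑ hp hm hs hδ ha hb h₁₂ hP hT
    exact ⟨R.globalLift_comp_latitudinal p ϑ hm hs hδ ha hb h₁₂ P,
      R.liftedOp_mem_HOperators p ϑ hm hs hδ ha hb h₁₂ hP,
      R.isOpen_liftSet ϑ hm.smooth.continuous δ ϑ₁ ϑ₂ hU,
      R.liftedOp_mem_HOperatorsOn p ϑ hm hs hδ ha hb h₁₂ hP, S, hS,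
      R.comp_self_of_induces_liftedOp ϑ hp hm hs hδ ha hb h₁₂ hP hT hTT hS, hSn⟩
  · intro ι _ 𝒰 P T C hdec
    have := Fintype.ofFinite ι
    have := hm.compactSpace_levelSet ϑ
    -- the latitudinal projection is the lifting of the identity
    obtain ⟨A, hA, -⟩ := R.exists_induces_liftedOp ϑ hp hm hs hδ ha hb h₁₂
      (id_mem_HOperatorsOn_univ (d := d) (e := (Subtype.val : levelSet m ϑ → M)))
      (Induces.id (p := p) (μ := R.weightedMeasure ϑ))
    rw [R.liftedOp_id p ϑ hδ ha hb h₁₂] at hA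
    choose S hS hSn using fun i => R.exists_induces_liftedOp ϑ hp hm hs hδ ha hb h₁₂
      (hdec.localized i) (hdec.induces i)
    obtain ⟨hsum, hlift⟩ :=
      R.isSmoothDecomposition_liftedOp ϑ hp hm hs hδ ha hb h₁₂ hdec hA hS
    refine ⟨by rw [finsum_eq_sum_of_fintype, hsum], A, S, hA, hlift, ?_⟩
    rintro rfl hsym i
    have hT1 : ‖T i‖ ≤ 1 := ContinuousLinearMap.norm_le_one_of_comp_self_of_isSymmetric
      (hdec.projection i) (isSymmetricLp_iff.1 (hsym i))
    refine isSymmetricLp_iff.2 (ContinuousLinearMap.isSymmetric_of_comp_self_of_norm_le_one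
      (hlift.projection i) ((hSn i).trans ?_))
    exact mul_le_one₀ awwConst_two_le (norm_nonneg _) hT1
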